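/- For a complex matrix $\mathbf z\in M^{m,n}(\mathbb C)$ with $m$ rows and $n$ columns put $V(\mathbf z)=I_m-\mathbf z\mathbf z^{*}$, with entries $V_{jk}=\delta_{jk}-\sum_{\ell=1}^n z_{j\ell}\overline{z_{k\ell}}$. For positive integers $m\le n$ let $$\mathbf I(m,n)=\{\mathbf z\in M^{m,n}(\mathbb C): V(\mathbf z)>0\},\quad \mathbf{II}(n)=\{\mathbf z\in \mathbf I(n,n):\mathbf z^{t}=\mathbf z\},\quad \mathbf{III}(n)=\{\mathbf z\in \mathbf I(n,n):\mathbf z^{t}=-\mathbf z\},$$ where $>0$ means positive definite. These are regarded as bounded domains in $\mathbb C^N$ with coordinates $z_{j\alpha}$ (all $j,\alpha$) for $\mathbf I(m,n)$, $z_{j\alpha}$ ($j\le\alpha$) for $\mathbf{II}(n)$, and $z_{j\alpha}$ ($j<\alpha$) for $\mathbf{III}(n)$. On $\mathbf{II}(n)$ one writes $\partial/\partial z_{\alpha j}=\partial/\partial z_{j\alpha}$, and on $\mathbf{III}(n)$ one writes $\partial/\partial z_{\alpha j}=-\partial/\partial z_{j\alpha}$ and $\partial/\partial z_{jj}=0$;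 likewise for $\partial/\partial\bar z_{j\alpha}$. For a bounded domain $D\subset\mathbb C^N$ let $K(z,z)=\sup\{|f(z)|^2: f \text{ holomorphic on } D,\ \int_D|f|^2\le 1\}$ be its Bergman kernel on the diagonal and $g_{p\bar q}=\partial^2\log K(z,z)/\partial z_p\partial\bar z_q$ its Bergman metric. The Laplace–Beltrami operator of the Bergman metric (the Hua operator, when $D$ is one of the above domains) is, up to a positive constant factor, $\sum_{p,q} g^{p\bar q}\,\partial^2/\partial z_p\partial\bar z_q$, where $\sum_q g^{p\bar q}g_{r\bar q}=\delta_{pr}$. Let $\Delta_1,\Delta_2,\Delta_3$ be the Hua operators of $\mathbf I(m,n)$, $\mathbf{II}(n)$, $\mathbf{III}(n)$ respectively. Define the second-order operators $$\Delta_1^{jk}=\sum_{\alpha,\beta=1}^n\Big(\delta_{\alpha\beta}-\sum_{\ell=1}^m z_{\ell\alpha}\overline{z_{\ell\beta}}\Big)\frac{\partial^2}{\partial z_{j\alpha}\partial\bar z_{k\beta}},\qquad 1\le j,k\le m,$$ $$\Delta_2^{jk}=\sum_{\alpha,\beta=1}^n\frac{V_{\alpha\beta}}{(1-\delta_{j\alpha}/2)(1-\delta_{k\beta}/2)}\frac{\partial^2}{\partial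 z_{j\alpha}\partial\bar z_{k\beta}},\qquad \Delta_3^{jk}=\sum_{\alpha,\beta=1}^n V_{\alpha\beta}(1-\delta_{j\alpha})(1-\delta_{k\beta})\frac{\partial^2}{\partial z_{j\alpha}\partial\bar z_{k\beta}},\qquad 1\le j,k\le n.$$ **Theorem 2.2.** Let $m\le n$ be positive integers, let $D$ be the domain named in each part, and let $u\in C^2(D)\cap C(\overline D)$ be complex-valued. Then: (i) for $D=\mathbf I(m,n)$: $\Delta_1u=0$ on $D$ if and only if $\Delta_1^{jk}u=0$ on $D$ for all $1\le j,k\le m$; (ii) for $D=\mathbf{II}(n)$: $\Delta_2u=0$ on $D$ if and only if $\Delta_2^{jk}u=0$ on $D$ for all $1\le j,k\le n$; (iii) for $D=\mathbf{III}(n)$ with $n$ even: $\Delta_3u=0$ on $D$ if and only if $\Delta_3^{jk}u=0$ on $D$ for all $1\le j,k\le n$. -/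

import Mathlib

open scoped BigOperators Matrix ComplexConjugate ComplexOrder

noncomputable section

/-! ### Complex calculus and the Bergman metric on open sets of `ℂ^ι` -/

section Bergman

variable {ι : Type*} [Fintype ι] [DecidableEq ι]

/-- The `(1,0)`-derivative of `f` at `z` in the direction `v`, i.e. `∑ i, v i * ∂f/∂z_i`. -/
def dz (v : ι → ℂ) (f : (ι → ℂ) → ℂ) (z : ι → ℂ) : ℂ :=
  (1 / 2 : ℂ) * (fderiv ℝ f z v - Complex.I * fderiv ℝ f z (Complex.I • v))

/-- The `(0,1)`-derivative of `f` at `z` in the direction `v`,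
i.e. `∑ i, conj (v i) * ∂f/∂(conj z_i)`. -/
def dzbar (v : ι → ℂ) (f : (ι → ℂ) → ℂ) (z : ι → ℂ) : ℂ :=
  (1 / 2 : ℂ) * (fderiv ℝ f z v + Complex.I * fderiv ℝ f z (Complex.I • v))

/-- The mixed second derivative of `f` at `z`: first `dzbar w`, then `dz v`. -/
def mixedDeriv (v w : ι → ℂ) (f : (ι → ℂ) → ℂ) (z : ι → ℂ) : ℂ :=
  dz v (dzbar w f) z

/-- The complex Hessian `(∂²f / ∂z_i ∂(conj z_j))_{i,j}`. -/
def complexHessian (f : (ι → ℂ) → ℂ) (z : ι → ℂ) : Matrix ι ι ℂ :=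
  Matrix.of fun i j => mixedDeriv (Pi.single i 1) (Pi.single j 1) f z

/-- The Bergman kernel of `D` on the diagonal, `K(z,z)`: the supremum of `|f(z)|²` over all
holomorphic `f` on `D` whose `L²(D)`-norm with respect to Lebesgue measure is at most one. -/
def bergmanKernelDiag (D : Set (ι → ℂ)) (z : ι → ℂ) : ℝ :=
  sSup {r : ℝ | ∃ f : (ι → ℂ) → ℂ, DifferentiableOn ℂ f D ∧
    (∫⁻ w in D, ‖f w‖ₑ ^ 2) ≤ 1 ∧ r = ‖f z‖ ^ 2}

/-- The Bergman metric `g_{i j} = ∂² log K(z,z) / ∂z_i ∂(conj z_j)`. -/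
def bergmanMetric (D : Set (ι → ℂ)) (z : ι → ℂ) : Matrix ι ι ℂ :=
  complexHessian (fun w => ((Real.log (bergmanKernelDiag D w) : ℝ) : ℂ)) z

/-- The Laplace-Beltrami operator of a Kähler metric `g`, in the usual normalization of complex
analysis: `Δ_g u = ∑_{i,j} g^{i j} ∂²u / ∂z_i ∂(conj z_j)`, where
`∑_j g^{i j} g_{k j} = δ_{i k}`, that is `g^{i j} = (g⁻¹)_{j i}`. -/
def kaehlerLaplacian (g : (ι → ℂ) → Matrix ι ι ℂ) (u : (ι → ℂ) → ℂ) (z : ι → ℂ) : ℂ :=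
  ∑ i, ∑ j, (g z)⁻¹ j i * mixedDeriv (Pi.single i 1) (Pi.single j 1) u z

/-- The Laplace-Beltrami operator of the Bergman metric of `D` (for a bounded symmetric domain,
the Hua operator). -/
def huaOperator (D : Set (ι → ℂ)) (u : (ι → ℂ) → ℂ) (z : ι → ℂ) : ℂ :=
  kaehlerLaplacian (bergmanMetric D) u z

end Bergman

/-- `V(z) = I - z z*`. -/
def matV {m n : ℕ} (z : Matrix (Fin m) (Fin n) ℂ) : Matrix (Fin m) (Fin m) ℂ :=
  1 - z * zᴴ

/-- The Kronecker symbol, as a complex number. -/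
def kron {n : ℕ} (j k : Fin n) : ℂ := if j = k then 1 else 0

/-! ### Type I: all `m × n` matrices, with their entries as coordinates -/

/-- The matrix with entries `z_{jα} = x (j, α)`. -/
def matI {m n : ℕ} (x : Fin m × Fin n → ℂ) : Matrix (Fin m) (Fin n) ℂ :=
  Matrix.of fun j α => x (j, α)

/-- The domain `I(m,n)` in the coordinates `z_{jα}`. -/
def domI (m n : ℕ) : Set (Fin m × Fin n → ℂ) := {x | (matV (matI x)).PosDef}

/-- `Δ₁^{jk}`. -/
def sysI {m n : ℕ} (j k : Fin m) (u : (Fin m × Fin n → ℂ) → ℂ) (x : Fin m × Fin n → ℂ) : ℂ :=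
  ∑ α : Fin n, ∑ β : Fin n,
    (kron α β - ∑ l : Fin m, matI x l α * conj (matI x l β)) *
      mixedDeriv (Pi.single (j, α) 1) (Pi.single (k, β) 1) u x

/-! ### Type II: symmetric matrices; the independent coordinates are `z_{jα} = z_{αj}`, one for
each unordered pair `s(j, α)` -/

/-- The symmetric matrix with entries `z_{jα} = x s(j, α)`. -/
def matII {n : ℕ} (x : Sym2 (Fin n) → ℂ) : Matrix (Fin n) (Fin n) ℂ :=
  Matrix.of fun j α => x s(j, α)

/-- The domain `II(n)` in the coordinates `z_{jα}`, `j ≤ α`. -/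
def domII (n : ℕ) : Set (Sym2 (Fin n) → ℂ) := {x | (matV (matII x)).PosDef}

/-- `Δ₂^{jk}`. -/
def sysII {n : ℕ} (j k : Fin n) (u : (Sym2 (Fin n) → ℂ) → ℂ) (x : Sym2 (Fin n) → ℂ) : ℂ :=
  ∑ α : Fin n, ∑ β : Fin n,
    matV (matII x) α β / ((1 - kron j α / 2) * (1 - kron k β / 2)) *
      mixedDeriv (Pi.single s(j, α) 1) (Pi.single s(k, β) 1) u x

/-! ### Type III: antisymmetric matrices; the independent coordinates are `z_{jα}`, `j < α` -/

/-- The index set `{(j, α) : j < α}` of the coordinates on antisymmetric matrices. -/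
abbrev SkewIdx (n : ℕ) : Type := {p : Fin n × Fin n // p.1 < p.2}

/-- The antisymmetric matrix with entries `z_{jα} = x (j, α)` for `j < α`. -/
def matIII {n : ℕ} (x : SkewIdx n → ℂ) : Matrix (Fin n) (Fin n) ℂ :=
  Matrix.of fun j α =>
    if h : j < α then x ⟨(j, α), h⟩ else if h : α < j then -x ⟨(α, j), h⟩ else 0

/-- The domain `III(n)` in the coordinates `z_{jα}`, `j < α`. -/
def domIII (n : ℕ) : Set (SkewIdx n → ℂ) := {x | (matV (matIII x)).PosDef}

/-- The coordinates of the antisymmetric matrix `E_{jα} - E_{αj}`. Differentiation in this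
direction is `∂/∂z_{jα}`; thus `∂/∂z_{jα} = -∂/∂z_{αj}`, as `z_{jα} = -z_{αj}`. -/
def dirIII {n : ℕ} (j α : Fin n) : SkewIdx n → ℂ :=
  fun p => if p.1 = (j, α) then 1 else if p.1 = (α, j) then -1 else 0

/-- `Δ₃^{jk}`. -/
def sysIII {n : ℕ} (j k : Fin n) (u : (SkewIdx n → ℂ) → ℂ) (x : SkewIdx n → ℂ) : ℂ :=
  ∑ α : Fin n, ∑ β : Fin n,
    matV (matIII x) α β * (1 - kron j α) * (1 - kron k β) *
      mixedDeriv (dirIII j α) (dirIII k β) u x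

end

/-!
The implication from the system to the Laplace equation is formal: on the domain the Hua operator
is a positive multiple of `∑ V_{jk} Δ^{jk}` (`huaOperator_dom`). To see this, one needs the Bergman
kernel only up to a constant. The transformation rule of the extremal problem that defines it and
the Möbius automorphisms `mob`, which move `0` to any point, show that it is a multiple of
`det V(z) ^ (-p)`, and `∂∂̄ log det V` is computed from `V` and `W = I - z* z`.

For the converse, the automorphisms reduce the claim to the origin
(`huaOperator_eq_zero_iff_sys_eq_zero`). There `∑ Δ^{jj} u = 0`, and all `Δ^{jk} u` must be shown to
vanish. The idea is to average `u`, with suitable weights, over the unitary automorphisms of the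
domain in such a way that the average is constant on the Shilov boundary `V = 0`. The average is
again a solution, hence is constant by a maximum principle on the Shilov boundary, and its second
derivatives at `0` are averages of those of `u` (`integral_sys_zero_eq_zero`).

* For all matrices, the right action `z ↦ z k` of the unitary group is transitive on the Shilov
  boundary and leaves the operators `Δ^{jk}` at `0` invariant; no weights are needed
  (`sys_zero_eq_zero_of_surjective`).
* For symmetric and antisymmetric matrices, the group acts by `z ↦ k* z k̄`, and the weights are the
  entries of `k M k*`, where `M` is the conjugate of the matrix `(Δ^{jk} u (0))`, of trace zero. At
  a point of the Shilov boundary, the averages form a matrix of trace zero that commutes with the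
  stabilizer of the point, an orthogonal or symplectic group. That group acts irreducibly, so the
  matrix is zero, and the mean of the squares of the entries of `k M k*` vanishes, hence `M = 0`
  (`sys_zero_eq_zero_of_stabilizer`).

The maximum principle (`re_le_of_lap_eq_zero`) compares `u`, which is merely continuous up to the
boundary, with the barrier `(tr V)^{1/4} (det V)^{-ε}`, which is strictly superharmonic for small
`ε` and infinite on the boundary outside the Shilov boundary. This is where the parity of `n`
matters for antisymmetric matrices: the proof of superharmonicity uses `2 tr V² ≤ (tr V)²`
(`two_mul_trace_sq_le`), which holds because the eigenvalues of `V` come in pairs. For odd `n`, no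
antisymmetric matrix satisfies `V = 0`.

The three types are treated together, as instances of the structure `CartanData`.
-/

open Filter Topology MeasureTheory
open scoped Pointwise

set_option linter.unusedSectionVars false

/-! ### Calculus of the mixed derivatives -/

section Calculus

variable {ι : Type*} [Fintype ι]

theorem dz_eq_of_hasFDerivAt {f : (ι → ℂ) → ℂ} {x : ι → ℂ} {f' : (ι → ℂ) →L[ℝ] ℂ}
    (hf : HasFDerivAt f f' x) {A B : (ι → ℂ) → ℂ} (h : ∀ v, f' v = A v + B v)
    (hA : ∀ v, A (Complex.I • v) = Complex.I * A v)
    (hB : ∀ v, B (Complex.I • v) = -(Complex.I * B v)) (v : ι → ℂ) : dz v f x = A v := by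
  rw [dz, hf.fderiv, h, h, hA, hB]
  linear_combination (-(1 / 2 : ℂ) * (A v - B v)) * Complex.I_sq

theorem dzbar_eq_of_hasFDerivAt {f : (ι → ℂ) → ℂ} {x : ι → ℂ} {f' : (ι → ℂ) →L[ℝ] ℂ}
    (hf : HasFDerivAt f f' x) {A B : (ι → ℂ) → ℂ} (h : ∀ v, f' v = A v + B v)
    (hA : ∀ v, A (Complex.I • v) = Complex.I * A v)
    (hB : ∀ v, B (Complex.I • v) = -(Complex.I * B v)) (v : ι → ℂ) : dzbar v f x = B v := by
  rw [dzbar, hf.fderiv, h, h, hA, hB]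
  linear_combination ((1 / 2 : ℂ) * (A v - B v)) * Complex.I_sq

theorem dz_congr {f g : (ι → ℂ) → ℂ} {x : ι → ℂ} (h : f =ᶠ[𝓝 x] g) (v : ι → ℂ) :
    dz v f x = dz v g x := by
  rw [dz, dz, h.fderiv_eq]

theorem dzbar_congr {f g : (ι → ℂ) → ℂ} {x : ι → ℂ} (h : f =ᶠ[𝓝 x] g) (v : ι → ℂ) :
    dzbar v f x = dzbar v g x := by
  rw [dzbar, dzbar, h.fderiv_eq]

theorem mixedDeriv_congr {f g : (ι → ℂ) → ℂ} {x : ι → ℂ} (h : f =ᶠ[𝓝 x] g) (v w : ι → ℂ) :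
    mixedDeriv v w f x = mixedDeriv v w g x := by
  refine dz_congr ?_ v
  filter_upwards [h.eventuallyEq_nhds] with y hy using dzbar_congr hy w

/-- The mixed derivative from the derivatives `A`, `A'` of the two directional derivatives that
make up `dzbar w u`. -/
theorem mixedDeriv_of_eventuallyEq {u : (ι → ℂ) → ℂ} {x v w : ι → ℂ} {G G' : (ι → ℂ) → ℂ}
    {A A' : (ι → ℂ) →L[ℝ] ℂ} (hG : (fun y => fderiv ℝ u y w) =ᶠ[𝓝 x] G)
    (hG' : (fun y => fderiv ℝ u y (Complex.I • w)) =ᶠ[𝓝 x] G')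
    (hA : HasFDerivAt G A x) (hA' : HasFDerivAt G' A' x) :
    mixedDeriv v w u x = (1 / 4 : ℂ) * (A v + Complex.I * A' v - Complex.I * A (Complex.I • v)
      + A' (Complex.I • v)) := by
  have h1 : dzbar w u =ᶠ[𝓝 x] fun y => (1 / 2 : ℂ) * (G y + Complex.I * G' y) := by
    filter_upwards [hG, hG'] with y h1 h2
    rw [dzbar, h1, h2]
  have h2 : HasFDerivAt (fun y => (1 / 2 : ℂ) * (G y + Complex.I * G' y))
      ((1 / 2 : ℂ) • (A + Complex.I • A')) x :=
    (hA.add (hA'.const_mul Complex.I)).const_mul (1 / 2 : ℂ)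
  rw [mixedDeriv, dz_congr h1, dz, h2.fderiv]
  simp only [smul_eq_mul, smul_apply, add_apply]
  linear_combination (-(1 / 4 : ℂ) * A' (Complex.I • v)) * Complex.I_sq

/-- The mixed derivative in terms of the real second derivative. -/
theorem mixedDeriv_eq {u : (ι → ℂ) → ℂ} {x : ι → ℂ} (hu : ContDiffAt ℝ 2 u x) (v w : ι → ℂ) :
    mixedDeriv v w u x = (1 / 4 : ℂ) * (fderiv ℝ (fderiv ℝ u) x v w
      + Complex.I * fderiv ℝ (fderiv ℝ u) x v (Complex.I • w)
      - Complex.I * fderiv ℝ (fderiv ℝ u) x (Complex.I • v) w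
      + fderiv ℝ (fderiv ℝ u) x (Complex.I • v) (Complex.I • w)) := by
  have h1 : HasFDerivAt (fderiv ℝ u) (fderiv ℝ (fderiv ℝ u) x) x :=
    ((hu.fderiv_right (m := 1) (by norm_num)).differentiableAt (by norm_num)).hasFDerivAt
  have h2 : ∀ w, HasFDerivAt (fun y => fderiv ℝ u y w)
      ((ContinuousLinearMap.apply ℝ ℂ w).comp (fderiv ℝ (fderiv ℝ u) x)) x := fun w =>
    (ContinuousLinearMap.apply ℝ ℂ w).hasFDerivAt.comp x h1
  rw [mixedDeriv_of_eventuallyEq EventuallyEq.rfl EventuallyEq.rfl (h2 w) (h2 _)]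
  simp

theorem mixedDeriv_add_left {u : (ι → ℂ) → ℂ} {x : ι → ℂ} (hu : ContDiffAt ℝ 2 u x)
    (v v' w : ι → ℂ) :
    mixedDeriv (v + v') w u x = mixedDeriv v w u x + mixedDeriv v' w u x := by
  simp only [mixedDeriv_eq hu, smul_add, map_add, add_apply]
  ring

theorem mixedDeriv_add_right {u : (ι → ℂ) → ℂ} {x : ι → ℂ} (hu : ContDiffAt ℝ 2 u x)
    (v w w' : ι → ℂ) :
    mixedDeriv v (w + w') u x = mixedDeriv v w u x + mixedDeriv v w' u x := by
  simp only [mixedDeriv_eq hu, smul_add, map_add]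
  ring

theorem smul_eq_re_im (a : ℂ) (v : ι → ℂ) : a • v = a.re • v + a.im • (Complex.I • v) := by
  ext i
  simp only [Pi.smul_apply, Pi.add_apply, smul_eq_mul, Complex.real_smul]
  linear_combination (v i) * (Complex.re_add_im a).symm

theorem mixedDeriv_smul_left {u : (ι → ℂ) → ℂ} {x : ι → ℂ} (hu : ContDiffAt ℝ 2 u x)
    (a : ℂ) (v w : ι → ℂ) :
    mixedDeriv (a • v) w u x = a * mixedDeriv v w u x := by
  have hI : Complex.I • a • v = a.re • (Complex.I • v) + (-a.im) • v := by
    ext i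
    simp only [Pi.smul_apply, Pi.add_apply, smul_eq_mul, Complex.real_smul]
    push_cast
    linear_combination (-(Complex.I * v i)) * (Complex.re_add_im a) + a.im * v i * Complex.I_sq
  rw [mixedDeriv_eq hu, mixedDeriv_eq hu, hI, smul_eq_re_im a v]
  simp only [map_add, map_smul, add_apply, smul_apply,
    Complex.real_smul]
  set P := fderiv ℝ (fderiv ℝ u) x v w
  set R := fderiv ℝ (fderiv ℝ u) x v (Complex.I • w)
  set S := fderiv ℝ (fderiv ℝ u) x (Complex.I • v) w
  set T := fderiv ℝ (fderiv ℝ u) x (Complex.I • v) (Complex.I • w)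
  push_cast
  linear_combination (1 / 4 * (P + Complex.I * R - Complex.I * S + T)) * (Complex.re_add_im a)
    + (1 / 4 * a.im * (S - R)) * Complex.I_sq

theorem mixedDeriv_smul_right {u : (ι → ℂ) → ℂ} {x : ι → ℂ} (hu : ContDiffAt ℝ 2 u x)
    (a : ℂ) (v w : ι → ℂ) :
    mixedDeriv v (a • w) u x = conj a * mixedDeriv v w u x := by
  have hI : Complex.I • a • w = a.re • (Complex.I • w) + (-a.im) • w := by
    ext i
    simp only [Pi.smul_apply, Pi.add_apply, smul_eq_mul, Complex.real_smul]
    push_cast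
    linear_combination (-(Complex.I * w i)) * (Complex.re_add_im a) + a.im * w i * Complex.I_sq
  have hc : conj a = (a.re : ℂ) - a.im * Complex.I :=
    Complex.ext (by simp) (by simp)
  rw [mixedDeriv_eq hu, mixedDeriv_eq hu, hI, smul_eq_re_im a w, hc]
  simp only [map_add, map_smul, Complex.real_smul]
  set P := fderiv ℝ (fderiv ℝ u) x v w
  set R := fderiv ℝ (fderiv ℝ u) x v (Complex.I • w)
  set S := fderiv ℝ (fderiv ℝ u) x (Complex.I • v) w
  set T := fderiv ℝ (fderiv ℝ u) x (Complex.I • v) (Complex.I • w)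
  push_cast
  linear_combination (1 / 4 * a.im * (R - S)) * Complex.I_sq

/-- The mixed derivative as a sesquilinear form. -/
noncomputable def leviForm {u : (ι → ℂ) → ℂ} {x : ι → ℂ} (hu : ContDiffAt ℝ 2 u x) :
    (ι → ℂ) →ₗ[ℂ] (ι → ℂ) →ₗ⋆[ℂ] ℂ :=
  LinearMap.mk₂'ₛₗ (RingHom.id ℂ) (starRingEnd ℂ) (fun v w => mixedDeriv v w u x)
    (mixedDeriv_add_left hu) (mixedDeriv_smul_left hu) (mixedDeriv_add_right hu)
    (fun a v w => mixedDeriv_smul_right hu a v w)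

@[simp] theorem leviForm_apply {u : (ι → ℂ) → ℂ} {x : ι → ℂ} (hu : ContDiffAt ℝ 2 u x)
    (v w : ι → ℂ) : leviForm hu v w = mixedDeriv v w u x := rfl

/-- Mixed derivatives transform by the chain rule under holomorphic maps: the second derivative of
the map contributes a complex bilinear term, which cancels. -/
theorem mixedDeriv_comp {u : (ι → ℂ) → ℂ} {φ : (ι → ℂ) → (ι → ℂ)} {x : ι → ℂ}
    (hφ : ContDiffAt ℂ 2 φ x) (hu : ContDiffAt ℝ 2 u (φ x)) (v w : ι → ℂ) :
    mixedDeriv v w (u ∘ φ) x = mixedDeriv (fderiv ℂ φ x v) (fderiv ℂ φ x w) u (φ x) := by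
  have h1 : HasFDerivAt (fderiv ℝ u) (fderiv ℝ (fderiv ℝ u) (φ x)) (φ x) :=
    ((hu.fderiv_right (m := 1) (by norm_num)).differentiableAt (by norm_num)).hasFDerivAt
  have hφ1 : HasFDerivAt φ ((fderiv ℂ φ x).restrictScalars ℝ) x :=
    (hφ.differentiableAt (by norm_num)).hasFDerivAt.restrictScalars ℝ
  have hφ2 : HasFDerivAt (fderiv ℂ φ) (fderiv ℂ (fderiv ℂ φ) x) x :=
    ((hφ.fderiv_right (m := 1) (by norm_num)).differentiableAt (by norm_num)).hasFDerivAt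
  have hev : ∀ᶠ y in 𝓝 x, fderiv ℝ (u ∘ φ) y
      = (fderiv ℝ u (φ y)).comp ((fderiv ℂ φ y).restrictScalars ℝ) := by
    have e1 := hφ.eventually (by norm_num)
    have e2 := hφ.continuousAt.eventually (hu.eventually (by norm_num))
    filter_upwards [e1, e2] with y h1 h2
    exact ((h2.differentiableAt (by norm_num)).hasFDerivAt.comp y
      ((h1.differentiableAt (by norm_num)).hasFDerivAt.restrictScalars ℝ)).fderiv
  have key : ∀ w, ∃ B : (ι → ℂ) →L[ℝ] ℂ,
      HasFDerivAt (fun y => fderiv ℝ u (φ y) (fderiv ℂ φ y w)) B x ∧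
      ∀ v, B v = fderiv ℝ u (φ x) (fderiv ℂ (fderiv ℂ φ) x v w)
        + fderiv ℝ (fderiv ℝ u) (φ x) (fderiv ℂ φ x v) (fderiv ℂ φ x w) := by
    intro w
    have h3 : HasFDerivAt (fun y => fderiv ℂ φ y w)
        (((ContinuousLinearMap.apply ℂ (ι → ℂ) w).comp
          (fderiv ℂ (fderiv ℂ φ) x)).restrictScalars ℝ) x :=
      ((ContinuousLinearMap.apply ℂ (ι → ℂ) w).hasFDerivAt.comp x hφ2).restrictScalars ℝ
    refine ⟨_, (h1.comp x hφ1).clm_apply h3, fun v => ?_⟩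
    simp
  obtain ⟨B, hB, hB'⟩ := key w
  obtain ⟨C, hC, hC'⟩ := key (Complex.I • w)
  rw [mixedDeriv_of_eventuallyEq (hev.mono fun y hy => congrArg (fun A => A w) hy)
    (hev.mono fun y hy => congrArg (fun A => A (Complex.I • w)) hy) hB hC, mixedDeriv_eq hu,
    hB', hB', hC', hC']
  simp only [map_smul, smul_apply]
  have : Complex.I • Complex.I • (fderiv ℂ (fderiv ℂ φ) x v w)
      = -(fderiv ℂ (fderiv ℂ φ) x v w) := by
    rw [smul_smul, Complex.I_mul_I, neg_one_smul]
  rw [this, map_neg]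
  ring

/-- Second derivative test: at a local maximum of the real part, the Levi form has non-positive
real part. -/
theorem re_mixedDeriv_self_nonpos {u : (ι → ℂ) → ℂ} {x : ι → ℂ} (hu : ContDiffAt ℝ 2 u x)
    (hmax : IsLocalMax (fun y => (u y).re) x) (v : ι → ℂ) : (mixedDeriv v v u x).re ≤ 0 := by
  have key : ∀ v : ι → ℂ, (fderiv ℝ (fderiv ℝ u) x v v).re ≤ 0 := by
    intro v
    by_contra! hpos
    have hγ : ∀ t : ℝ, HasDerivAt (fun t : ℝ => x + t • v) v t := fun t => by
      simpa using ((hasDerivAt_id t).smul_const v).const_add x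
    have hcont : Tendsto (fun t : ℝ => x + t • v) (𝓝 0) (𝓝 x) := by
      have := (hγ 0).continuousAt.tendsto
      simpa using this
    have hd : ∀ᶠ t in 𝓝 (0 : ℝ), HasDerivAt (fun t : ℝ => (u (x + t • v)).re)
        ((fderiv ℝ u (x + t • v) v).re) t := by
      filter_upwards [hcont.eventually (hu.eventually (by norm_num))] with t ht
      have h1 := (ht.differentiableAt (by norm_num)).hasFDerivAt.comp_hasDerivAt t (hγ t)
      exact Complex.reCLM.hasFDerivAt.comp_hasDerivAt t h1
    have hdd : deriv (fun t : ℝ => (u (x + t • v)).re) =ᶠ[𝓝 0]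
        fun t => (fderiv ℝ u (x + t • v) v).re := hd.mono fun t ht => ht.deriv
    have h2 : HasDerivAt (fun t : ℝ => (fderiv ℝ u (x + t • v) v).re)
        ((fderiv ℝ (fderiv ℝ u) x v v).re) 0 := by
      have h1 : HasFDerivAt (fderiv ℝ u) (fderiv ℝ (fderiv ℝ u) x) (x + (0 : ℝ) • v) := by
        simpa using ((hu.fderiv_right (m := 1) (by norm_num)).differentiableAt
          (by norm_num)).hasFDerivAt
      have h3 := h1.comp_hasDerivAt (0 : ℝ) (hγ 0)
      have h4 := (ContinuousLinearMap.apply ℝ ℂ v).hasFDerivAt.comp_hasDerivAt (0 : ℝ) h3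
      exact Complex.reCLM.hasFDerivAt.comp_hasDerivAt (0 : ℝ) h4
    have hmax0 : IsLocalMax (fun t : ℝ => (u (x + t • v)).re) 0 := by
      have := hcont.eventually hmax
      filter_upwards [this] with t ht
      simpa using ht
    have hmin : IsLocalMin (fun t : ℝ => (u (x + t • v)).re) 0 := by
      refine isLocalMin_of_deriv_deriv_pos ?_ hmax0.deriv_eq_zero
        (hd.self_of_nhds.continuousAt)
      rw [hdd.deriv_eq, h2.deriv]
      exact hpos
    have hconst : (fun t : ℝ => (u (x + t • v)).re) =ᶠ[𝓝 0]
        fun _ => (u (x + (0 : ℝ) • v)).re := by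
      filter_upwards [hmax0, hmin] with t h1 h2 using le_antisymm h1 h2
    have hz : deriv (fun t : ℝ => (u (x + t • v)).re) =ᶠ[𝓝 0] fun _ => 0 := by
      filter_upwards [hconst.eventuallyEq_nhds] with t ht
      rw [ht.deriv_eq]
      simp
    have : (fderiv ℝ (fderiv ℝ u) x v v).re = 0 := by
      rw [← h2.deriv, ← hdd.deriv_eq, hz.deriv_eq]
      simp
    exact hpos.ne' this
  have hsymm : fderiv ℝ (fderiv ℝ u) x v (Complex.I • v)
      = fderiv ℝ (fderiv ℝ u) x (Complex.I • v) v :=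
    (hu.isSymmSndFDerivAt (by simp)) v (Complex.I • v)
  rw [mixedDeriv_eq hu, hsymm]
  have h1 := key v
  have h2 := key (Complex.I • v)
  set P := fderiv ℝ (fderiv ℝ u) x v v
  set T := fderiv ℝ (fderiv ℝ u) x (Complex.I • v) (Complex.I • v)
  have : ∀ R : ℂ, ((1 / 4 : ℂ) * (P + Complex.I * R - Complex.I * R + T)).re
      = (P.re + T.re) / 4 := by
    intro R
    rw [add_sub_cancel_right]
    simp [Complex.mul_re]
    ring
  rw [this]
  linarith

end Calculus

/-! ### The matrix ball and its Möbius transformations -/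

section MatrixBall

variable {m n : ℕ}

/-- `W(z) = I - z* z`. -/
def matW (z : Matrix (Fin m) (Fin n) ℂ) : Matrix (Fin n) (Fin n) ℂ :=
  1 - zᴴ * z

theorem matV_isHermitian (z : Matrix (Fin m) (Fin n) ℂ) : (matV z)ᴴ = matV z := by
  simp [matV]

theorem matW_isHermitian (z : Matrix (Fin m) (Fin n) ℂ) : (matW z)ᴴ = matW z := by
  simp [matW]

theorem matV_conjTranspose (z : Matrix (Fin m) (Fin n) ℂ) : matV zᴴ = matW z := by
  simp [matV, matW]

theorem matW_conjTranspose (z : Matrix (Fin m) (Fin n) ℂ) : matW zᴴ = matV z := by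
  simp [matV, matW]

theorem matV_mul (z : Matrix (Fin m) (Fin n) ℂ) : matV z * z = z * matW z := by
  simp [matV, matW, Matrix.sub_mul, Matrix.mul_sub, Matrix.mul_assoc]

theorem matV_neg (z : Matrix (Fin m) (Fin n) ℂ) : matV (-z) = matV z := by
  simp [matV]

theorem matW_neg (z : Matrix (Fin m) (Fin n) ℂ) : matW (-z) = matW z := by
  simp [matW]

theorem matW_mul_eq_one {z : Matrix (Fin m) (Fin n) ℂ} (h : IsUnit (matV z)) :
    matW z * (1 + zᴴ * (matV z)⁻¹ * z) = 1 := by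
  have hd := (Matrix.isUnit_iff_isUnit_det _).1 h
  have h1 : matW z * zᴴ = zᴴ * matV z := by
    simp [matV, matW, Matrix.sub_mul, Matrix.mul_sub, Matrix.mul_assoc]
  calc matW z * (1 + zᴴ * (matV z)⁻¹ * z)
      = matW z + matW z * zᴴ * (matV z)⁻¹ * z := by
        rw [Matrix.mul_add, Matrix.mul_one, ← Matrix.mul_assoc, ← Matrix.mul_assoc]
    _ = matW z + zᴴ * z := by
        rw [h1, Matrix.mul_assoc zᴴ, Matrix.mul_nonsing_inv _ hd, Matrix.mul_one]
    _ = 1 := by simp [matW]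

theorem matW_inv {z : Matrix (Fin m) (Fin n) ℂ} (h : IsUnit (matV z)) :
    (matW z)⁻¹ = 1 + zᴴ * (matV z)⁻¹ * z :=
  Matrix.inv_eq_right_inv (matW_mul_eq_one h)

theorem isUnit_matW {z : Matrix (Fin m) (Fin n) ℂ} (h : IsUnit (matV z)) : IsUnit (matW z) := by
  rw [Matrix.isUnit_iff_isUnit_det]
  exact Matrix.isUnit_det_of_right_inverse (matW_mul_eq_one h)

theorem posDef_matW {z : Matrix (Fin m) (Fin n) ℂ} (h : (matV z).PosDef) : (matW z).PosDef := by
  rw [← Matrix.posDef_inv_iff, matW_inv h.isUnit]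
  exact Matrix.PosDef.one.add_posSemidef (h.inv.posSemidef.conjTranspose_mul_mul_same z)

theorem posDef_matV_iff (z : Matrix (Fin m) (Fin n) ℂ) :
    (matV z).PosDef ↔ (matW z).PosDef := by
  refine ⟨posDef_matW, fun h => ?_⟩
  rw [← matV_conjTranspose] at h
  rw [← matW_conjTranspose]
  exact posDef_matW h

theorem star_dotProduct_matV (z : Matrix (Fin m) (Fin n) ℂ) (x : Fin m → ℂ) :
    star x ⬝ᵥ (matV z *ᵥ x) = star x ⬝ᵥ x - star (zᴴ *ᵥ x) ⬝ᵥ (zᴴ *ᵥ x) := by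
  rw [matV, Matrix.sub_mulVec, Matrix.one_mulVec, dotProduct_sub, Matrix.star_mulVec,
    Matrix.conjTranspose_conjTranspose, ← Matrix.mulVec_mulVec, Matrix.dotProduct_mulVec]

/-- For `V(a) > 0` and `V(z) ≥ 0`, the matrix `1 + a* z` is invertible: a vector `x` with
`x = - z* a x` satisfies `|x| ≤ |a x|`, while `|a x| < |x|` for `x ≠ 0`. -/
theorem isUnit_one_add {a z : Matrix (Fin m) (Fin n) ℂ} (ha : (matV a).PosDef)
    (hz : (matV z).PosSemidef) : IsUnit (1 + aᴴ * z) := by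
  rw [Matrix.isUnit_iff_isUnit_det, isUnit_iff_ne_zero]
  intro h0
  have h0' : ((1 + aᴴ * z)ᴴ).det = 0 := by rw [Matrix.det_conjTranspose, h0, star_zero]
  obtain ⟨x, hx, hx0⟩ := Matrix.exists_mulVec_eq_zero_iff.2 h0'
  have h1 : x = -(zᴴ *ᵥ (a *ᵥ x)) := by
    simp only [Matrix.conjTranspose_add, Matrix.conjTranspose_one, Matrix.conjTranspose_mul,
      Matrix.conjTranspose_conjTranspose, Matrix.add_mulVec, Matrix.one_mulVec] at hx0
    rw [Matrix.mulVec_mulVec]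
    exact eq_neg_of_add_eq_zero_left hx0
  have h2 := hz.dotProduct_mulVec_nonneg (a *ᵥ x)
  have h3 := (posDef_matW ha).dotProduct_mulVec_pos hx
  rw [star_dotProduct_matV] at h2
  rw [← matV_conjTranspose, star_dotProduct_matV, Matrix.conjTranspose_conjTranspose] at h3
  have h4 : star (zᴴ *ᵥ (a *ᵥ x)) ⬝ᵥ (zᴴ *ᵥ (a *ᵥ x)) = star x ⬝ᵥ x := by
    conv_rhs => rw [h1]
    simp
  rw [h4] at h2
  have := add_pos_of_nonneg_of_pos h2 h3
  simp at this

/-- `C` and `D` are the positive square roots of `V(a)` and `W(a)`. -/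
structure IsSqrtPair (a : Matrix (Fin m) (Fin n) ℂ) (C : Matrix (Fin m) (Fin m) ℂ)
    (D : Matrix (Fin n) (Fin n) ℂ) : Prop where
  posDef_left : C.PosDef
  posDef_right : D.PosDef
  sq_left : C * C = matV a
  sq_right : D * D = matW a

namespace IsSqrtPair

variable {a : Matrix (Fin m) (Fin n) ℂ} {C : Matrix (Fin m) (Fin m) ℂ}
  {D : Matrix (Fin n) (Fin n) ℂ}

theorem symm (h : IsSqrtPair a C D) : IsSqrtPair aᴴ D C where
  posDef_left := h.posDef_right
  posDef_right := h.posDef_left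
  sq_left := by rw [h.sq_right, matV_conjTranspose]
  sq_right := by rw [h.sq_left, matW_conjTranspose]

theorem neg (h : IsSqrtPair a C D) : IsSqrtPair (-a) C D where
  posDef_left := h.posDef_left
  posDef_right := h.posDef_right
  sq_left := by rw [h.sq_left, matV_neg]
  sq_right := by rw [h.sq_right, matW_neg]

/-- The square roots intertwine `a`: the Sylvester equation `C X + X D = 0` with positive definite
coefficients has only the trivial solution, and `X = C a - a D` solves it. -/
theorem mul_comm (h : IsSqrtPair a C D) : C * a = a * D := by
  set X := C * a - a * D with hX
  have h0 : C * X + X * D = 0 := by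
    have : C * X + X * D = C * C * a - a * (D * D) := by
      simp only [hX, Matrix.mul_sub, Matrix.sub_mul, Matrix.mul_assoc]
      abel
    rw [this, h.sq_left, h.sq_right, matV_mul, sub_self]
  have h1 : (Xᴴ * C * X).PosSemidef := h.posDef_left.posSemidef.conjTranspose_mul_mul_same X
  have h2 : (X * D * Xᴴ).PosSemidef := h.posDef_right.posSemidef.mul_mul_conjTranspose_same X
  have h3 : (Xᴴ * C * X).trace + (X * D * Xᴴ).trace = 0 := by
    rw [Matrix.trace_mul_comm (X * D), ← Matrix.trace_add, Matrix.mul_assoc, ← Matrix.mul_add, h0,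
      Matrix.mul_zero, Matrix.trace_zero]
  have h4 : (Xᴴ * C * X).trace = 0 :=
    le_antisymm (by rw [eq_neg_of_add_eq_zero_left h3]; simpa using h2.trace_nonneg)
      h1.trace_nonneg
  have h5 : Xᴴ * C * X = 0 := h1.trace_eq_zero_iff.1 h4
  have h6 : X = 0 := by
    ext i j
    by_contra hne
    have hv : X *ᵥ Pi.single j 1 ≠ 0 := by
      intro hv
      apply hne
      simpa using congrFun hv i
    have := h.posDef_left.dotProduct_mulVec_pos hv
    rw [Matrix.star_mulVec, ← Matrix.dotProduct_mulVec, Matrix.mulVec_mulVec,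
      Matrix.mulVec_mulVec, h5] at this
    simp at this
  exact sub_eq_zero.1 h6

theorem conjTranspose_left (h : IsSqrtPair a C D) : Cᴴ = C := h.posDef_left.isHermitian

theorem conjTranspose_right (h : IsSqrtPair a C D) : Dᴴ = D := h.posDef_right.isHermitian

theorem posDef_matV (h : IsSqrtPair a C D) : (matV a).PosDef := by
  have hC := h.conjTranspose_left
  have := h.posDef_left
  rw [← h.sq_left]
  nth_rw 1 [← hC]
  refine Matrix.PosDef.conjTranspose_mul_self C ?_
  exact Matrix.mulVec_injective_of_isUnit this.isUnit

theorem isUnit_det_left (h : IsSqrtPair a C D) : IsUnit C.det :=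
  (Matrix.isUnit_iff_isUnit_det _).1 h.posDef_left.isUnit

theorem isUnit_det_right (h : IsSqrtPair a C D) : IsUnit D.det :=
  (Matrix.isUnit_iff_isUnit_det _).1 h.posDef_right.isUnit

end IsSqrtPair

/-- The Möbius transformation of the matrix ball that takes `0` to `a`, where `C` and `D` are the
square roots of `V(a)` and `W(a)`. -/
noncomputable def moebius (a : Matrix (Fin m) (Fin n) ℂ) (C : Matrix (Fin m) (Fin m) ℂ)
    (D : Matrix (Fin n) (Fin n) ℂ) (z : Matrix (Fin m) (Fin n) ℂ) : Matrix (Fin m) (Fin n) ℂ :=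
  a + C * (z * (1 + aᴴ * z)⁻¹) * D

section Moebius

variable {a z : Matrix (Fin m) (Fin n) ℂ} {C : Matrix (Fin m) (Fin m) ℂ}
  {D : Matrix (Fin n) (Fin n) ℂ}

theorem moebius_zero : moebius a C D 0 = a := by simp [moebius]

theorem mul_moebius (h : IsSqrtPair a C D) (hu : IsUnit (1 + aᴴ * z)) :
    C * moebius a C D z = (z + a) * (1 + aᴴ * z)⁻¹ * D := by
  have hd := (Matrix.isUnit_iff_isUnit_det _).1 hu
  have h1 : C * a = a * (1 + aᴴ * z) * (1 + aᴴ * z)⁻¹ * D := by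
    rw [Matrix.mul_nonsing_inv_cancel_right _ _ hd, h.mul_comm]
  have h2 : C * C * z + a * (1 + aᴴ * z) = z + a := by
    rw [h.sq_left, matV, Matrix.sub_mul, Matrix.mul_add, Matrix.one_mul, Matrix.mul_one,
      Matrix.mul_assoc]
    abel
  rw [moebius, Matrix.mul_add, h1, ← h2]
  simp only [Matrix.add_mul, Matrix.mul_assoc]
  abel

theorem push_through_inv {a z : Matrix (Fin m) (Fin n) ℂ} (hu : IsUnit (1 + aᴴ * z)) :
    z * (1 + aᴴ * z)⁻¹ = (1 + z * aᴴ)⁻¹ * z := by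
  have hd := (Matrix.isUnit_iff_isUnit_det _).1 hu
  have hd' : IsUnit (1 + z * aᴴ).det := by rwa [Matrix.det_one_add_mul_comm]
  have : (1 + z * aᴴ) * z = z * (1 + aᴴ * z) := by
    simp [Matrix.add_mul, Matrix.mul_add, Matrix.mul_assoc]
  calc z * (1 + aᴴ * z)⁻¹ = (1 + z * aᴴ)⁻¹ * ((1 + z * aᴴ) * z) * (1 + aᴴ * z)⁻¹ := by
        rw [Matrix.nonsing_inv_mul_cancel_left _ _ hd']
    _ = _ := by rw [this, Matrix.mul_assoc, Matrix.mul_nonsing_inv_cancel_right _ _ hd]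

theorem isUnit_one_add_conjTranspose {a z : Matrix (Fin m) (Fin n) ℂ}
    (hu : IsUnit (1 + aᴴ * z)) : IsUnit (1 + a * zᴴ) := by
  rw [Matrix.isUnit_iff_isUnit_det] at hu ⊢
  have h1 : (1 + zᴴ * a).det = star (1 + aᴴ * z).det := by
    rw [← Matrix.det_conjTranspose]
    simp
  rw [Matrix.det_one_add_mul_comm, h1]
  exact hu.star

theorem moebius_conjTranspose (h : IsSqrtPair a C D) (hu : IsUnit (1 + aᴴ * z)) :
    (moebius a C D z)ᴴ = moebius aᴴ D C zᴴ := by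
  have hu' : IsUnit (1 + aᴴᴴ * zᴴ) := by
    rw [Matrix.conjTranspose_conjTranspose]
    exact isUnit_one_add_conjTranspose hu
  rw [moebius, moebius, push_through_inv hu']
  simp [Matrix.conjTranspose_nonsing_inv, h.conjTranspose_left, h.conjTranspose_right,
    Matrix.mul_assoc]

theorem matW_moebius (h : IsSqrtPair a C D) (hu : IsUnit (1 + aᴴ * z)) :
    matW (moebius a C D z)
      = ((1 + aᴴ * z)⁻¹ * D)ᴴ * matW z * ((1 + aᴴ * z)⁻¹ * D) := by
  have hd := (Matrix.isUnit_iff_isUnit_det _).1 hu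
  have hV := h.posDef_matV
  have hVd := (Matrix.isUnit_iff_isUnit_det _).1 hV.isUnit
  have hWd := (Matrix.isUnit_iff_isUnit_det _).1 (isUnit_matW hV.isUnit)
  set N := 1 + aᴴ * z with hN
  set P := (matV a)⁻¹ with hP
  set S := (matW a)⁻¹ with hS
  have hPC : C⁻¹ * C⁻¹ = P := by rw [hP, ← h.sq_left, Matrix.mul_inv_rev]
  have hSD : D * S * D = 1 := by
    rw [hS, ← h.sq_right, Matrix.mul_inv_rev, ← Matrix.mul_assoc,
      Matrix.mul_nonsing_inv _ h.isUnit_det_right, Matrix.one_mul,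
      Matrix.nonsing_inv_mul _ h.isUnit_det_right]
  have f3 : S = 1 + aᴴ * P * a := matW_inv hV.isUnit
  have f1 : a * S = P * a := by
    have : matV a * a * S = a := by
      rw [matV_mul, Matrix.mul_nonsing_inv_cancel_right _ _ hWd]
    calc a * S = P * (matV a * (a * S)) := (Matrix.nonsing_inv_mul_cancel_left _ _ hVd).symm
      _ = P * a := by rw [← Matrix.mul_assoc (matV a), this]
  have f2 : S * aᴴ = aᴴ * P := by
    have := congrArg Matrix.conjTranspose f1
    simpa [hP, hS, Matrix.conjTranspose_nonsing_inv, matV_isHermitian, matW_isHermitian]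
      using this
  have f4 : a * S * aᴴ = P - 1 := by
    have : P * matV a = 1 := Matrix.nonsing_inv_mul _ hVd
    rw [matV, Matrix.mul_sub, Matrix.mul_one, ← Matrix.mul_assoc, sub_eq_iff_eq_add] at this
    rw [f1, eq_sub_iff_add_eq', ← this]
  have key : Nᴴ * S * N - (z + a)ᴴ * P * (z + a) = matW z := by
    have e1 : Nᴴ * S * N = S + S * aᴴ * z + zᴴ * (a * S) + zᴴ * (a * S * aᴴ) * z := by
      simp only [hN, Matrix.conjTranspose_add, Matrix.conjTranspose_one,
        Matrix.conjTranspose_mul, Matrix.conjTranspose_conjTranspose, Matrix.add_mul,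
        Matrix.mul_add, Matrix.one_mul, Matrix.mul_one, Matrix.mul_assoc]
      abel
    rw [e1, f2, f4, f1, f3, matW]
    simp only [Matrix.conjTranspose_add, Matrix.add_mul, Matrix.mul_add, Matrix.mul_sub,
      Matrix.sub_mul, Matrix.mul_one, Matrix.mul_assoc]
    abel
  have hw : moebius a C D z = C⁻¹ * ((z + a) * N⁻¹ * D) := by
    rw [← mul_moebius h hu, Matrix.nonsing_inv_mul_cancel_left _ _ h.isUnit_det_left]
  have hone : (N⁻¹ * D)ᴴ * (Nᴴ * S * N) * (N⁻¹ * D) = 1 := by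
    have h1 : N * (N⁻¹ * D) = D := Matrix.mul_nonsing_inv_cancel_left _ _ hd
    calc (N⁻¹ * D)ᴴ * (Nᴴ * S * N) * (N⁻¹ * D) = (N * (N⁻¹ * D))ᴴ * S * (N * (N⁻¹ * D)) := by
          simp only [Matrix.conjTranspose_mul, Matrix.mul_assoc]
      _ = 1 := by rw [h1, h.conjTranspose_right, hSD]
  have hwz : (moebius a C D z)ᴴ * moebius a C D z
      = (N⁻¹ * D)ᴴ * ((z + a)ᴴ * P * (z + a)) * (N⁻¹ * D) := by
    rw [hw, ← hPC]
    simp only [Matrix.conjTranspose_mul, Matrix.conjTranspose_nonsing_inv, h.conjTranspose_left,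
      Matrix.mul_assoc]
  rw [matW, hwz, ← key, Matrix.mul_sub, Matrix.sub_mul, hone]

theorem matV_moebius (h : IsSqrtPair a C D) (hu : IsUnit (1 + aᴴ * z)) :
    matV (moebius a C D z)
      = (C * (1 + z * aᴴ)⁻¹) * matV z * (C * (1 + z * aᴴ)⁻¹)ᴴ := by
  have hu' : IsUnit (1 + aᴴᴴ * zᴴ) := by
    rw [Matrix.conjTranspose_conjTranspose]
    exact isUnit_one_add_conjTranspose hu
  rw [← matW_conjTranspose (moebius a C D z), moebius_conjTranspose h hu,
    matW_moebius h.symm hu', matW_conjTranspose]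
  simp [Matrix.conjTranspose_nonsing_inv, h.conjTranspose_left]

theorem posDef_moebius (h : IsSqrtPair a C D) (hz : (matV z).PosDef) :
    (matV (moebius a C D z)).PosDef := by
  have hu := isUnit_one_add h.posDef_matV hz.posSemidef
  rw [posDef_matV_iff, matW_moebius h hu]
  refine (posDef_matW hz).conjTranspose_mul_mul_same ?_
  refine Matrix.mulVec_injective_of_isUnit ?_
  exact ((Matrix.isUnit_nonsing_inv_iff.2 hu).mul h.posDef_right.isUnit)

theorem moebius_neg_moebius (h : IsSqrtPair a C D) (hu : IsUnit (1 + aᴴ * z)) :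
    moebius (-a) C D (moebius a C D z) = z := by
  have hd := (Matrix.isUnit_iff_isUnit_det _).1 hu
  set N := 1 + aᴴ * z with hN
  set w := moebius a C D z with hw
  have hC := h.isUnit_det_left
  have hD := h.isUnit_det_right
  have hDC : D * aᴴ = aᴴ * C := h.symm.mul_comm
  have hN' : D * (1 + (-a)ᴴ * w) = D * (D * N⁻¹ * D) := by
    have h1 : D * (aᴴ * w) = aᴴ * (z + a) * N⁻¹ * D := by
      rw [← Matrix.mul_assoc, hDC, Matrix.mul_assoc, hw, mul_moebius h hu, ← hN]
      simp only [Matrix.mul_assoc]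
    have h2 : D = N * N⁻¹ * D := by rw [Matrix.mul_nonsing_inv _ hd, Matrix.one_mul]
    have h3 : N - aᴴ * (z + a) = D * D := by
      rw [h.sq_right, hN, matW, Matrix.mul_add]
      abel
    rw [Matrix.mul_add, Matrix.mul_one, Matrix.conjTranspose_neg, Matrix.neg_mul, Matrix.mul_neg,
      h1]
    nth_rw 1 [h2]
    simp only [← Matrix.mul_assoc]
    rw [← h3]
    simp only [Matrix.sub_mul, Matrix.mul_assoc]
    abel
  have hN2 : 1 + (-a)ᴴ * w = D * N⁻¹ * D := by
    have := congrArg (D⁻¹ * ·) hN'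
    simpa only [Matrix.nonsing_inv_mul_cancel_left _ _ hD] using this
  have hinv : (D * N⁻¹ * D)⁻¹ = D⁻¹ * (N * D⁻¹) := by
    rw [Matrix.mul_inv_rev, Matrix.mul_inv_rev, Matrix.nonsing_inv_nonsing_inv _ hd]
  have h4 := mul_moebius (z := w) h.neg (by
    rw [hN2]
    exact (h.posDef_right.isUnit.mul (Matrix.isUnit_nonsing_inv_iff.2 hu)).mul
      h.posDef_right.isUnit)
  rw [hN2, hinv] at h4
  have h5 : w + -a = C * (z * N⁻¹) * D := by
    rw [hw, moebius]
    abel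
  rw [h5] at h4
  have h6 : C * (z * N⁻¹) * D * (D⁻¹ * (N * D⁻¹)) * D = C * z := by
    simp only [Matrix.mul_assoc]
    rw [Matrix.nonsing_inv_mul _ hD, Matrix.mul_one, Matrix.mul_nonsing_inv_cancel_left _ _ hD,
      Matrix.nonsing_inv_mul _ hd, Matrix.mul_one]
  rw [h6] at h4
  have := congrArg (C⁻¹ * ·) h4
  simpa only [Matrix.nonsing_inv_mul_cancel_left _ _ hC] using this

end Moebius

end MatrixBall

/-! ### Linear models of the classical domains -/

/-- The pair `(A, B)` is admissible for an operator `Π` on matrices if `X ↦ A X B` commutes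
with `Π`. -/
def IsAdmissible {m n : ℕ} (proj : Matrix (Fin m) (Fin n) ℂ → Matrix (Fin m) (Fin n) ℂ)
    (A : Matrix (Fin m) (Fin m) ℂ) (B : Matrix (Fin n) (Fin n) ℂ) : Prop :=
  ∀ X, proj (A * X * B) = A * proj X * B

theorem IsAdmissible.mul {m n : ℕ} {proj : Matrix (Fin m) (Fin n) ℂ → Matrix (Fin m) (Fin n) ℂ}
    {A A' : Matrix (Fin m) (Fin m) ℂ} {B B' : Matrix (Fin n) (Fin n) ℂ}
    (h : IsAdmissible proj A B) (h' : IsAdmissible proj A' B') :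
    IsAdmissible proj (A * A') (B' * B) := fun X => by
  have : A * A' * X * (B' * B) = A * (A' * X * B') * B := by simp only [Matrix.mul_assoc]
  rw [this, h, h']
  simp only [Matrix.mul_assoc]

/-- The matrix unit `E_{jα}`. -/
abbrev matUnit {m n : ℕ} (j : Fin m) (α : Fin n) : Matrix (Fin m) (Fin n) ℂ := Matrix.single j α 1

/-- A space `ℂ^ι` of matrices, embedded by `toMat` in `M^{m,n}(ℂ)`, to which the theory of all
three types of classical domains applies. The map `toMat ∘ ofMat` is `c` times the orthogonal
projection onto the space: `c = 1` for the space of all matrices, and `X ↦ X ± Xᵗ`, `c = 2`, for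
symmetric and antisymmetric matrices. The natural number `p` is the genus: the Bergman kernel is a
multiple of `det V(z) ^ (-p)`; this is encoded by the Jacobian determinant of `v ↦ C v D`, the
derivative at `0` of an automorphism that takes `0` to `x`. The remaining fields say that the
Möbius transformations of the matrix ball preserve the space, and that the Laplacian of `tr V` is
at most `- kappa (tr V)²`. -/
structure CartanData (ι : Type*) [Fintype ι] [DecidableEq ι] (m n : ℕ) where
  toMat : (ι → ℂ) →ₗ[ℂ] Matrix (Fin m) (Fin n) ℂ
  ofMat : Matrix (Fin m) (Fin n) ℂ →ₗ[ℂ] (ι → ℂ)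
  c : ℝ
  c_pos : 0 < c
  ofMat_toMat : ∀ x, ofMat (toMat x) = (c : ℂ) • x
  trace_toMat_mul : ∀ x X,
    (toMat x * (toMat (ofMat X))ᴴ).trace = c * (toMat x * Xᴴ).trace
  p : ℕ
  p_pos : 0 < p
  exists_sqrt : ∀ x, (matV (toMat x)).PosDef → ∃ C D, IsSqrtPair (toMat x) C D ∧
    IsAdmissible (fun X => toMat (ofMat X)) C D ∧
    ∀ T : (ι → ℂ) →ₗ[ℂ] (ι → ℂ), (∀ v, T v = (c : ℂ)⁻¹ • ofMat (C * toMat v * D)) →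
      ‖LinearMap.det T‖ ^ 2 = (matV (toMat x)).det.re ^ p
  exists_toMat_eq : ∀ x y, IsUnit (1 + (toMat x)ᴴ * toMat y) →
    ∃ y', toMat y' = toMat y * (1 + (toMat x)ᴴ * toMat y)⁻¹
  isAdmissible_inv : ∀ x y, IsUnit (1 + (toMat x)ᴴ * toMat y) →
    IsAdmissible (fun X => toMat (ofMat X)) (1 + toMat y * (toMat x)ᴴ)⁻¹
      (1 + (toMat x)ᴴ * toMat y)⁻¹
  kappa : ℝ
  kappa_pos : 0 < kappa
  kappa_le : ∀ x C D, IsSqrtPair (toMat x) C D → IsAdmissible (fun X => toMat (ofMat X)) C D →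
    kappa * (matV (toMat x)).trace.re ^ 2 ≤ ∑ j : Fin m, ∑ α : Fin n,
      ((C * toMat (ofMat (matUnit j α)) * D) *
        (C * toMat (ofMat (matUnit j α)) * D)ᴴ).trace.re

theorem single_conj_eq_sum {m n : ℕ} (A : Matrix (Fin m) (Fin m) ℂ) (B : Matrix (Fin n) (Fin n) ℂ)
    (j : Fin m) (α : Fin n) :
    A * matUnit j α * B = ∑ a : Fin m, ∑ β : Fin n, (A a j * B α β) • matUnit a β := by
  ext a β
  simp [Matrix.sum_apply, Matrix.mul_apply, Matrix.single_apply, ite_and]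

/-- A sesquilinear form summed over the frames `A E_{jα} B` and `A E_{kα} B`. -/
theorem sum_sesquilinear_single {m n : ℕ}
    (H : Matrix (Fin m) (Fin n) ℂ →ₗ[ℂ] Matrix (Fin m) (Fin n) ℂ →ₗ⋆[ℂ] ℂ)
    (A : Matrix (Fin m) (Fin m) ℂ) (B : Matrix (Fin n) (Fin n) ℂ) (j k : Fin m) :
    ∑ α : Fin n, H (A * matUnit j α * B) (A * matUnit k α * B)
      = ∑ a, ∑ b, A a j * conj (A b k) *
        ∑ α, ∑ β, (Bᴴ * B) β α * H (matUnit a α) (matUnit b β) := by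
  have e1 : ∀ (α : Fin n) Y, H (A * matUnit j α * B) Y
      = ∑ a, ∑ α', A a j * B α α' * H (matUnit a α') Y := fun α Y => by
    rw [single_conj_eq_sum]
    simp only [map_sum, LinearMap.sum_apply, map_smul, LinearMap.smul_apply, smul_eq_mul]
  have e2 : ∀ (α : Fin n) X, H X (A * matUnit k α * B)
      = ∑ b, ∑ β, conj (A b k) * conj (B α β) * H X (matUnit b β) := fun α X => by
    rw [single_conj_eq_sum]
    simp only [map_sum, LinearMap.map_smulₛₗ, smul_eq_mul, map_mul]
  have e3 : ∀ α : Fin n, H (A * matUnit j α * B) (A * matUnit k α * B)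
      = ∑ a, ∑ α', ∑ b, ∑ β, A a j * conj (A b k) *
          (conj (B α β) * B α α' * H (matUnit a α') (matUnit b β)) := fun α => by
    rw [e1]
    refine Finset.sum_congr rfl fun a _ => Finset.sum_congr rfl fun α' _ => ?_
    rw [e2, Finset.mul_sum]
    refine Finset.sum_congr rfl fun b _ => ?_
    rw [Finset.mul_sum]
    refine Finset.sum_congr rfl fun β _ => ?_
    ring
  rw [Finset.sum_congr rfl fun (α : Fin n) _ => e3 α, Finset.sum_comm]
  simp only [Matrix.mul_apply, Matrix.conjTranspose_apply, Finset.mul_sum,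
    Finset.sum_mul, RCLike.star_def]
  refine Finset.sum_congr rfl fun a _ => ?_
  rw [Finset.sum_comm, Finset.sum_comm (s := (Finset.univ : Finset (Fin m)))]
  refine Finset.sum_congr rfl fun α' _ => ?_
  rw [Finset.sum_comm]
  refine Finset.sum_congr rfl fun b _ => ?_
  rw [Finset.sum_comm]

namespace CartanData

variable {ι : Type*} [Fintype ι] [DecidableEq ι] {m n : ℕ} (S : CartanData ι m n)

/-- The operator `toMat ∘ ofMat` on matrices. -/
def proj (X : Matrix (Fin m) (Fin n) ℂ) : Matrix (Fin m) (Fin n) ℂ := S.toMat (S.ofMat X)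

/-- The domain `V(z) > 0` in the space of matrices. -/
def dom : Set (ι → ℂ) := {x | (matV (S.toMat x)).PosDef}

/-- The direction of differentiation attached to the matrix unit `E_{jα}`. -/
def dir (j : Fin m) (α : Fin n) : ι → ℂ := S.ofMat (matUnit j α)

/-- The second-order operators `Δ^{jk}`. -/
noncomputable def sys (j k : Fin m) (u : (ι → ℂ) → ℂ) (x : ι → ℂ) : ℂ :=
  ∑ α, ∑ β, matW (S.toMat x) β α * mixedDeriv (S.dir j α) (S.dir k β) u x

/-- The operator `∑ V_{jk} Δ^{jk}`, a multiple of the Laplacian of the Bergman metric. -/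
noncomputable def lap (u : (ι → ℂ) → ℂ) (x : ι → ℂ) : ℂ :=
  ∑ j, ∑ k, matV (S.toMat x) j k * S.sys j k u x

theorem c_ne_zero : (S.c : ℂ) ≠ 0 := by exact_mod_cast S.c_pos.ne'

theorem toMat_injective : Function.Injective S.toMat := fun x y h => by
  have := congrArg S.ofMat h
  rw [S.ofMat_toMat, S.ofMat_toMat] at this
  exact smul_right_injective _ S.c_ne_zero this

theorem toMat_ofMat_toMat (x : ι → ℂ) : S.toMat (S.ofMat (S.toMat x)) = (S.c : ℂ) • S.toMat x := by
  rw [S.ofMat_toMat, map_smul]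

theorem sum_mixedDeriv {u : (ι → ℂ) → ℂ} {x : ι → ℂ} (hu : ContDiffAt ℝ 2 u x)
    {A : Matrix (Fin m) (Fin m) ℂ} {B : Matrix (Fin n) (Fin n) ℂ}
    (hB : Bᴴ * B = matW (S.toMat x)) (j k : Fin m) :
    ∑ α : Fin n, mixedDeriv (S.ofMat (A * matUnit j α * B))
        (S.ofMat (A * matUnit k α * B)) u x
      = ∑ a, ∑ b, A a j * conj (A b k) * S.sys a b u x := by
  have := sum_sesquilinear_single
    (((leviForm hu).comp S.ofMat).compl₂ S.ofMat) A B j k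
  rw [hB] at this
  exact this

/-- The Laplacian is the trace of the Levi form over the frame `A E_{jα} B`, for any factorizations
`V = A A*` and `W = B* B`. -/
theorem lap_eq_sum {u : (ι → ℂ) → ℂ} {x : ι → ℂ} (hu : ContDiffAt ℝ 2 u x)
    {A : Matrix (Fin m) (Fin m) ℂ} {B : Matrix (Fin n) (Fin n) ℂ}
    (hA : A * Aᴴ = matV (S.toMat x)) (hB : Bᴴ * B = matW (S.toMat x)) :
    S.lap u x = ∑ j : Fin m, ∑ α : Fin n, mixedDeriv (S.ofMat (A * matUnit j α * B))
        (S.ofMat (A * matUnit j α * B)) u x := by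
  rw [Finset.sum_congr rfl fun j _ => S.sum_mixedDeriv hu hB j j, lap, ← hA]
  simp only [Matrix.mul_apply, Matrix.conjTranspose_apply, Finset.sum_mul, RCLike.star_def]
  conv_rhs => rw [Finset.sum_comm]
  refine Finset.sum_congr rfl fun a _ => ?_
  rw [Finset.sum_comm]

theorem sys_congr {u v : (ι → ℂ) → ℂ} {x : ι → ℂ} (h : u =ᶠ[𝓝 x] v) (j k : Fin m) :
    S.sys j k u x = S.sys j k v x := by
  simp only [sys, mixedDeriv_congr h]

end CartanData

/-! ### Topology of the domains -/

section DomTopology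

variable {m n : ℕ}

theorem continuous_matV : Continuous (matV : Matrix (Fin m) (Fin n) ℂ → _) :=
  continuous_const.sub (continuous_id.matrix_mul continuous_id.matrix_conjTranspose)

theorem star_dotProduct_self (x : Fin m → ℂ) : star x ⬝ᵥ x = ((∑ i, ‖x i‖ ^ 2 : ℝ) : ℂ) := by
  simp only [dotProduct, Pi.star_apply, RCLike.star_def, Complex.conj_mul']
  push_cast
  rfl

/-- The quadratic form of `V(z)`. -/
theorem star_dotProduct_matV_eq_ofReal (z : Matrix (Fin m) (Fin n) ℂ) (x : Fin m → ℂ) :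
    star x ⬝ᵥ (matV z *ᵥ x)
      = ((∑ i, ‖x i‖ ^ 2 - ∑ i, ‖(zᴴ *ᵥ x) i‖ ^ 2 : ℝ) : ℂ) := by
  rw [star_dotProduct_matV, star_dotProduct_self, star_dotProduct_self]
  push_cast
  rfl

theorem posDef_matV_iff_forall (z : Matrix (Fin m) (Fin n) ℂ) :
    (matV z).PosDef ↔ ∀ x : Fin m → ℂ, x ≠ 0 →
      0 < ∑ i, ‖x i‖ ^ 2 - ∑ i, ‖(zᴴ *ᵥ x) i‖ ^ 2 := by
  rw [Matrix.posDef_iff_dotProduct_mulVec]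
  refine ⟨fun h x hx => ?_, fun h => ⟨matV_isHermitian z, fun x hx => ?_⟩⟩
  · have := h.2 hx
    rw [star_dotProduct_matV_eq_ofReal] at this
    exact_mod_cast this
  · rw [star_dotProduct_matV_eq_ofReal]
    exact_mod_cast h x hx

theorem posSemidef_matV_iff_forall (z : Matrix (Fin m) (Fin n) ℂ) :
    (matV z).PosSemidef ↔ ∀ x : Fin m → ℂ,
      0 ≤ ∑ i, ‖x i‖ ^ 2 - ∑ i, ‖(zᴴ *ᵥ x) i‖ ^ 2 := by
  rw [Matrix.posSemidef_iff_dotProduct_mulVec]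
  refine ⟨fun h x => ?_, fun h => ⟨matV_isHermitian z, fun x => ?_⟩⟩
  · have := h.2 x
    rw [star_dotProduct_matV_eq_ofReal] at this
    exact_mod_cast this
  · rw [star_dotProduct_matV_eq_ofReal]
    exact_mod_cast h x

theorem isOpen_posDef_matV : IsOpen {z : Matrix (Fin m) (Fin n) ℂ | (matV z).PosDef} := by
  rw [isOpen_iff_mem_nhds]
  intro z₀ hz₀
  have hcont : Continuous fun p : Matrix (Fin m) (Fin n) ℂ × (Fin m → ℂ) =>
      ∑ i, ‖p.2 i‖ ^ 2 - ∑ i, ‖(p.1ᴴ *ᵥ p.2) i‖ ^ 2 := by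
    have h1 : Continuous fun p : Matrix (Fin m) (Fin n) ℂ × (Fin m → ℂ) => p.1ᴴ *ᵥ p.2 :=
      continuous_fst.matrix_conjTranspose.matrix_mulVec continuous_snd
    fun_prop
  have hsph : ∀ᶠ z in 𝓝 z₀, ∀ x ∈ Metric.sphere (0 : Fin m → ℂ) 1,
      0 < ∑ i, ‖x i‖ ^ 2 - ∑ i, ‖(zᴴ *ᵥ x) i‖ ^ 2 := by
    refine (isCompact_sphere (0 : Fin m → ℂ) 1).eventually_forall_of_forall_eventually
      fun x hx => ?_
    refine hcont.continuousAt.eventually (lt_mem_nhds ?_)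
    exact (posDef_matV_iff_forall z₀).1 hz₀ x (by
      rintro rfl
      simp at hx)
  filter_upwards [hsph] with z hz
  refine (posDef_matV_iff_forall z).2 fun x hx => ?_
  have hx' : 0 < ‖x‖ := norm_pos_iff.2 hx
  have := hz ((‖x‖ : ℂ)⁻¹ • x) (by
    rw [mem_sphere_zero_iff_norm, norm_smul, norm_inv, Complex.norm_real, norm_norm,
      inv_mul_cancel₀ hx'.ne'])
  simp only [Matrix.mulVec_smul, Pi.smul_apply, norm_smul, mul_pow, ← Finset.mul_sum,
    ← mul_sub] at this
  exact pos_of_mul_pos_right this (by positivity)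

theorem isClosed_posSemidef_matV :
    IsClosed {z : Matrix (Fin m) (Fin n) ℂ | (matV z).PosSemidef} := by
  simp only [posSemidef_matV_iff_forall, Set.ofPred_forall]
  refine isClosed_iInter fun x => isClosed_le continuous_const ?_
  have h1 : Continuous fun z : Matrix (Fin m) (Fin n) ℂ => zᴴ *ᵥ x :=
    continuous_id.matrix_conjTranspose.matrix_mulVec continuous_const
  fun_prop

theorem norm_le_one_of_posSemidef {z : Matrix (Fin m) (Fin n) ℂ} (h : (matV z).PosSemidef)
    (j : Fin m) (α : Fin n) : ‖z j α‖ ≤ 1 := by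
  have h1 := (posSemidef_matV_iff_forall z).1 h (Pi.single j 1)
  have h2 : ∑ i, ‖(Pi.single j 1 : Fin m → ℂ) i‖ ^ 2 = 1 := by
    rw [Finset.sum_eq_single j] <;> simp +contextual
  rw [h2] at h1
  have h3 : ‖z j α‖ ^ 2 ≤ ∑ i, ‖(zᴴ *ᵥ Pi.single j 1) i‖ ^ 2 := by
    refine le_trans (le_of_eq ?_) (Finset.single_le_sum
      (f := fun i => ‖(zᴴ *ᵥ Pi.single j 1) i‖ ^ 2) (fun i _ => by positivity)
      (Finset.mem_univ α))
    simp
  exact (sq_le_one_iff₀ (norm_nonneg _)).1 (by linarith)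

theorem posDef_matV_smul {z : Matrix (Fin m) (Fin n) ℂ} (h : (matV z).PosDef) {t : ℂ}
    (ht : ‖t‖ ≤ 1) : (matV (t • z)).PosDef := by
  refine (posDef_matV_iff_forall _).2 fun x hx => ?_
  have h1 := (posDef_matV_iff_forall z).1 h x hx
  simp only [Matrix.conjTranspose_smul, Matrix.smul_mulVec, Pi.smul_apply, norm_smul, norm_star,
    mul_pow, ← Finset.mul_sum]
  have h2 : ‖t‖ ^ 2 ≤ 1 := (sq_le_one_iff₀ (norm_nonneg _)).2 ht
  have h3 : 0 ≤ ∑ i, ‖(zᴴ *ᵥ x) i‖ ^ 2 := by positivity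
  nlinarith

end DomTopology

/-! ### Differentiation of matrix-valued functions, entry by entry -/

section MatrixCalculus

variable {E : Type*} [NormedAddCommGroup E] {𝕜 : Type*} [NontriviallyNormedField 𝕜]
  [NormedAlgebra 𝕜 ℂ] [NormedSpace 𝕜 E] {m n k : ℕ} {x : E}

/-- `F'` is the derivative at `x` of the matrix-valued function `F`, entry by entry. -/
def HasMatrixDerivAt (𝕜 : Type*) [NontriviallyNormedField 𝕜] [NormedAlgebra 𝕜 ℂ]
    [NormedSpace 𝕜 E] (F F' : E → Matrix (Fin m) (Fin n) ℂ) (x : E) : Prop :=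
  ∀ i j, ∃ T : E →L[𝕜] ℂ, HasFDerivAt (fun y => F y i j) T x ∧ ∀ v, T v = F' v i j

namespace HasMatrixDerivAt

theorem const (A : Matrix (Fin m) (Fin n) ℂ) :
    HasMatrixDerivAt 𝕜 (fun _ => A) (fun _ : E => 0) x := fun _ _ =>
  ⟨0, hasFDerivAt_const _ _, fun _ => rfl⟩

variable {F F' G G' : E → Matrix (Fin m) (Fin n) ℂ} {H H' : E → Matrix (Fin n) (Fin k) ℂ}

theorem congr_deriv (hF : HasMatrixDerivAt 𝕜 F F' x) (h : ∀ v, F' v = G' v) :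
    HasMatrixDerivAt 𝕜 F G' x := fun i j =>
  let ⟨T, h1, h2⟩ := hF i j
  ⟨T, h1, fun v => by rw [h2, h]⟩

theorem add (hF : HasMatrixDerivAt 𝕜 F F' x) (hG : HasMatrixDerivAt 𝕜 G G' x) :
    HasMatrixDerivAt 𝕜 (fun y => F y + G y) (fun v => F' v + G' v) x := fun i j =>
  let ⟨T, h1, h2⟩ := hF i j
  let ⟨U, h3, h4⟩ := hG i j
  ⟨T + U, h1.add h3, fun v => by simp [h2, h4]⟩

theorem sub (hF : HasMatrixDerivAt 𝕜 F F' x) (hG : HasMatrixDerivAt 𝕜 G G' x) :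
    HasMatrixDerivAt 𝕜 (fun y => F y - G y) (fun v => F' v - G' v) x := fun i j =>
  let ⟨T, h1, h2⟩ := hF i j
  let ⟨U, h3, h4⟩ := hG i j
  ⟨T - U, h1.sub h3, fun v => by simp [h2, h4]⟩

theorem mul (hF : HasMatrixDerivAt 𝕜 F F' x) (hH : HasMatrixDerivAt 𝕜 H H' x) :
    HasMatrixDerivAt 𝕜 (fun y => F y * H y) (fun v => F' v * H x + F x * H' v) x := by
  intro i j
  choose T h1 h2 using hF
  choose U h3 h4 using hH
  refine ⟨∑ l, (F x i l • U l j + H x l j • T i l), ?_, fun v => ?_⟩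
  · simp only [Matrix.mul_apply]
    exact HasFDerivAt.fun_sum fun l _ => (h1 i l).mul (h3 l j)
  · simp only [_root_.sum_apply, _root_.add_apply, _root_.smul_apply, Matrix.add_apply,
      Matrix.mul_apply, h2, h4, ← Finset.sum_add_distrib, smul_eq_mul]
    exact Finset.sum_congr rfl fun l _ => by ring

theorem linearMap {E : Type*} [NormedAddCommGroup E] [NormedSpace 𝕜 E] [CompleteSpace 𝕜]
    [FiniteDimensional 𝕜 E] {x : E} (L : E →ₗ[𝕜] Matrix (Fin m) (Fin n) ℂ) :
    HasMatrixDerivAt 𝕜 (fun y => L y) (fun v => L v) x := fun i j =>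
  ⟨LinearMap.toContinuousLinearMap (Matrix.entryLinearMap 𝕜 ℂ i j ∘ₗ L),
    (LinearMap.toContinuousLinearMap (Matrix.entryLinearMap 𝕜 ℂ i j ∘ₗ L)).hasFDerivAt,
    fun _ => rfl⟩

theorem conjTranspose {E : Type*} [NormedAddCommGroup E] [NormedSpace ℝ E] {x : E}
    {F F' : E → Matrix (Fin m) (Fin n) ℂ} (hF : HasMatrixDerivAt ℝ F F' x) :
    HasMatrixDerivAt ℝ (fun y => (F y)ᴴ) (fun v => (F' v)ᴴ) x := fun i j =>
  let ⟨T, h1, h2⟩ := hF j i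
  ⟨(Complex.conjCLE : ℂ →L[ℝ] ℂ).comp T,
    (Complex.conjCLE : ℂ →L[ℝ] ℂ).hasFDerivAt.comp x h1, fun v => by simp [h2]⟩

theorem trace {F F' : E → Matrix (Fin m) (Fin m) ℂ} (hF : HasMatrixDerivAt 𝕜 F F' x) :
    ∃ T : E →L[𝕜] ℂ, HasFDerivAt (fun y => (F y).trace) T x ∧ ∀ v, T v = (F' v).trace := by
  choose T h1 h2 using hF
  refine ⟨∑ i, T i i, ?_, fun v => ?_⟩
  · simp only [Matrix.trace, Matrix.diag]
    exact HasFDerivAt.fun_sum fun i _ => h1 i i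
  · simp [Matrix.trace, h2]

theorem continuousLinearMap {V : Type*} [NormedAddCommGroup V] [NormedSpace ℂ V] [NormedSpace 𝕜 V]
    [IsScalarTower 𝕜 ℂ V] (hF : HasMatrixDerivAt 𝕜 F F' x)
    (L : Matrix (Fin m) (Fin n) ℂ →ₗ[ℂ] V) :
    ∃ T : E →L[𝕜] V, HasFDerivAt (fun y => L (F y)) T x ∧ ∀ v, T v = L (F' v) := by
  have hsum : ∀ X, L X = ∑ i, ∑ j, X i j • L (matUnit i j) := fun X => by
    conv_lhs => rw [Matrix.matrix_eq_sum_single X]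
    simp only [map_sum]
    refine Finset.sum_congr rfl fun i _ => Finset.sum_congr rfl fun j _ => ?_
    rw [← map_smul, Matrix.smul_single, smul_eq_mul, mul_one]
  choose T h1 h2 using hF
  refine ⟨∑ i, ∑ j, (T i j).smulRight (L (matUnit i j)), ?_, fun v => ?_⟩
  · rw [funext fun y => hsum (F y)]
    exact HasFDerivAt.fun_sum fun i _ => HasFDerivAt.fun_sum fun j _ => (h1 i j).smul_const _
  · rw [hsum]
    simp [h2]

open scoped Matrix.Norms.Operator in
theorem inv {F F' : E → Matrix (Fin m) (Fin m) ℂ} (hF : HasMatrixDerivAt 𝕜 F F' x)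
    (hu : IsUnit (F x)) :
    HasMatrixDerivAt 𝕜 (fun y => (F y)⁻¹) (fun v => -((F x)⁻¹ * F' v * (F x)⁻¹)) x := by
  obtain ⟨T, hT, hT'⟩ := hF.continuousLinearMap
    (LinearMap.id : Matrix (Fin m) (Fin m) ℂ →ₗ[ℂ] Matrix (Fin m) (Fin m) ℂ)
  obtain ⟨U, hU⟩ := hu
  have h1 := hasFDerivAt_ringInverse (𝕜 := 𝕜) U
  rw [hU] at h1
  have h2 := h1.comp x hT
  have hUinv : ((U⁻¹ : _ˣ) : Matrix (Fin m) (Fin m) ℂ) = (F x)⁻¹ := by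
    rw [← hU, Matrix.coe_units_inv]
  intro i j
  let ent : Matrix (Fin m) (Fin m) ℂ →L[𝕜] ℂ :=
    ⟨Matrix.entryLinearMap 𝕜 ℂ i j, continuous_id.matrix_elem i j⟩
  have h3 := ent.hasFDerivAt.comp x h2
  refine ⟨_, h3.congr_of_eventuallyEq (Eventually.of_forall fun y => ?_), fun v => ?_⟩
  · exact congrFun (congrFun (Matrix.nonsing_inv_eq_ringInverse (F y)) i) j
  · have hv : T v = F' v := hT' v
    simp only [← hUinv, ← hv]
    rfl

end HasMatrixDerivAt

open scoped Matrix.Norms.Operator in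
theorem contDiffAt_matrix_inv {N : E → Matrix (Fin n) (Fin n) ℂ} 
    (hN : ∀ i j, ContDiffAt 𝕜 2 (fun y => N y i j) x) (hu : IsUnit (N x)) (i j : Fin n) :
    ContDiffAt 𝕜 2 (fun y => (N y)⁻¹ i j) x := by
  have hN' : ContDiffAt 𝕜 2 N x := by
    have : N = fun y => ∑ i, ∑ j, N y i j • (matUnit i j : Matrix (Fin n) (Fin n) ℂ) := by
      funext y
      conv_lhs => rw [Matrix.matrix_eq_sum_single (N y)]
      simp [Matrix.smul_single]
    rw [this]
    exact ContDiffAt.sum fun i _ => ContDiffAt.sum fun j _ => (hN i j).smul contDiffAt_const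
  obtain ⟨U, hU⟩ := hu
  have h1 : ContDiffAt 𝕜 2 Ring.inverse (N x) := hU ▸ contDiffAt_ringInverse 𝕜 U
  let ent : Matrix (Fin n) (Fin n) ℂ →L[𝕜] ℂ :=
    ⟨Matrix.entryLinearMap 𝕜 ℂ i j, continuous_id.matrix_elem i j⟩
  refine (ent.contDiff.contDiffAt.comp x (h1.comp x hN')).congr_of_eventuallyEq
    (Eventually.of_forall fun y => ?_)
  exact congrFun (congrFun (Matrix.nonsing_inv_eq_ringInverse (N y)) i) j

end MatrixCalculus

namespace CartanData

variable {ι : Type*} [Fintype ι] [DecidableEq ι] {m n : ℕ} (S : CartanData ι m n)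

theorem continuous_toMat : Continuous S.toMat := S.toMat.continuous_of_finiteDimensional

theorem continuous_ofMat : Continuous S.ofMat := S.ofMat.continuous_of_finiteDimensional

theorem mem_dom {x : ι → ℂ} : x ∈ S.dom ↔ (matV (S.toMat x)).PosDef := Iff.rfl

theorem isOpen_dom : IsOpen S.dom := isOpen_posDef_matV.preimage S.continuous_toMat

theorem zero_mem_dom : (0 : ι → ℂ) ∈ S.dom := by
  rw [mem_dom, map_zero, matV]
  simpa using Matrix.PosDef.one

theorem posSemidef_of_mem_closure {x : ι → ℂ} (hx : x ∈ closure S.dom) :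
    (matV (S.toMat x)).PosSemidef :=
  closure_minimal (fun _ hy => Matrix.PosDef.posSemidef hy)
    (isClosed_posSemidef_matV.preimage S.continuous_toMat) hx

theorem smul_mem_dom {x : ι → ℂ} (hx : x ∈ S.dom) {t : ℂ} (ht : ‖t‖ ≤ 1) : t • x ∈ S.dom := by
  rw [mem_dom, map_smul]
  exact posDef_matV_smul hx ht

theorem isBounded_dom : Bornology.IsBounded S.dom := by
  have hb : Bornology.IsBounded (Set.pi Set.univ fun _ : Fin m => Set.pi Set.univ fun _ : Fin n =>
      Metric.closedBall (0 : ℂ) 1) :=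
    Bornology.IsBounded.pi fun _ => Bornology.IsBounded.pi fun _ => Metric.isBounded_closedBall
  have hK : IsCompact ((fun z => (S.c : ℂ)⁻¹ • S.ofMat z) '' (Set.pi Set.univ fun _ : Fin m =>
      Set.pi Set.univ fun _ : Fin n => Metric.closedBall (0 : ℂ) 1)) := by
    refine IsCompact.image ?_ (by have := S.continuous_ofMat; fun_prop)
    exact isCompact_univ_pi fun _ => isCompact_univ_pi fun _ => isCompact_closedBall _ _
  refine hK.isBounded.subset fun x hx => ⟨S.toMat x, ?_, ?_⟩
  · intro j _ α _
    rw [mem_closedBall_zero_iff]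
    exact norm_le_one_of_posSemidef (Matrix.PosDef.posSemidef hx) j α
  · simp only [S.ofMat_toMat]
    rw [inv_smul_smul₀ S.c_ne_zero]

theorem isCompact_closure_dom : IsCompact (closure S.dom) := S.isBounded_dom.isCompact_closure

/-! ### Automorphisms in coordinates -/

/-- The map `X ↦ A X B`, on coordinates. -/
noncomputable def sandwich (A : Matrix (Fin m) (Fin m) ℂ) (B : Matrix (Fin n) (Fin n) ℂ) :
    (ι → ℂ) →ₗ[ℂ] (ι → ℂ) where
  toFun v := (S.c : ℂ)⁻¹ • S.ofMat (A * S.toMat v * B)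
  map_add' v w := by simp only [map_add, Matrix.mul_add, Matrix.add_mul, smul_add]
  map_smul' t v := by
    simp only [map_smul, Matrix.mul_smul, Matrix.smul_mul, RingHom.id_apply]
    rw [smul_comm]

theorem sandwich_apply (A : Matrix (Fin m) (Fin m) ℂ) (B : Matrix (Fin n) (Fin n) ℂ)
    (v : ι → ℂ) : S.sandwich A B v = (S.c : ℂ)⁻¹ • S.ofMat (A * S.toMat v * B) := rfl

theorem toMat_inv_smul_ofMat (x : ι → ℂ) :
    S.toMat ((S.c : ℂ)⁻¹ • S.ofMat (S.toMat x)) = S.toMat x := by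
  rw [S.ofMat_toMat, inv_smul_smul₀ S.c_ne_zero]

theorem toMat_sandwich {A : Matrix (Fin m) (Fin m) ℂ} {B : Matrix (Fin n) (Fin n) ℂ}
    (h : IsAdmissible S.proj A B) (v : ι → ℂ) :
    S.toMat (S.sandwich A B v) = A * S.toMat v * B := by
  have h1 : S.proj (A * S.toMat v * B) = A * S.proj (S.toMat v) * B := h _
  rw [proj, proj, toMat_ofMat_toMat] at h1
  rw [sandwich_apply, map_smul, h1, Matrix.mul_smul, Matrix.smul_mul,
    inv_smul_smul₀ S.c_ne_zero]

theorem sandwich_ofMat {A : Matrix (Fin m) (Fin m) ℂ} {B : Matrix (Fin n) (Fin n) ℂ}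
    (h : IsAdmissible S.proj A B) (X : Matrix (Fin m) (Fin n) ℂ) :
    S.sandwich A B (S.ofMat X) = S.ofMat (A * X * B) := by
  apply S.toMat_injective
  rw [S.toMat_sandwich h]
  exact (h X).symm

/-- The automorphism `moebius` of the domain, in coordinates. -/
noncomputable def mob (a : ι → ℂ) (C : Matrix (Fin m) (Fin m) ℂ) (D : Matrix (Fin n) (Fin n) ℂ)
    (x : ι → ℂ) : ι → ℂ :=
  (S.c : ℂ)⁻¹ • S.ofMat (moebius (S.toMat a) C D (S.toMat x))

section Mob

variable {a x : ι → ℂ} {C : Matrix (Fin m) (Fin m) ℂ} {D : Matrix (Fin n) (Fin n) ℂ}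

theorem toMat_mob (hadm : IsAdmissible S.proj C D)
    (hu : IsUnit (1 + (S.toMat a)ᴴ * S.toMat x)) :
    S.toMat (S.mob a C D x) = moebius (S.toMat a) C D (S.toMat x) := by
  obtain ⟨y, hy⟩ := S.exists_toMat_eq a x hu
  have : moebius (S.toMat a) C D (S.toMat x) = S.toMat (a + S.sandwich C D y) := by
    rw [moebius, ← hy, map_add, S.toMat_sandwich hadm]
  rw [mob, this, toMat_inv_smul_ofMat]

theorem mob_zero : S.mob a C D 0 = a := by
  rw [mob, map_zero, moebius_zero, S.ofMat_toMat, inv_smul_smul₀ S.c_ne_zero]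

theorem isUnit_of_mem_closure (ha : a ∈ S.dom) (hx : x ∈ closure S.dom) :
    IsUnit (1 + (S.toMat a)ᴴ * S.toMat x) :=
  isUnit_one_add ha (S.posSemidef_of_mem_closure hx)

theorem mob_mem_dom (h : IsSqrtPair (S.toMat a) C D) (hadm : IsAdmissible S.proj C D)
    (hx : x ∈ S.dom) : S.mob a C D x ∈ S.dom := by
  rw [mem_dom, S.toMat_mob hadm (S.isUnit_of_mem_closure h.posDef_matV (subset_closure hx))]
  exact posDef_moebius h hx

theorem mob_neg_mob (h : IsSqrtPair (S.toMat a) C D) (hadm : IsAdmissible S.proj C D)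
    (hx : x ∈ S.dom) : S.mob (-a) C D (S.mob a C D x) = x := by
  have hu := S.isUnit_of_mem_closure h.posDef_matV (subset_closure hx)
  apply S.toMat_injective
  have h' : IsSqrtPair (S.toMat (-a)) C D := by rw [map_neg]; exact h.neg
  rw [S.toMat_mob hadm (S.isUnit_of_mem_closure h'.posDef_matV
    (subset_closure (S.mob_mem_dom h hadm hx))), S.toMat_mob hadm hu, map_neg]
  exact moebius_neg_moebius h hu

theorem contDiffAt_toMat (i : Fin m) (j : Fin n) : ContDiffAt ℂ 2 (fun y => S.toMat y i j) x :=
  (LinearMap.toContinuousLinearMap (Matrix.entryLinearMap ℂ ℂ i j ∘ₗ S.toMat)).contDiff.contDiffAt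

theorem contDiffAt_mob (hu : IsUnit (1 + (S.toMat a)ᴴ * S.toMat x)) :
    ContDiffAt ℂ 2 (S.mob a C D) x := by
  have hN : ∀ i j, ContDiffAt ℂ 2 
      (fun y => (1 + (S.toMat a)ᴴ * S.toMat y : Matrix (Fin n) (Fin n) ℂ) i j) x := fun i j => by
    simp only [Matrix.add_apply, Matrix.mul_apply]
    exact contDiffAt_const.add (ContDiffAt.sum fun l _ => contDiffAt_const.mul
      (S.contDiffAt_toMat l j))
  have hinv := contDiffAt_matrix_inv hN hu
  have hent : ∀ i j, ContDiffAt ℂ 2 (fun y => moebius (S.toMat a) C D (S.toMat y) i j) x :=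
    fun i j => by
      simp only [moebius, Matrix.add_apply, Matrix.mul_apply]
      exact contDiffAt_const.add (ContDiffAt.sum fun l _ => (ContDiffAt.sum fun p _ =>
        contDiffAt_const.mul (ContDiffAt.sum fun q _ =>
          (S.contDiffAt_toMat p q).mul (hinv q l))).mul contDiffAt_const)
  have hsum : S.mob a C D = fun y => (S.c : ℂ)⁻¹ • ∑ i, ∑ j,
      moebius (S.toMat a) C D (S.toMat y) i j • S.dir i j := by
    funext y
    rw [mob]
    congr 1
    conv_lhs => rw [Matrix.matrix_eq_sum_single (moebius (S.toMat a) C D (S.toMat y))]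
    simp only [map_sum, dir]
    refine Finset.sum_congr rfl fun i _ => Finset.sum_congr rfl fun j _ => ?_
    rw [← map_smul, Matrix.smul_single, smul_eq_mul, mul_one]
  rw [hsum]
  exact (ContDiffAt.sum fun i _ => ContDiffAt.sum fun j _ =>
    (hent i j).smul contDiffAt_const).const_smul _

theorem hasFDerivAt_mob (hu : IsUnit (1 + (S.toMat a)ᴴ * S.toMat x)) :
    HasFDerivAt (S.mob a C D) (LinearMap.toContinuousLinearMap (S.sandwich
      (C * (1 + S.toMat x * (S.toMat a)ᴴ)⁻¹) ((1 + (S.toMat a)ᴴ * S.toMat x)⁻¹ * D))) x := by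
  have hL : HasMatrixDerivAt ℂ (fun y => S.toMat y) (fun v => S.toMat v) x :=
    HasMatrixDerivAt.linearMap S.toMat
  have hM := (HasMatrixDerivAt.const (S.toMat a)).add
    (((HasMatrixDerivAt.const C).mul (hL.mul
      (((HasMatrixDerivAt.const 1).add ((HasMatrixDerivAt.const (S.toMat a)ᴴ).mul hL)).inv
        hu))).mul (HasMatrixDerivAt.const D))
  obtain ⟨T, hT, hT'⟩ := hM.continuousLinearMap ((S.c : ℂ)⁻¹ • S.ofMat)
  refine hT.congr_fderiv ?_
  ext1 v
  have hd := (Matrix.isUnit_iff_isUnit_det _).1 hu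
  rw [hT' v]
  set N := 1 + (S.toMat a)ᴴ * S.toMat x with hNdef
  have key : S.toMat v * N⁻¹ + S.toMat x * -(N⁻¹ * ((S.toMat a)ᴴ * S.toMat v) * N⁻¹)
      = (1 + S.toMat x * (S.toMat a)ᴴ)⁻¹ * S.toMat v * N⁻¹ := by
    have hd' : IsUnit (1 + S.toMat x * (S.toMat a)ᴴ).det := by
      rwa [Matrix.det_one_add_mul_comm]
    have h1 : (1 + S.toMat x * (S.toMat a)ᴴ)⁻¹ = 1 - S.toMat x * N⁻¹ * (S.toMat a)ᴴ := by
      rw [push_through_inv hu, Matrix.mul_assoc]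
      have := Matrix.nonsing_inv_mul _ hd'
      rw [Matrix.mul_add, Matrix.mul_one] at this
      exact eq_sub_of_add_eq this
    rw [h1]
    simp only [Matrix.sub_mul, Matrix.one_mul, Matrix.mul_neg, Matrix.mul_assoc]
    abel
  simp only [Matrix.zero_mul, Matrix.mul_zero, zero_add, add_zero, LinearMap.smul_apply,
    LinearMap.coe_toContinuousLinearMap', sandwich_apply]
  rw [key]
  simp only [Matrix.mul_assoc]

theorem mob_mem_closure (h : IsSqrtPair (S.toMat a) C D) (hadm : IsAdmissible S.proj C D)
    (hx : x ∈ closure S.dom) : S.mob a C D x ∈ closure S.dom := by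
  have hc : ContinuousWithinAt (S.mob a C D) S.dom x :=
    (S.hasFDerivAt_mob (S.isUnit_of_mem_closure h.posDef_matV hx)).continuousAt.continuousWithinAt
  exact hc.mem_closure hx fun y hy => S.mob_mem_dom h hadm hy

theorem isAdmissible_mob (h : IsSqrtPair (S.toMat a) C D) (hadm : IsAdmissible S.proj C D)
    (hx : x ∈ S.dom) :
    IsAdmissible S.proj (C * (1 + S.toMat x * (S.toMat a)ᴴ)⁻¹)
      ((1 + (S.toMat a)ᴴ * S.toMat x)⁻¹ * D) :=
  hadm.mul (S.isAdmissible_inv a x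
    (S.isUnit_of_mem_closure h.posDef_matV (subset_closure hx)))

theorem mixedDeriv_comp_mob (h : IsSqrtPair (S.toMat a) C D) (hadm : IsAdmissible S.proj C D)
    (hx : x ∈ S.dom) {u : (ι → ℂ) → ℂ} (hu : ContDiffAt ℝ 2 u (S.mob a C D x))
    (X Y : Matrix (Fin m) (Fin n) ℂ) :
    mixedDeriv (S.ofMat X) (S.ofMat Y) (u ∘ S.mob a C D) x
      = mixedDeriv
        (S.ofMat (C * (1 + S.toMat x * (S.toMat a)ᴴ)⁻¹ * X *
          ((1 + (S.toMat a)ᴴ * S.toMat x)⁻¹ * D)))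
        (S.ofMat (C * (1 + S.toMat x * (S.toMat a)ᴴ)⁻¹ * Y *
          ((1 + (S.toMat a)ᴴ * S.toMat x)⁻¹ * D)))
        u (S.mob a C D x) := by
  have hun := S.isUnit_of_mem_closure h.posDef_matV (subset_closure hx)
  rw [mixedDeriv_comp (S.contDiffAt_mob hun) hu, (S.hasFDerivAt_mob hun).fderiv]
  simp only [LinearMap.coe_toContinuousLinearMap']
  rw [S.sandwich_ofMat (S.isAdmissible_mob h hadm hx), S.sandwich_ofMat
    (S.isAdmissible_mob h hadm hx)]

theorem contDiffAt_comp_mob (h : IsSqrtPair (S.toMat a) C D)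
    (hx : x ∈ S.dom) {u : (ι → ℂ) → ℂ} (hu : ContDiffAt ℝ 2 u (S.mob a C D x)) :
    ContDiffAt ℝ 2 (u ∘ S.mob a C D) x :=
  hu.comp x ((S.contDiffAt_mob
    (S.isUnit_of_mem_closure h.posDef_matV (subset_closure hx))).restrict_scalars ℝ)

/-- The Laplacian is invariant under the automorphisms of the domain. -/
theorem lap_comp_mob (h : IsSqrtPair (S.toMat a) C D) (hadm : IsAdmissible S.proj C D)
    (hx : x ∈ S.dom) {u : (ι → ℂ) → ℂ} (hu : ContDiffAt ℝ 2 u (S.mob a C D x)) :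
    S.lap (u ∘ S.mob a C D) x = S.lap u (S.mob a C D x) := by
  have hun := S.isUnit_of_mem_closure h.posDef_matV (subset_closure hx)
  obtain ⟨A, B, hAB, -, -⟩ := S.exists_sqrt x hx
  rw [S.lap_eq_sum (S.contDiffAt_comp_mob h hx hu) (A := A) (B := B)
    (by rw [hAB.conjTranspose_left, hAB.sq_left]) (by rw [hAB.conjTranspose_right, hAB.sq_right])]
  simp only [S.mixedDeriv_comp_mob h hadm hx hu]
  rw [S.lap_eq_sum hu (A := C * (1 + S.toMat x * (S.toMat a)ᴴ)⁻¹ * A)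
    (B := B * ((1 + (S.toMat a)ᴴ * S.toMat x)⁻¹ * D))]
  · simp only [Matrix.mul_assoc]
  · rw [S.toMat_mob hadm hun, matV_moebius h hun, ← hAB.sq_left, Matrix.conjTranspose_mul _ A,
      hAB.conjTranspose_left]
    simp only [Matrix.mul_assoc]
  · rw [S.toMat_mob hadm hun, matW_moebius h hun, ← hAB.sq_right, Matrix.conjTranspose_mul B,
      hAB.conjTranspose_right]
    simp only [Matrix.mul_assoc]

theorem matV_zero : matV (0 : Matrix (Fin m) (Fin n) ℂ) = 1 := by simp [matV]

theorem matW_zero : matW (0 : Matrix (Fin m) (Fin n) ℂ) = 1 := by simp [matW]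

theorem sys_zero (j k : Fin m) (u : (ι → ℂ) → ℂ) :
    S.sys j k u 0 = ∑ α, mixedDeriv (S.dir j α) (S.dir k α) u 0 := by
  simp [sys, matW_zero, Matrix.one_apply]

/-- The values at `a` of the operators `Δ^{jk}` vanish if their values at `0` vanish after
composition with the automorphism that takes `0` to `a`. -/
theorem sys_eq_zero_of_comp_mob (h : IsSqrtPair (S.toMat a) C D) (hadm : IsAdmissible S.proj C D)
    {u : (ι → ℂ) → ℂ} (hu : ContDiffAt ℝ 2 u a)
    (h0 : ∀ j k, S.sys j k (u ∘ S.mob a C D) 0 = 0) (j k : Fin m) : S.sys j k u a = 0 := by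
  have hu' : ContDiffAt ℝ 2 u (S.mob a C D 0) := by rwa [mob_zero]
  set M : Matrix (Fin m) (Fin m) ℂ := Matrix.of fun j k => S.sys j k u a with hM
  have h1 : Cᵀ * M * Cᵀ = 0 := by
    ext j k
    have := h0 j k
    rw [sys_zero] at this
    simp only [dir, S.mixedDeriv_comp_mob h hadm S.zero_mem_dom hu', map_zero, Matrix.zero_mul,
      Matrix.mul_zero, add_zero, inv_one, Matrix.mul_one, Matrix.one_mul, mob_zero] at this
    rw [S.sum_mixedDeriv hu (by rw [h.conjTranspose_right, h.sq_right])] at this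
    rw [Matrix.zero_apply, ← this]
    simp only [Matrix.mul_apply, Matrix.transpose_apply, hM, Matrix.of_apply, Finset.sum_mul]
    rw [Finset.sum_comm]
    refine Finset.sum_congr rfl fun a' _ => Finset.sum_congr rfl fun b _ => ?_
    have : conj (C b k) = C k b := by
      have := congrFun (congrFun h.conjTranspose_left k) b
      rwa [Matrix.conjTranspose_apply] at this
    rw [this]
    ring
  have hdet : IsUnit (Cᵀ).det := by
    rw [Matrix.det_transpose]
    exact h.isUnit_det_left
  have h2 : M = 0 := by
    have h3 := congrArg (fun Y => (Cᵀ)⁻¹ * Y * (Cᵀ)⁻¹) h1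
    simp only [Matrix.mul_assoc, Matrix.mul_nonsing_inv _ hdet, Matrix.mul_one, Matrix.zero_mul,
      Matrix.mul_zero, Matrix.nonsing_inv_mul_cancel_left _ _ hdet] at h3
    exact h3
  exact congrFun (congrFun h2 j) k

end Mob

end CartanData

/-! ### The Bergman kernel on the diagonal -/

section BergmanKernel

variable {ι : Type*} [Fintype ι] [DecidableEq ι] {D : Set (ι → ℂ)}

/-- The values `|f(z)|²` of the holomorphic functions `f` in the unit ball of `L²(D)`. -/
def bergmanValues (D : Set (ι → ℂ)) (z : ι → ℂ) : Set ℝ :=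
  {r : ℝ | ∃ f : (ι → ℂ) → ℂ, DifferentiableOn ℂ f D ∧
    (∫⁻ w in D, ‖f w‖ₑ ^ 2) ≤ 1 ∧ r = ‖f z‖ ^ 2}

theorem abs_det_restrictScalars (T : (ι → ℂ) →L[ℂ] (ι → ℂ)) :
    |(T.restrictScalars ℝ).det| = ‖T.det‖ ^ 2 := by
  have : (T.restrictScalars ℝ).det = Complex.normSq T.det := by
    rw [← Algebra.norm_complex_apply]
    exact LinearMap.det_restrictScalars
  rw [this, abs_of_nonneg (Complex.normSq_nonneg _), Complex.normSq_eq_norm_sq]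

theorem differentiableOn_det_fderiv {φ : (ι → ℂ) → (ι → ℂ)} (hφ : ∀ x ∈ D, ContDiffAt ℂ 2 φ x) :
    DifferentiableOn ℂ (fun x => (fderiv ℂ φ x).det) D := by
  intro x hx
  have h1 : DifferentiableAt ℂ (fderiv ℂ φ) x :=
    ((hφ x hx).fderiv_right (m := 1) (by norm_num)).differentiableAt (by norm_num)
  have h2 : (fun y => (fderiv ℂ φ y).det) = fun y => ∑ σ : Equiv.Perm ι,
      ((Equiv.Perm.sign σ : ℤ) : ℂ) * ∏ i, fderiv ℂ φ y (Pi.single i 1) (σ i) := by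
    funext y
    have : (fderiv ℂ φ y).det
        = (LinearMap.toMatrix' (fderiv ℂ φ y : (ι → ℂ) →ₗ[ℂ] (ι → ℂ))).det :=
      (LinearMap.det_toMatrix' _).symm
    rw [this, Matrix.det_apply']
    simp [LinearMap.toMatrix'_apply]
  rw [h2]
  have h3 : ∀ i j, DifferentiableAt ℂ (fun y => fderiv ℂ φ y (Pi.single i 1) j) x := fun i j =>
    differentiableAt_pi.1 (h1.clm_apply (differentiableAt_const _)) j
  refine DifferentiableAt.differentiableWithinAt ?_
  refine DifferentiableAt.fun_sum fun σ _ => (DifferentiableAt.const_mul ?_ _)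
  exact (HasFDerivAt.finsetProd fun i _ => (h3 i (σ i)).hasFDerivAt).differentiableAt

/-- The pullback `f ↦ det φ' · f ∘ φ` along an injective holomorphic map `φ` of `D` into itself does
not increase the norm of `L²(D)`. -/
theorem mul_mem_bergmanValues (hD : IsOpen D) {φ : (ι → ℂ) → (ι → ℂ)}
    (hφ : ∀ x ∈ D, ContDiffAt ℂ 2 φ x) (hmaps : Set.MapsTo φ D D) (hinj : Set.InjOn φ D)
    {z : ι → ℂ} {r : ℝ} (hr : r ∈ bergmanValues D (φ z)) :
    ‖(fderiv ℂ φ z).det‖ ^ 2 * r ∈ bergmanValues D z := by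
  obtain ⟨f, hf, hint, rfl⟩ := hr
  have hφd : ∀ x ∈ D, DifferentiableAt ℂ φ x := fun x hx =>
    (hφ x hx).differentiableAt (by norm_num)
  refine ⟨fun x => (fderiv ℂ φ x).det * f (φ x), ?_, ?_, ?_⟩
  · exact (differentiableOn_det_fderiv hφ).mul
      (hf.comp (fun x hx => (hφd x hx).differentiableWithinAt) hmaps)
  · have h1 := lintegral_image_eq_lintegral_abs_det_fderiv_mul volume hD.measurableSet
      (f' := fun x => (fderiv ℂ φ x).restrictScalars ℝ)
      (fun x hx => ((hφd x hx).hasFDerivAt.restrictScalars ℝ).hasFDerivWithinAt) hinj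
      (fun w => ‖f w‖ₑ ^ 2)
    have h2 : ∀ x, ‖(fderiv ℂ φ x).det * f (φ x)‖ₑ ^ 2
        = ENNReal.ofReal |((fderiv ℂ φ x).restrictScalars ℝ).det| * ‖f (φ x)‖ₑ ^ 2 := fun x => by
      rw [abs_det_restrictScalars, enorm_mul, mul_pow, ENNReal.ofReal_pow (norm_nonneg _),
        ofReal_norm]
    simp only [h2]
    rw [← h1]
    exact (lintegral_mono_set hmaps.image_subset).trans hint
  · rw [norm_mul, mul_pow]

/-- The transformation rule of the Bergman kernel under a biholomorphic map. -/
theorem bergmanKernelDiag_eq (hD : IsOpen D) {φ ψ : (ι → ℂ) → (ι → ℂ)}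
    (hφ : ∀ x ∈ D, ContDiffAt ℂ 2 φ x) (hψ : ∀ x ∈ D, ContDiffAt ℂ 2 ψ x)
    (hφD : Set.MapsTo φ D D) (hψD : Set.MapsTo ψ D D) (hψφ : ∀ x ∈ D, ψ (φ x) = x)
    (hφψ : ∀ x ∈ D, φ (ψ x) = x) {z : ι → ℂ} (hz : z ∈ D) :
    bergmanKernelDiag D z = ‖(fderiv ℂ φ z).det‖ ^ 2 * bergmanKernelDiag D (φ z) := by
  have hJ : (fderiv ℂ ψ (φ z)).det * (fderiv ℂ φ z).det = 1 := by
    have h1 : HasFDerivAt (ψ ∘ φ) ((fderiv ℂ ψ (φ z)).comp (fderiv ℂ φ z)) z :=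
      ((hψ _ (hφD hz)).differentiableAt (by norm_num)).hasFDerivAt.comp z
        ((hφ z hz).differentiableAt (by norm_num)).hasFDerivAt
    have h2 : HasFDerivAt (ψ ∘ φ) (ContinuousLinearMap.id ℂ (ι → ℂ)) z :=
      (hasFDerivAt_id z).congr_of_eventuallyEq
        ((hD.eventually_mem hz).mono fun y hy => hψφ y hy)
    have h3 := congrArg ContinuousLinearMap.det (h1.unique h2)
    rw [ContinuousLinearMap.det, ContinuousLinearMap.det] at h3
    simpa [ContinuousLinearMap.det] using h3
  have hset : bergmanValues D z = ‖(fderiv ℂ φ z).det‖ ^ 2 • bergmanValues D (φ z) := by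
    ext r
    rw [Set.mem_smul_set]
    constructor
    · intro hr
      refine ⟨‖(fderiv ℂ ψ (φ z)).det‖ ^ 2 * r, ?_, ?_⟩
      · refine mul_mem_bergmanValues hD hψ hψD (fun x hx y hy hxy => ?_) (by rwa [hψφ z hz])
        rw [← hφψ x hx, hxy, hφψ y hy]
      · rw [smul_eq_mul, ← mul_assoc, ← mul_pow, ← norm_mul, _root_.mul_comm (fderiv ℂ φ z).det,
          hJ, norm_one, one_pow, one_mul]
    · rintro ⟨s, hs, rfl⟩
      refine mul_mem_bergmanValues hD hφ hφD (fun x hx y hy hxy => ?_) hs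
      rw [← hψφ x hx, hxy, hψφ y hy]
  change sSup (bergmanValues D z) = _ * sSup (bergmanValues D (φ z))
  rw [hset, Real.sSup_smul_of_nonneg (by positivity), smul_eq_mul]

theorem lintegral_comp_smul {F : (ι → ℂ) → ENNReal} (hF : Measurable F) {t : ℂ} (ht : ‖t‖ = 1) :
    ∫⁻ x, F (t • x) = ∫⁻ x, F x := by
  have h1 : MeasurePreserving (fun z : ℂ => t * z) := by
    exact (rotation ⟨t, mem_sphere_zero_iff_norm.2 ht⟩).measurePreserving
  have h2 : MeasurePreserving (fun (x : ι → ℂ) i => t * x i) := volume_preserving_pi fun _ => h1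
  exact h2.lintegral_comp hF

/-- On a domain that is invariant under the disc, the mean value property bounds `|f(0)|²` by the
mean of `|f|²`. -/
theorem volume_mul_enorm_sq_le (hD : IsOpen D)
    (hbal : ∀ x ∈ D, ∀ t : ℂ, ‖t‖ ≤ 1 → t • x ∈ D) {f : (ι → ℂ) → ℂ}
    (hf : DifferentiableOn ℂ f D) :
    volume D * ‖f 0‖ₑ ^ 2 ≤ ∫⁻ w in D, ‖f w‖ₑ ^ 2 := by
  set F : (ι → ℂ) → ENNReal := D.indicator fun w => ‖f w‖ₑ ^ 2 with hF
  have hFm : Measurable F := by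
    classical
    rw [hF, ← Set.piecewise_eq_indicator]
    refine ContinuousOn.measurable_piecewise ?_ continuousOn_const hD.measurableSet
    exact (ENNReal.continuous_pow 2).comp_continuousOn (hf.continuousOn.enorm)
  -- The mean value property of `t ↦ f (t x) ^ 2` on the closed unit disc
  have hpt : ∀ x ∈ D, ‖f 0‖ₑ ^ 2 ≤ ENNReal.ofReal ((2 * Real.pi)⁻¹) *
      ∫⁻ θ in Set.Ioc 0 (2 * Real.pi), F (circleMap 0 1 θ • x) := by
    intro x hx
    have hd : DiffContOnCl ℂ (fun t : ℂ => f (t • x) ^ 2) (Metric.ball 0 |1|) := by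
      refine DifferentiableOn.diffContOnCl_ball (U := {t : ℂ | t • x ∈ D}) ?_ ?_
      · have hlin : DifferentiableOn ℂ (fun t : ℂ => t • x) {t : ℂ | t • x ∈ D} := by fun_prop
        exact (hf.comp hlin fun t ht => ht).pow 2
      · intro t ht
        exact hbal x hx t (by simpa using ht)
    have h1 := hd.circleAverage
    rw [Real.circleAverage_def, zero_smul,
      intervalIntegral.integral_of_le (by positivity)] at h1
    calc ‖f 0‖ₑ ^ 2 = ‖f 0 ^ 2‖ₑ := (enorm_pow _ _).symm
      _ = ‖(2 * Real.pi)⁻¹‖ₑ *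
          ‖∫ θ in Set.Ioc 0 (2 * Real.pi), f (circleMap 0 1 θ • x) ^ 2‖ₑ := by
        rw [← h1, enorm_smul]
      _ ≤ ENNReal.ofReal ((2 * Real.pi)⁻¹) *
          ∫⁻ θ in Set.Ioc 0 (2 * Real.pi), F (circleMap 0 1 θ • x) := by
        rw [Real.enorm_of_nonneg (by positivity)]
        gcongr
        refine (enorm_integral_le_lintegral_enorm _).trans (lintegral_mono fun θ => ?_)
        have hmem : circleMap 0 1 θ • x ∈ D := hbal x hx _ (by simp)
        rw [hF, Set.indicator_of_mem hmem, enorm_pow]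
  have hjoint : Measurable fun p : (ι → ℂ) × ℝ => F (circleMap 0 1 p.2 • p.1) := by
    refine hFm.comp ?_
    have : Continuous fun p : (ι → ℂ) × ℝ => circleMap 0 1 p.2 • p.1 :=
      ((continuous_circleMap 0 1).comp continuous_snd).smul continuous_fst
    exact this.measurable
  calc volume D * ‖f 0‖ₑ ^ 2 = ∫⁻ _ in D, ‖f 0‖ₑ ^ 2 := by
        rw [setLIntegral_const, _root_.mul_comm]
    _ ≤ ∫⁻ x in D, ENNReal.ofReal ((2 * Real.pi)⁻¹) *
          ∫⁻ θ in Set.Ioc 0 (2 * Real.pi), F (circleMap 0 1 θ • x) :=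
        setLIntegral_mono' hD.measurableSet hpt
    _ ≤ ∫⁻ x, ENNReal.ofReal ((2 * Real.pi)⁻¹) *
          ∫⁻ θ in Set.Ioc 0 (2 * Real.pi), F (circleMap 0 1 θ • x) :=
        setLIntegral_le_lintegral _ _
    _ = ENNReal.ofReal ((2 * Real.pi)⁻¹) *
          ∫⁻ θ in Set.Ioc 0 (2 * Real.pi), ∫⁻ x, F (circleMap 0 1 θ • x) := by
        rw [lintegral_const_mul' _ _ ENNReal.ofReal_ne_top, lintegral_lintegral_swap]
        exact hjoint.aemeasurable
    _ = ENNReal.ofReal ((2 * Real.pi)⁻¹) *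
          ∫⁻ _ in Set.Ioc 0 (2 * Real.pi), ∫⁻ x, F x := by
        congr 1
        refine lintegral_congr fun θ => lintegral_comp_smul hFm (by simp)
    _ = ∫⁻ x, F x := by
        rw [setLIntegral_const, Real.volume_Ioc, sub_zero, _root_.mul_comm (∫⁻ x, F x),
          ← mul_assoc, ← ENNReal.ofReal_mul (by positivity), inv_mul_cancel₀ (by positivity),
          ENNReal.ofReal_one, one_mul]
    _ = ∫⁻ w in D, ‖f w‖ₑ ^ 2 := lintegral_indicator hD.measurableSet _

/-- The supremum that defines `K(0, 0)` is finite and positive, as `K(0, 0) = 1 / vol D`. -/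
theorem bergmanKernelDiag_zero_pos (hD : IsOpen D) (hb : Bornology.IsBounded D)
    (h0 : (0 : ι → ℂ) ∈ D) (hbal : ∀ x ∈ D, ∀ t : ℂ, ‖t‖ ≤ 1 → t • x ∈ D) :
    0 < bergmanKernelDiag D 0 := by
  have hvol : volume D ≠ ⊤ := hb.measure_lt_top.ne
  have hvol0 : volume D ≠ 0 := (hD.measure_pos volume ⟨0, h0⟩).ne'
  have hpos : 0 < (volume D).toReal := ENNReal.toReal_pos hvol0 hvol
  have hbdd : BddAbove (bergmanValues D 0) := by
    refine ⟨(volume D).toReal⁻¹, ?_⟩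
    rintro r ⟨f, hf, hint, rfl⟩
    have h1 := (volume_mul_enorm_sq_le hD hbal hf).trans hint
    have h2 := ENNReal.toReal_mono ENNReal.one_ne_top h1
    rw [ENNReal.toReal_mul, ENNReal.toReal_pow, toReal_enorm, ENNReal.toReal_one] at h2
    rw [← one_div, le_div_iff₀ hpos, _root_.mul_comm]
    exact h2
  have hmem : (volume D).toReal⁻¹ ∈ bergmanValues D 0 := by
    refine ⟨fun _ => ((Real.sqrt (volume D).toReal⁻¹ : ℝ) : ℂ), differentiableOn_const _, ?_, ?_⟩
    · rw [setLIntegral_const]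
      have : ‖((Real.sqrt (volume D).toReal⁻¹ : ℝ) : ℂ)‖ₑ ^ 2 = (volume D)⁻¹ := by
        rw [← ofReal_norm, Complex.norm_real, Real.norm_of_nonneg (Real.sqrt_nonneg _),
          ← ENNReal.ofReal_pow (Real.sqrt_nonneg _), Real.sq_sqrt (by positivity),
          ENNReal.ofReal_inv_of_pos hpos, ENNReal.ofReal_toReal hvol]
      rw [this, ENNReal.inv_mul_cancel hvol0 hvol]
    · rw [Complex.norm_real, Real.norm_of_nonneg (Real.sqrt_nonneg _),
        Real.sq_sqrt (by positivity)]
  exact lt_of_lt_of_le (by positivity) (le_csSup hbdd hmem)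

end BergmanKernel

namespace CartanData

variable {ι : Type*} [Fintype ι] [DecidableEq ι] {m n : ℕ} (S : CartanData ι m n)

/-- The Bergman kernel on the diagonal is a multiple of `det V(z) ^ (-p)`. -/
theorem bergmanKernelDiag_dom {a : ι → ℂ} (ha : a ∈ S.dom) :
    bergmanKernelDiag S.dom 0
      = (matV (S.toMat a)).det.re ^ S.p * bergmanKernelDiag S.dom a := by
  obtain ⟨C, D, h, hadm, hdet⟩ := S.exists_sqrt a ha
  have hna : -a ∈ S.dom := by simpa using S.smul_mem_dom ha (t := -1) (by simp)
  have h' : IsSqrtPair (S.toMat (-a)) C D := by rw [map_neg]; exact h.neg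
  have hu : ∀ b ∈ S.dom, ∀ x ∈ S.dom, IsUnit (1 + (S.toMat b)ᴴ * S.toMat x) := fun b hb x hx =>
    S.isUnit_of_mem_closure hb (subset_closure hx)
  have key := bergmanKernelDiag_eq S.isOpen_dom (φ := S.mob a C D) (ψ := S.mob (-a) C D)
    (fun x hx => S.contDiffAt_mob (hu a ha x hx)) (fun x hx => S.contDiffAt_mob (hu _ hna x hx))
    (fun x hx => S.mob_mem_dom h hadm hx) (fun x hx => S.mob_mem_dom h' hadm hx)
    (fun x hx => S.mob_neg_mob h hadm hx)
    (fun x hx => by simpa using S.mob_neg_mob h' hadm hx) S.zero_mem_dom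
  rw [key, mob_zero, (S.hasFDerivAt_mob (hu a ha 0 S.zero_mem_dom)).fderiv,
    ← hdet (S.sandwich C D) (fun v => rfl)]
  congr 2
  simp [ContinuousLinearMap.det]

theorem det_matV_re_pos {a : ι → ℂ} (ha : a ∈ S.dom) : 0 < (matV (S.toMat a)).det.re := by
  have := Matrix.PosDef.det_pos ha
  exact (Complex.pos_iff.1 this).1

theorem log_bergmanKernelDiag_dom {a : ι → ℂ} (ha : a ∈ S.dom) :
    Real.log (bergmanKernelDiag S.dom a) = Real.log (bergmanKernelDiag S.dom 0)
      - S.p * Real.log (matV (S.toMat a)).det.re := by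
  have h0 : 0 < bergmanKernelDiag S.dom 0 := bergmanKernelDiag_zero_pos S.isOpen_dom
    S.isBounded_dom S.zero_mem_dom fun x hx t ht => S.smul_mem_dom hx ht
  have hd := S.det_matV_re_pos ha
  have hK := S.bergmanKernelDiag_dom ha
  have ha0 : 0 < bergmanKernelDiag S.dom a := by
    rw [hK] at h0
    exact pos_of_mul_pos_right h0 (by positivity)
  rw [hK, Real.log_mul (by positivity) ha0.ne', Real.log_pow]
  ring

end CartanData

/-! ### The Bergman metric -/

section DetCalculus

variable {E : Type*} [NormedAddCommGroup E] {𝕜 : Type*} [NontriviallyNormedField 𝕜]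
  [NormedAlgebra 𝕜 ℂ] [NormedSpace 𝕜 E] {m : ℕ} {x : E}

/-- Jacobi's formula. -/
theorem HasMatrixDerivAt.det {F F' : E → Matrix (Fin m) (Fin m) ℂ}
    (hF : HasMatrixDerivAt 𝕜 F F' x) :
    ∃ T : E →L[𝕜] ℂ, HasFDerivAt (fun y => (F y).det) T x ∧
      ∀ v, T v = ((F x).adjugate * F' v).trace := by
  choose T h1 h2 using hF
  refine ⟨∑ σ : Equiv.Perm (Fin m), ((Equiv.Perm.sign σ : ℤ) : ℂ) •
    ∑ i, (∏ j ∈ Finset.univ.erase i, F x (σ j) j) • T (σ i) i, ?_, fun v => ?_⟩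
  · simp only [Matrix.det_apply']
    exact HasFDerivAt.fun_sum fun σ _ => (HasFDerivAt.finsetProd fun i _ => h1 (σ i) i).const_mul _
  · have h3 : ∀ i, ((F x).updateCol i fun r => F' v r i).det
        = ∑ σ : Equiv.Perm (Fin m), ((Equiv.Perm.sign σ : ℤ) : ℂ) *
          ((∏ j ∈ Finset.univ.erase i, F x (σ j) j) * F' v (σ i) i) := fun i => by
      rw [Matrix.det_apply']
      refine Finset.sum_congr rfl fun σ _ => ?_
      rw [← Finset.prod_erase_mul _ _ (Finset.mem_univ i)]
      congr 2
      · refine Finset.prod_congr rfl fun j hj => ?_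
        rw [Matrix.updateCol_ne (Finset.ne_of_mem_erase hj)]
      · rw [Matrix.updateCol_self]
    have h4 : ((F x).adjugate * F' v).trace = ∑ i, ((F x).updateCol i fun r => F' v r i).det := by
      rw [Matrix.trace]
      refine Finset.sum_congr rfl fun i _ => ?_
      rw [← Matrix.cramer_apply, Matrix.cramer_eq_adjugate_mulVec]
      rfl
    rw [h4, Finset.sum_congr rfl fun i _ => h3 i, Finset.sum_comm]
    simp [h2, Finset.mul_sum]

end DetCalculus

theorem mixedDeriv_const_add_mul {ι : Type*} [Fintype ι] [DecidableEq ι] (a b : ℂ)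
    (f : (ι → ℂ) → ℂ) (x v w : ι → ℂ) :
    mixedDeriv v w (fun y => a + b * f y) x = b * mixedDeriv v w f x := by
  have hf : ∀ (c d : ℂ) (g : (ι → ℂ) → ℂ) (y : ι → ℂ),
      fderiv ℝ (fun y => c + d * g y) y = d • fderiv ℝ g y := fun c d g y => by
    rw [fderiv_const_add]
    exact congrFun (fderiv_const_smul_field d) y
  have h1 : dzbar w (fun y => a + b * f y) = fun y => 0 + b * dzbar w f y := by
    funext y
    simp only [dzbar, hf, _root_.smul_apply, smul_eq_mul]
    ring
  rw [mixedDeriv, h1, mixedDeriv]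
  simp only [dz, hf, _root_.smul_apply, smul_eq_mul]
  ring

/-- The complex Hessian of `exp φ`. Here `A` and `B` stand for `∂φ` and `∂̄φ`, and `A'` for
`∂∂̄φ` at `x`. -/
theorem mixedDeriv_cexp {ι : Type*} [Fintype ι] [DecidableEq ι] {φ : (ι → ℂ) → ℂ} {x w : ι → ℂ}
    {A B : (ι → ℂ) → (ι → ℂ) → ℂ} {A' B' : (ι → ℂ) → ℂ}
    (hφ : ∀ᶠ y in 𝓝 x, ∃ T : (ι → ℂ) →L[ℝ] ℂ, HasFDerivAt φ T y ∧ ∀ v, T v = A y v + B y v)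
    (hA : ∀ y v, A y (Complex.I • v) = Complex.I * A y v)
    (hB : ∀ y v, B y (Complex.I • v) = -(Complex.I * B y v))
    (hφ' : ∃ T : (ι → ℂ) →L[ℝ] ℂ, HasFDerivAt (fun y => B y w) T x ∧ ∀ v, T v = A' v + B' v)
    (hA' : ∀ v, A' (Complex.I • v) = Complex.I * A' v)
    (hB' : ∀ v, B' (Complex.I • v) = -(Complex.I * B' v)) (v : ι → ℂ) :
    mixedDeriv v w (fun y => Complex.exp (φ y)) x
      = Complex.exp (φ x) * (A' v + A x v * B x w) := by
  have h1 : dzbar w (fun y => Complex.exp (φ y)) =ᶠ[𝓝 x] fun y => Complex.exp (φ y) * B y w := by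
    filter_upwards [hφ] with y ⟨T, hT, hT'⟩
    refine dzbar_eq_of_hasFDerivAt hT.cexp (A := fun v => Complex.exp (φ y) * A y v)
      (B := fun v => Complex.exp (φ y) * B y v) (fun v => ?_) (fun v => ?_) (fun v => ?_) w
    · simp [hT', mul_add]
    · simp only [hA]; ring
    · simp only [hB]; ring
  obtain ⟨T, hT, hT'⟩ := hφ.self_of_nhds
  obtain ⟨U, hU, hU'⟩ := hφ'
  rw [mixedDeriv, dz_congr h1]
  refine dz_eq_of_hasFDerivAt (hT.cexp.mul hU)
    (A := fun v => Complex.exp (φ x) * (A' v + A x v * B x w))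
    (B := fun v => Complex.exp (φ x) * (B' v + B x v * B x w))
    (fun v => ?_) (fun v => ?_) (fun v => ?_) v
  · simp [hT', hU']
    ring
  · simp only [hA, hA']; ring
  · simp only [hB, hB']; ring

namespace CartanData

variable {ι : Type*} [Fintype ι] [DecidableEq ι] {m n : ℕ} (S : CartanData ι m n) {x : ι → ℂ}

theorem hasMatrixDerivAt_toMat :
    HasMatrixDerivAt ℝ (fun y => S.toMat y) (fun v => S.toMat v) x :=
  HasMatrixDerivAt.linearMap (S.toMat.restrictScalars ℝ)

theorem hasMatrixDerivAt_matV :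
    HasMatrixDerivAt ℝ (fun y => matV (S.toMat y))
      (fun v => -(S.toMat v * (S.toMat x)ᴴ + S.toMat x * (S.toMat v)ᴴ)) x :=
  ((HasMatrixDerivAt.const 1).sub
    (S.hasMatrixDerivAt_toMat.mul S.hasMatrixDerivAt_toMat.conjTranspose)).congr_deriv
    fun _ => zero_sub _

theorem isUnit_matV_of_mem (hx : x ∈ S.dom) : IsUnit (matV (S.toMat x)) := Matrix.PosDef.isUnit hx

theorem ofReal_det_matV (y : ι → ℂ) :
    (((matV (S.toMat y)).det.re : ℝ) : ℂ) = (matV (S.toMat y)).det := by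
  refine (Complex.conj_eq_iff_re).1 ?_
  rw [← RCLike.star_def, ← Matrix.det_conjTranspose, matV_isHermitian]

theorem ofReal_trace_matV (y : ι → ℂ) :
    (((matV (S.toMat y)).trace.re : ℝ) : ℂ) = (matV (S.toMat y)).trace := by
  refine (Complex.conj_eq_iff_re).1 ?_
  rw [← RCLike.star_def, ← Matrix.trace_conjTranspose, matV_isHermitian]

/-- `∂ log det V`. -/
noncomputable def dLogDet (y v : ι → ℂ) : ℂ :=
  -((matV (S.toMat y))⁻¹ * (S.toMat v * (S.toMat y)ᴴ)).trace

/-- `∂̄ log det V`. -/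
noncomputable def dbarLogDet (y v : ι → ℂ) : ℂ :=
  -((matV (S.toMat y))⁻¹ * (S.toMat y * (S.toMat v)ᴴ)).trace

theorem dLogDet_I_smul (y v : ι → ℂ) :
    S.dLogDet y (Complex.I • v) = Complex.I * S.dLogDet y v := by
  simp [dLogDet]

theorem dbarLogDet_I_smul (y v : ι → ℂ) :
    S.dbarLogDet y (Complex.I • v) = -(Complex.I * S.dbarLogDet y v) := by
  simp [dbarLogDet]

theorem hasFDerivAt_log_det (hx : x ∈ S.dom) : ∃ T : (ι → ℂ) →L[ℝ] ℂ,
    HasFDerivAt (fun y => Complex.log (matV (S.toMat y)).det) T x ∧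
      ∀ v, T v = S.dLogDet x v + S.dbarLogDet x v := by
  obtain ⟨T, hT, hT'⟩ := S.hasMatrixDerivAt_matV (x := x) |>.det
  have hslit : (matV (S.toMat x)).det ∈ Complex.slitPlane := Or.inl (S.det_matV_re_pos hx)
  refine ⟨(matV (S.toMat x)).det⁻¹ • T, ?_, fun v => ?_⟩
  · refine (((Complex.hasStrictDerivAt_log hslit).hasDerivAt.hasFDerivAt.restrictScalars ℝ).comp x
      hT).congr_fderiv ?_
    ext v
    simp [_root_.mul_comm]
  rw [_root_.smul_apply, hT', dLogDet, dbarLogDet, Matrix.inv_def, Ring.inverse_eq_inv',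
    Matrix.mul_neg, Matrix.trace_neg, Matrix.mul_add, Matrix.trace_add]
  simp only [Matrix.smul_mul, Matrix.trace_smul, smul_eq_mul]
  ring

/-- `∂∂̄ log det V(v, w) = - tr(V⁻¹ v W⁻¹ w*)`. -/
theorem hasFDerivAt_dbarLogDet (hx : x ∈ S.dom) (w : ι → ℂ) : ∃ T : (ι → ℂ) →L[ℝ] ℂ,
    HasFDerivAt (fun y => S.dbarLogDet y w) T x ∧ ∀ v, T v =
      -((matV (S.toMat x))⁻¹ * S.toMat v * (matW (S.toMat x))⁻¹ * (S.toMat w)ᴴ).trace +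
      -((matV (S.toMat x))⁻¹ * (S.toMat x * (S.toMat v)ᴴ) * (matV (S.toMat x))⁻¹ *
        S.toMat x * (S.toMat w)ᴴ).trace := by
  have hu := S.isUnit_matV_of_mem hx
  obtain ⟨T, hT, hT'⟩ := ((S.hasMatrixDerivAt_matV (x := x)).inv hu |>.mul
    (S.hasMatrixDerivAt_toMat.mul (HasMatrixDerivAt.const (S.toMat w)ᴴ))).trace
  refine ⟨-T, hT.neg, fun v => ?_⟩
  rw [_root_.neg_apply, hT', matW_inv hu, ← neg_add, ← Matrix.trace_add]
  congr 2
  simp only [Matrix.mul_neg, Matrix.neg_mul, neg_neg, Matrix.mul_add, Matrix.add_mul,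
    Matrix.mul_assoc, Matrix.mul_one, Matrix.mul_zero, add_zero]
  abel

theorem mixedDeriv_log_det (hx : x ∈ S.dom) (v w : ι → ℂ) :
    mixedDeriv v w (fun y => Complex.log (matV (S.toMat y)).det) x
      = -((matV (S.toMat x))⁻¹ * S.toMat v * (matW (S.toMat x))⁻¹ * (S.toMat w)ᴴ).trace := by
  have h1 : dzbar w (fun y => Complex.log (matV (S.toMat y)).det) =ᶠ[𝓝 x]
      fun y => S.dbarLogDet y w := by
    filter_upwards [S.isOpen_dom.eventually_mem hx] with y hy
    obtain ⟨T, hT, hT'⟩ := S.hasFDerivAt_log_det hy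
    exact dzbar_eq_of_hasFDerivAt hT hT' (S.dLogDet_I_smul y) (S.dbarLogDet_I_smul y) w
  obtain ⟨T, hT, hT'⟩ := S.hasFDerivAt_dbarLogDet hx w
  rw [mixedDeriv, dz_congr h1]
  refine dz_eq_of_hasFDerivAt hT hT' (fun v => ?_) (fun v => ?_) v
  · simp
  · simp

theorem bergmanMetric_dom (hx : x ∈ S.dom) (i j : ι) : bergmanMetric S.dom x i j
    = S.p * ((matV (S.toMat x))⁻¹ * S.toMat (Pi.single i 1) * (matW (S.toMat x))⁻¹ *
      (S.toMat (Pi.single j 1))ᴴ).trace := by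
  have h1 : (fun w => ((Real.log (bergmanKernelDiag S.dom w) : ℝ) : ℂ)) =ᶠ[𝓝 x]
      fun w => (Real.log (bergmanKernelDiag S.dom 0) : ℂ)
        + (-(S.p : ℂ)) * Complex.log (matV (S.toMat w)).det := by
    filter_upwards [S.isOpen_dom.eventually_mem hx] with y hy
    rw [S.log_bergmanKernelDiag_dom hy, ← S.ofReal_det_matV y,
      ← Complex.ofReal_log (S.det_matV_re_pos hy).le, Complex.ofReal_re]
    push_cast
    ring
  rw [bergmanMetric, complexHessian, Matrix.of_apply, mixedDeriv_congr h1,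
    mixedDeriv_const_add_mul, S.mixedDeriv_log_det hx]
  ring

theorem trace_mul_proj (X : Matrix (Fin m) (Fin n) ℂ) (v : ι → ℂ) :
    (S.toMat (S.ofMat X) * (S.toMat v)ᴴ).trace = S.c * (X * (S.toMat v)ᴴ).trace := by
  have := congrArg star (S.trace_toMat_mul v X)
  rw [← Matrix.trace_conjTranspose, star_mul', ← Matrix.trace_conjTranspose] at this
  simpa using this

theorem sum_single_trace (M : Matrix (Fin m) (Fin n) ℂ) (j : Fin m) (α : Fin n) :
    ((matUnit j α : Matrix (Fin m) (Fin n) ℂ) * Mᴴ).trace = conj (M j α) := by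
  simp [Matrix.trace_single_mul]

theorem isAdmissible_inv_of_isUnit {A : Matrix (Fin m) (Fin m) ℂ} {B : Matrix (Fin n) (Fin n) ℂ}
    (h : IsAdmissible S.proj A B) (hA : IsUnit A.det) (hB : IsUnit B.det) :
    IsAdmissible S.proj A⁻¹ B⁻¹ := fun X => by
  have h1 := h (A⁻¹ * X * B⁻¹)
  have h2 : A * (A⁻¹ * X * B⁻¹) * B = X := by
    rw [← Matrix.mul_assoc, Matrix.nonsing_inv_mul_cancel_right _ _ hB,
      Matrix.mul_nonsing_inv_cancel_left _ _ hA]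
  rw [h2] at h1
  rw [h1, ← Matrix.mul_assoc, ← Matrix.mul_assoc, Matrix.nonsing_inv_mul _ hA, Matrix.one_mul,
    Matrix.mul_nonsing_inv_cancel_right _ _ hB]

theorem _root_.IsSqrtPair.inv_left {a : Matrix (Fin m) (Fin n) ℂ} {C : Matrix (Fin m) (Fin m) ℂ}
    {D : Matrix (Fin n) (Fin n) ℂ} (h : IsSqrtPair a C D) : (matV a)⁻¹ = C⁻¹ * C⁻¹ := by
  rw [← h.sq_left, Matrix.mul_inv_rev]

theorem _root_.IsSqrtPair.inv_right {a : Matrix (Fin m) (Fin n) ℂ} {C : Matrix (Fin m) (Fin m) ℂ}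
    {D : Matrix (Fin n) (Fin n) ℂ} (h : IsSqrtPair a C D) : (matW a)⁻¹ = D⁻¹ * D⁻¹ := by
  rw [← h.sq_right, Matrix.mul_inv_rev]

/-- The vectors `F_{jα} = ofMat (C E_{jα} D)` are, up to the factor `c`, an orthonormal frame of
`tr(V⁻¹ v W⁻¹ w*)`. -/
theorem trace_frame {C : Matrix (Fin m) (Fin m) ℂ} {D : Matrix (Fin n) (Fin n) ℂ}
    (h : IsSqrtPair (S.toMat x) C D) (hadm : IsAdmissible S.proj C D) (j : Fin m) (α : Fin n)
    (w : ι → ℂ) :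
    ((matV (S.toMat x))⁻¹ * S.toMat (S.ofMat (C * matUnit j α * D)) * (matW (S.toMat x))⁻¹ *
      (S.toMat w)ᴴ).trace = S.c * conj ((C⁻¹ * S.toMat w * D⁻¹) j α) := by
  have hC := h.isUnit_det_left
  have hD := h.isUnit_det_right
  have h1 : S.toMat (S.ofMat (C * matUnit j α * D)) = C * S.toMat (S.ofMat (matUnit j α)) * D :=
    hadm _
  have hadm' := S.isAdmissible_inv_of_isUnit hadm hC hD
  have h2 : (C⁻¹ * S.toMat w * D⁻¹)ᴴ = D⁻¹ * (S.toMat w)ᴴ * C⁻¹ := by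
    rw [Matrix.conjTranspose_mul, Matrix.conjTranspose_mul, Matrix.conjTranspose_nonsing_inv,
      Matrix.conjTranspose_nonsing_inv, h.conjTranspose_left, h.conjTranspose_right,
      Matrix.mul_assoc]
  have h3 : (matV (S.toMat x))⁻¹ * (C * S.toMat (S.ofMat (matUnit j α)) * D) *
      (matW (S.toMat x))⁻¹ * (S.toMat w)ᴴ
      = C⁻¹ * (S.toMat (S.ofMat (matUnit j α)) * (D⁻¹ * (S.toMat w)ᴴ)) := by
    rw [h.inv_left, h.inv_right]
    simp only [Matrix.mul_assoc]
    rw [Matrix.nonsing_inv_mul_cancel_left _ _ hC, Matrix.mul_nonsing_inv_cancel_left _ _ hD]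
  rw [h1, h3, Matrix.trace_mul_comm, Matrix.mul_assoc, ← h2, ← S.toMat_sandwich hadm',
    S.trace_mul_proj, sum_single_trace]

theorem sum_smul_frame (M : Matrix (Fin m) (Fin n) ℂ) (C : Matrix (Fin m) (Fin m) ℂ)
    (D : Matrix (Fin n) (Fin n) ℂ) :
    ∑ j : Fin m, ∑ α : Fin n, M j α • S.ofMat (C * matUnit j α * D) = S.ofMat (C * M * D) := by
  conv_rhs => rw [Matrix.matrix_eq_sum_single M]
  simp only [Matrix.mul_sum, Matrix.sum_mul, map_sum]
  refine Finset.sum_congr rfl fun j _ => Finset.sum_congr rfl fun α _ => ?_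
  rw [← map_smul, ← Matrix.smul_mul, ← Matrix.mul_smul, Matrix.smul_single, smul_eq_mul, mul_one]

/-- The Hua operator is a multiple of `∑ V_{jk} Δ^{jk}`. -/
theorem huaOperator_dom (hx : x ∈ S.dom) {u : (ι → ℂ) → ℂ} (hu : ContDiffAt ℝ 2 u x) :
    huaOperator S.dom u x = (S.p * S.c ^ 2 : ℂ)⁻¹ * S.lap u x := by
  obtain ⟨C, D, h, hadm, -⟩ := S.exists_sqrt x hx
  have hC := h.isUnit_det_left
  have hD := h.isUnit_det_right
  have hp : (S.p : ℂ) ≠ 0 := by exact_mod_cast S.p_pos.ne'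
  have hc := S.c_ne_zero
  set F : Fin m → Fin n → ι → ℂ := fun j α => S.ofMat (C * matUnit j α * D) with hF
  have hsingle : ∀ v : ι → ℂ, v = ∑ i, v i • (Pi.single i 1 : ι → ℂ) := fun v => by
    ext i
    simp [Pi.single_apply]
  -- The frame `F` is a multiple of a tight frame for the Bergman metric, so that `∑ F F*` is a
  -- multiple of the inverse metric.
  set N : Matrix ι ι ℂ := Matrix.of fun q r =>
    (S.p * S.c ^ 2 : ℂ)⁻¹ * ∑ j, ∑ α, F j α r * conj (F j α q) with hN
  have hinv : N * bergmanMetric S.dom x = 1 := by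
    ext q r
    set w : ι → ℂ := Pi.single r 1 with hw
    have h1 : ∀ j α, ∑ i, F j α i * bergmanMetric S.dom x i r
        = S.p * (S.c * conj ((C⁻¹ * S.toMat w * D⁻¹) j α)) := fun j α => by
      rw [← S.trace_frame h hadm j α w]
      conv_rhs => rw [show S.ofMat (C * matUnit j α * D) = F j α from rfl, hsingle (F j α)]
      simp only [map_sum, map_smul, Matrix.mul_sum, Matrix.sum_mul, Matrix.trace_sum,
        Matrix.mul_smul, Matrix.smul_mul, Matrix.trace_smul, smul_eq_mul, Finset.mul_sum]
      refine Finset.sum_congr rfl fun i _ => ?_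
      rw [S.bergmanMetric_dom hx]
      ring
    have h2 := S.sum_smul_frame (C⁻¹ * S.toMat w * D⁻¹) C D
    have h3 : C * (C⁻¹ * S.toMat w * D⁻¹) * D = S.toMat w := by
      rw [← Matrix.mul_assoc, Matrix.nonsing_inv_mul_cancel_right _ _ hD,
        Matrix.mul_nonsing_inv_cancel_left _ _ hC]
    rw [h3, S.ofMat_toMat] at h2
    have h4 := congrArg conj (congrFun h2 q)
    simp only [Finset.sum_apply, Pi.smul_apply, smul_eq_mul, map_sum, map_mul,
      Complex.conj_ofReal] at h4
    have h5 : (N * bergmanMetric S.dom x) q r = (S.p * S.c ^ 2 : ℂ)⁻¹ *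
        ∑ j, ∑ α, conj (F j α q) * ∑ i, F j α i * bergmanMetric S.dom x i r := by
      simp only [Matrix.mul_apply, hN, Matrix.of_apply, Finset.mul_sum, Finset.sum_mul]
      rw [Finset.sum_comm]
      refine Finset.sum_congr rfl fun j _ => ?_
      rw [Finset.sum_comm]
      refine Finset.sum_congr rfl fun α _ => Finset.sum_congr rfl fun i _ => ?_
      ring
    have h6 : ∑ j, ∑ α, conj (F j α q) * ∑ i, F j α i * bergmanMetric S.dom x i r
        = S.p * S.c * ∑ j, ∑ α, conj ((C⁻¹ * S.toMat w * D⁻¹) j α) * conj (F j α q) := by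
      simp only [h1, Finset.mul_sum]
      refine Finset.sum_congr rfl fun j _ => Finset.sum_congr rfl fun α _ => ?_
      ring
    rw [h5, h6, h4, hw, Matrix.one_apply, Pi.single_apply]
    split_ifs
    · simp only [map_one]
      field_simp
    · simp
  rw [huaOperator, kaehlerLaplacian, Matrix.inv_eq_left_inv hinv,
    S.lap_eq_sum hu (A := C) (B := D) (by rw [h.conjTranspose_left, h.sq_left])
      (by rw [h.conjTranspose_right, h.sq_right])]
  have h7 : ∀ v : ι → ℂ, mixedDeriv v v u x
      = ∑ i, ∑ j, v i * conj (v j) * mixedDeriv (Pi.single i 1) (Pi.single j 1) u x := fun v => by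
    rw [← leviForm_apply hu]
    conv_lhs => rw [hsingle v]
    simp only [map_sum, LinearMap.sum_apply, map_smul, LinearMap.smul_apply, LinearMap.map_smulₛₗ,
      smul_eq_mul, leviForm_apply, Finset.mul_sum]
    rw [Finset.sum_comm]
    refine Finset.sum_congr rfl fun i _ => Finset.sum_congr rfl fun j _ => ?_
    ring
  simp only [h7, hN, Matrix.of_apply, Finset.mul_sum, Finset.sum_mul]
  have : ∀ (f : ι → ι → Fin m → Fin n → ℂ), ∑ a, ∑ b, ∑ j, ∑ α, f a b j α
      = ∑ j, ∑ α, ∑ a, ∑ b, f a b j α := fun f => by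
    calc _ = ∑ a, ∑ j, ∑ b, ∑ α, f a b j α :=
          Finset.sum_congr rfl fun a _ => Finset.sum_comm
      _ = ∑ j, ∑ a, ∑ b, ∑ α, f a b j α := Finset.sum_comm
      _ = ∑ j, ∑ a, ∑ α, ∑ b, f a b j α := Finset.sum_congr rfl fun j _ =>
          Finset.sum_congr rfl fun a _ => Finset.sum_comm
      _ = _ := Finset.sum_congr rfl fun j _ => Finset.sum_comm
  rw [this]
  refine Finset.sum_congr rfl fun j _ => Finset.sum_congr rfl fun α _ =>
    Finset.sum_congr rfl fun a _ => Finset.sum_congr rfl fun b _ => ?_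
  ring

theorem huaOperator_eq_zero_iff (hx : x ∈ S.dom) {u : (ι → ℂ) → ℂ} (hu : ContDiffAt ℝ 2 u x) :
    huaOperator S.dom u x = 0 ↔ S.lap u x = 0 := by
  have hp : (S.p : ℂ) ≠ 0 := by exact_mod_cast S.p_pos.ne'
  have hc := S.c_ne_zero
  rw [S.huaOperator_dom hx hu, mul_eq_zero, or_iff_right (by simp [hp, hc])]

end CartanData

/-! ### Traces of powers of positive matrices -/

section TracePow

variable {m : ℕ} {V : Matrix (Fin m) (Fin m) ℂ}

theorem Matrix.IsHermitian.trace_pow (hV : V.IsHermitian) (k : ℕ) :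
    (V ^ k).trace = ((∑ i, hV.eigenvalues i ^ k : ℝ) : ℂ) := by
  conv_lhs => rw [hV.spectral_theorem, ← map_pow, Unitary.conjStarAlgAut_apply,
    Matrix.trace_mul_comm, ← Matrix.mul_assoc, Unitary.coe_star_mul_self, Matrix.one_mul,
    Matrix.diagonal_pow, Matrix.trace_diagonal]
  push_cast
  rfl

/-- If `V ≥ 0` and `tr V ≤ 1/2`, then `tr (V² - V³) ≥ (tr V)² / (2m)`. -/
theorem Matrix.PosSemidef.trace_sq_sub_cube (hV : V.PosSemidef) (h : V.trace.re ≤ 1 / 2) :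
    V.trace.re ^ 2 ≤ 2 * m * ((V ^ 2).trace.re - (V ^ 3).trace.re) := by
  have h1 := hV.isHermitian.trace_pow 1
  rw [pow_one] at h1
  rw [h1, Complex.ofReal_re] at h
  rw [h1, hV.isHermitian.trace_pow, hV.isHermitian.trace_pow, Complex.ofReal_re, Complex.ofReal_re,
    Complex.ofReal_re, ← Finset.sum_sub_distrib]
  set l := hV.isHermitian.eigenvalues with hl
  have hl0 : ∀ i, 0 ≤ l i := hV.eigenvalues_nonneg
  simp only [pow_one] at h ⊢
  have hle : ∀ i, l i ≤ 1 / 2 := fun i =>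
    (Finset.single_le_sum (fun i _ => hl0 i) (Finset.mem_univ i)).trans h
  have h2 : ∑ i, l i ^ 2 ≤ 2 * ∑ i, (l i ^ 2 - l i ^ 3) := by
    rw [Finset.mul_sum]
    refine Finset.sum_le_sum fun i _ => ?_
    nlinarith [sq_nonneg (l i), hle i]
  have h3 := sq_sum_le_card_mul_sum_sq (s := Finset.univ) (f := l)
  rw [Finset.card_univ, Fintype.card_fin] at h3
  calc (∑ i, l i) ^ 2 ≤ m * ∑ i, l i ^ 2 := h3
    _ ≤ m * (2 * ∑ i, (l i ^ 2 - l i ^ 3)) := by gcongr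
    _ = _ := by ring

end TracePow

theorem trace_mul_conjTranspose_self {m n : ℕ} (X : Matrix (Fin m) (Fin n) ℂ) :
    (X * Xᴴ).trace = ((∑ j, ∑ α, ‖X j α‖ ^ 2 : ℝ) : ℂ) := by
  simp only [Matrix.trace, Matrix.diag, Matrix.mul_apply, Matrix.conjTranspose_apply,
    RCLike.star_def, Complex.mul_conj']
  push_cast
  rfl

section MixedDerivLinear

variable {ι : Type*} [Fintype ι] [DecidableEq ι]

theorem mixedDeriv_add {u h : (ι → ℂ) → ℂ} {x : ι → ℂ} (hu : ContDiffAt ℝ 2 u x)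
    (hh : ContDiffAt ℝ 2 h x) (v w : ι → ℂ) :
    mixedDeriv v w (fun y => u y + h y) x = mixedDeriv v w u x + mixedDeriv v w h x := by
  have hd : ∀ {g : (ι → ℂ) → ℂ}, ContDiffAt ℝ 2 g x → ∀ᶠ y in 𝓝 x, DifferentiableAt ℝ g y :=
    fun hg => (hg.eventually (by simp)).mono fun y hy => hy.differentiableAt (by norm_num)
  have hd2 : ∀ {g : (ι → ℂ) → ℂ}, ContDiffAt ℝ 2 g x → DifferentiableAt ℝ (fderiv ℝ g) x :=
    fun hg => (hg.fderiv_right (m := 1) (by norm_num)).differentiableAt (by norm_num)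
  have h1 : fderiv ℝ (fun y => u y + h y) =ᶠ[𝓝 x] fun y => fderiv ℝ u y + fderiv ℝ h y := by
    filter_upwards [hd hu, hd hh] with y h1 h2 using fderiv_fun_add h1 h2
  have h2 : fderiv ℝ (fderiv ℝ (fun y => u y + h y)) x
      = fderiv ℝ (fderiv ℝ u) x + fderiv ℝ (fderiv ℝ h) x := by
    rw [h1.fderiv_eq, fderiv_fun_add (hd2 hu) (hd2 hh)]
  rw [mixedDeriv_eq (hu.add hh), mixedDeriv_eq hu, mixedDeriv_eq hh, h2]
  simp only [_root_.add_apply]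
  ring

theorem mixedDeriv_const_mul (b : ℂ) (f : (ι → ℂ) → ℂ) (x v w : ι → ℂ) :
    mixedDeriv v w (fun y => b * f y) x = b * mixedDeriv v w f x := by
  simpa using mixedDeriv_const_add_mul 0 b f x v w

end MixedDerivLinear

namespace CartanData

variable {ι : Type*} [Fintype ι] [DecidableEq ι] {m n : ℕ} (S : CartanData ι m n) {x : ι → ℂ}

theorem sys_add {u h : (ι → ℂ) → ℂ} (hu : ContDiffAt ℝ 2 u x) (hh : ContDiffAt ℝ 2 h x)
    (j k : Fin m) :
    S.sys j k (fun y => u y + h y) x = S.sys j k u x + S.sys j k h x := by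
  simp only [sys, mixedDeriv_add hu hh, mul_add, Finset.sum_add_distrib]

theorem sys_const_mul (b : ℂ) (u : (ι → ℂ) → ℂ) (j k : Fin m) :
    S.sys j k (fun y => b * u y) x = b * S.sys j k u x := by
  simp only [sys, mixedDeriv_const_mul, Finset.mul_sum]
  exact Finset.sum_congr rfl fun _ _ => Finset.sum_congr rfl fun _ _ => by ring

theorem lap_add {u h : (ι → ℂ) → ℂ} (hu : ContDiffAt ℝ 2 u x) (hh : ContDiffAt ℝ 2 h x) :
    S.lap (fun y => u y + h y) x = S.lap u x + S.lap h x := by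
  simp only [lap, S.sys_add hu hh, mul_add, Finset.sum_add_distrib]

theorem lap_const_mul (b : ℂ) (u : (ι → ℂ) → ℂ) :
    S.lap (fun y => b * u y) x = b * S.lap u x := by
  simp only [lap, S.sys_const_mul, Finset.mul_sum]
  exact Finset.sum_congr rfl fun _ _ => Finset.sum_congr rfl fun _ _ => by ring

/-! ### A superharmonic barrier and the maximum principle -/

theorem trace_matV_re_pos (hm : 0 < m) (hx : x ∈ S.dom) : 0 < (matV (S.toMat x)).trace.re := by
  have : Nonempty (Fin m) := ⟨⟨0, hm⟩⟩
  exact (Complex.pos_iff.1 (Matrix.PosDef.trace_pos hx)).1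

/-- `∂ log tr V`. -/
noncomputable def dLogTrace (y v : ι → ℂ) : ℂ :=
  -(S.toMat v * (S.toMat y)ᴴ).trace / (matV (S.toMat y)).trace

/-- `∂̄ log tr V`. -/
noncomputable def dbarLogTrace (y v : ι → ℂ) : ℂ :=
  -(S.toMat y * (S.toMat v)ᴴ).trace / (matV (S.toMat y)).trace

theorem hasFDerivAt_trace_matV : ∃ T : (ι → ℂ) →L[ℝ] ℂ,
    HasFDerivAt (fun y => (matV (S.toMat y)).trace) T x ∧
      ∀ v, T v = -((S.toMat v * (S.toMat x)ᴴ).trace + (S.toMat x * (S.toMat v)ᴴ).trace) := by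
  obtain ⟨T, hT, hT'⟩ := S.hasMatrixDerivAt_matV (x := x) |>.trace
  exact ⟨T, hT, fun v => by rw [hT', Matrix.trace_neg, Matrix.trace_add]⟩

theorem hasFDerivAt_log_trace (hm : 0 < m) (hx : x ∈ S.dom) : ∃ T : (ι → ℂ) →L[ℝ] ℂ,
    HasFDerivAt (fun y => Complex.log (matV (S.toMat y)).trace) T x ∧
      ∀ v, T v = S.dLogTrace x v + S.dbarLogTrace x v := by
  obtain ⟨T, hT, hT'⟩ := S.hasFDerivAt_trace_matV (x := x)
  have hslit : (matV (S.toMat x)).trace ∈ Complex.slitPlane := Or.inl (S.trace_matV_re_pos hm hx)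
  refine ⟨(matV (S.toMat x)).trace⁻¹ • T, ?_, fun v => ?_⟩
  · refine (((Complex.hasStrictDerivAt_log hslit).hasDerivAt.hasFDerivAt.restrictScalars ℝ).comp x
      hT).congr_fderiv ?_
    ext v
    simp [_root_.mul_comm]
  · rw [_root_.smul_apply, hT', dLogTrace, dbarLogTrace, smul_eq_mul]
    ring

theorem hasFDerivAt_dbarLogTrace (hm : 0 < m) (hx : x ∈ S.dom) (w : ι → ℂ) :
    ∃ T : (ι → ℂ) →L[ℝ] ℂ, HasFDerivAt (fun y => S.dbarLogTrace y w) T x ∧ ∀ v, T v =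
      (-(S.toMat v * (S.toMat w)ᴴ).trace / (matV (S.toMat x)).trace
        - (S.toMat x * (S.toMat w)ᴴ).trace * (S.toMat v * (S.toMat x)ᴴ).trace
          / (matV (S.toMat x)).trace ^ 2) +
      -((S.toMat x * (S.toMat w)ᴴ).trace * (S.toMat x * (S.toMat v)ᴴ).trace
          / (matV (S.toMat x)).trace ^ 2) := by
  obtain ⟨T, hT, hT'⟩ := S.hasFDerivAt_trace_matV (x := x)
  obtain ⟨U, hU, hU'⟩ := (S.hasMatrixDerivAt_toMat (x := x) |>.mul
    (HasMatrixDerivAt.const (S.toMat w)ᴴ)).trace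
  have h0 : (matV (S.toMat x)).trace ≠ 0 := by
    intro h
    have := S.trace_matV_re_pos hm hx
    rw [h] at this
    exact lt_irrefl _ this
  refine ⟨_, hU.neg.mul ((hasDerivAt_inv h0).hasFDerivAt.restrictScalars ℝ |>.comp x hT),
    fun v => ?_⟩
  simp [hT', hU']
  field_simp
  ring

/-- The logarithm of the barrier `(tr V)^{1/4} (det V)^{-ε}`. -/
noncomputable def logBarrier (ε : ℝ) (y : ι → ℂ) : ℂ :=
  (1 / 4 : ℂ) * Complex.log (matV (S.toMat y)).trace - ε * Complex.log (matV (S.toMat y)).det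

/-- The barrier `(tr V)^{1/4} (det V)^{-ε}`. The factor `(tr V)^{1/4}` makes it strictly
superharmonic, the factor `(det V)^{-ε}` makes it infinite at the boundary points with `V ≠ 0`. -/
noncomputable def barrier (ε : ℝ) (y : ι → ℂ) : ℂ := Complex.exp (S.logBarrier ε y)

theorem barrier_eq_ofReal (hm : 0 < m) (ε : ℝ) (hx : x ∈ S.dom) : S.barrier ε x
    = (Real.exp (1 / 4 * Real.log (matV (S.toMat x)).trace.re
      - ε * Real.log (matV (S.toMat x)).det.re) : ℝ) := by
  rw [barrier, logBarrier, ← S.ofReal_trace_matV, ← S.ofReal_det_matV,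
    ← Complex.ofReal_log (S.trace_matV_re_pos hm hx).le,
    ← Complex.ofReal_log (S.det_matV_re_pos hx).le]
  push_cast [Complex.ofReal_re]
  rfl

theorem contDiffAt_matV (i j : Fin m) :
    ContDiffAt ℝ 2 (fun y => matV (S.toMat y) i j) x := by
  have h : ∀ i j, ContDiffAt ℝ 2 (fun y => S.toMat y i j) x := fun i j =>
    (S.contDiffAt_toMat i j).restrict_scalars ℝ
  simp only [matV, Matrix.sub_apply, Matrix.mul_apply, Matrix.conjTranspose_apply]
  refine contDiffAt_const.sub (ContDiffAt.sum fun l _ => (h i l).mul ?_)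
  exact (Complex.conjCLE : ℂ →L[ℝ] ℂ).contDiff.contDiffAt.comp x (h j l)

theorem contDiffAt_barrier (hm : 0 < m) (ε : ℝ) (hx : x ∈ S.dom) :
    ContDiffAt ℝ 2 (S.barrier ε) x := by
  have hlog : ∀ {g : (ι → ℂ) → ℂ}, ContDiffAt ℝ 2 g x → 0 < (g x).re →
      ContDiffAt ℝ 2 (fun y => Complex.log (g y)) x := fun hg h0 =>
    ((Complex.contDiffAt_log (n := 2) (Or.inl h0)).restrict_scalars ℝ).comp x hg
  have htr : ContDiffAt ℝ 2 (fun y => (matV (S.toMat y)).trace) x :=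
    ContDiffAt.sum fun i _ => S.contDiffAt_matV i i
  have hdet : ContDiffAt ℝ 2 (fun y => (matV (S.toMat y)).det) x := by
    simp only [Matrix.det_apply']
    exact ContDiffAt.sum fun σ _ => contDiffAt_const.mul
      (contDiffAt_prod fun i _ => S.contDiffAt_matV (σ i) i)
  exact ((contDiffAt_const.mul (hlog htr (S.trace_matV_re_pos hm hx))).sub
    (contDiffAt_const.mul (hlog hdet (S.det_matV_re_pos hx)))).cexp

theorem conj_trace_mul (X Y : Matrix (Fin m) (Fin n) ℂ) :
    conj (X * Yᴴ).trace = (Y * Xᴴ).trace := by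
  rw [← RCLike.star_def, ← Matrix.trace_conjTranspose, Matrix.conjTranspose_mul,
    Matrix.conjTranspose_conjTranspose]

theorem mixedDeriv_barrier (hm : 0 < m) (ε : ℝ) (hx : x ∈ S.dom) (v w : ι → ℂ) :
    mixedDeriv v w (S.barrier ε) x = S.barrier ε x *
      ((1 / 4 * (-(S.toMat v * (S.toMat w)ᴴ).trace / (matV (S.toMat x)).trace
          - (S.toMat x * (S.toMat w)ᴴ).trace * (S.toMat v * (S.toMat x)ᴴ).trace
            / (matV (S.toMat x)).trace ^ 2)
        + ε * ((matV (S.toMat x))⁻¹ * S.toMat v * (matW (S.toMat x))⁻¹ * (S.toMat w)ᴴ).trace)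
      + (1 / 4 * S.dLogTrace x v - ε * S.dLogDet x v) *
        (1 / 4 * S.dbarLogTrace x w - ε * S.dbarLogDet x w)) := by
  obtain ⟨T, hT, hT'⟩ := S.hasFDerivAt_dbarLogTrace hm hx w
  obtain ⟨U, hU, hU'⟩ := S.hasFDerivAt_dbarLogDet hx w
  refine mixedDeriv_cexp (φ := S.logBarrier ε)
    (A := fun y v => 1 / 4 * S.dLogTrace y v - ε * S.dLogDet y v)
    (B := fun y v => 1 / 4 * S.dbarLogTrace y v - ε * S.dbarLogDet y v)
    (A' := fun v => 1 / 4 * (-(S.toMat v * (S.toMat w)ᴴ).trace / (matV (S.toMat x)).trace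
          - (S.toMat x * (S.toMat w)ᴴ).trace * (S.toMat v * (S.toMat x)ᴴ).trace
            / (matV (S.toMat x)).trace ^ 2)
        + ε * ((matV (S.toMat x))⁻¹ * S.toMat v * (matW (S.toMat x))⁻¹ * (S.toMat w)ᴴ).trace)
    (B' := fun v => 1 / 4 * (-((S.toMat x * (S.toMat w)ᴴ).trace *
            (S.toMat x * (S.toMat v)ᴴ).trace / (matV (S.toMat x)).trace ^ 2))
        + ε * ((matV (S.toMat x))⁻¹ * (S.toMat x * (S.toMat v)ᴴ) * (matV (S.toMat x))⁻¹ *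
        S.toMat x * (S.toMat w)ᴴ).trace)
    ?_ (fun y v => ?_) (fun y v => ?_) ?_ (fun v => ?_) (fun v => ?_) v
  · filter_upwards [S.isOpen_dom.eventually_mem hx] with y hy
    obtain ⟨T, hT, hT'⟩ := S.hasFDerivAt_log_trace hm hy
    obtain ⟨U, hU, hU'⟩ := S.hasFDerivAt_log_det hy
    refine ⟨_, (hT.const_mul _).sub (hU.const_mul _), fun v => ?_⟩
    simp [hT', hU']
    ring
  · simp [dLogTrace, dLogDet]
    ring
  · simp [dbarLogTrace, dbarLogDet]
    ring
  · refine ⟨_, (hT.const_mul _).sub (hU.const_mul _), fun v => ?_⟩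
    simp [hT', hU']
    ring
  · simp
    ring
  · simp
    ring

/-- The constant `∑ ‖Π(E_{jα})‖²`. -/
noncomputable def frameNorm : ℝ :=
  ∑ j : Fin m, ∑ α : Fin n, ∑ a, ∑ b, ‖S.toMat (S.ofMat (matUnit j α)) a b‖ ^ 2

section Frame

variable {C : Matrix (Fin m) (Fin m) ℂ} {D : Matrix (Fin n) (Fin n) ℂ}
  (h : IsSqrtPair (S.toMat x) C D) (hadm : IsAdmissible S.proj C D) (j : Fin m) (α : Fin n)
include h hadm

theorem frame_trace_V_mul : (S.toMat (S.ofMat (C * matUnit j α * D)) * (S.toMat x)ᴴ).trace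
    = S.c * conj ((matV (S.toMat x) * S.toMat x) j α) := by
  have h1 : S.toMat (S.ofMat (C * matUnit j α * D)) = C * S.toMat (S.ofMat (matUnit j α)) * D :=
    hadm _
  have h2 : (matV (S.toMat x) * S.toMat x)ᴴ = D * (S.toMat x)ᴴ * C := by
    have : matV (S.toMat x) * S.toMat x = C * S.toMat x * D := by
      rw [← h.sq_left, Matrix.mul_assoc, Matrix.mul_assoc C _ D, h.mul_comm]
    rw [this, Matrix.conjTranspose_mul, Matrix.conjTranspose_mul, h.conjTranspose_left,
      h.conjTranspose_right, Matrix.mul_assoc]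
  have h3 : matV (S.toMat x) * S.toMat x = S.toMat (S.sandwich C D x) := by
    rw [S.toMat_sandwich hadm, ← h.sq_left, Matrix.mul_assoc, Matrix.mul_assoc C _ D, h.mul_comm]
  rw [h1, Matrix.mul_assoc, Matrix.mul_assoc, Matrix.trace_mul_comm, Matrix.mul_assoc, ← h2, h3,
    S.trace_mul_proj, sum_single_trace]

theorem frame_trace_inv_mul :
    ((matV (S.toMat x))⁻¹ * (S.toMat (S.ofMat (C * matUnit j α * D)) * (S.toMat x)ᴴ)).trace
    = S.c * conj (S.toMat x j α) := by
  have h1 : S.toMat (S.ofMat (C * matUnit j α * D)) = C * S.toMat (S.ofMat (matUnit j α)) * D :=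
    hadm _
  have h2 : D * (S.toMat x)ᴴ = (S.toMat x)ᴴ * C := by
    have := congrArg Matrix.conjTranspose h.mul_comm
    rw [Matrix.conjTranspose_mul, Matrix.conjTranspose_mul, h.conjTranspose_left,
      h.conjTranspose_right] at this
    exact this.symm
  have h3 : (matV (S.toMat x))⁻¹ * (C * S.toMat (S.ofMat (matUnit j α)) * D * (S.toMat x)ᴴ)
      = C⁻¹ * (S.toMat (S.ofMat (matUnit j α)) * (S.toMat x)ᴴ * C) := by
    rw [h.inv_left]
    simp only [Matrix.mul_assoc]
    rw [Matrix.nonsing_inv_mul_cancel_left _ _ h.isUnit_det_left, h2]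
  rw [h1, h3, Matrix.trace_mul_comm, Matrix.mul_nonsing_inv_cancel_right _ _ h.isUnit_det_left,
    S.trace_mul_proj, sum_single_trace]

theorem frame_trace_inv_inv :
    ((matV (S.toMat x))⁻¹ * S.toMat (S.ofMat (C * matUnit j α * D)) * (matW (S.toMat x))⁻¹ *
      (S.toMat (S.ofMat (C * matUnit j α * D)))ᴴ).trace
    = (S.toMat (S.ofMat (matUnit j α)) * (S.toMat (S.ofMat (matUnit j α)))ᴴ).trace := by
  have h1 : S.toMat (S.ofMat (C * matUnit j α * D)) = C * S.toMat (S.ofMat (matUnit j α)) * D :=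
    hadm _
  rw [h1, h.inv_left, h.inv_right, Matrix.conjTranspose_mul, Matrix.conjTranspose_mul,
    h.conjTranspose_left, h.conjTranspose_right]
  simp only [Matrix.mul_assoc]
  rw [Matrix.nonsing_inv_mul_cancel_left _ _ h.isUnit_det_left,
    Matrix.mul_nonsing_inv_cancel_left _ _ h.isUnit_det_right,
    Matrix.nonsing_inv_mul_cancel_left _ _ h.isUnit_det_right, Matrix.trace_mul_comm]
  simp only [Matrix.mul_assoc]
  rw [Matrix.mul_nonsing_inv _ h.isUnit_det_left, Matrix.mul_one]

/-- The Levi form of the barrier on the frame vectors. -/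
theorem mixedDeriv_barrier_frame_le (hm : 0 < m) (ε : ℝ) (hx : x ∈ S.dom) :
    (mixedDeriv (S.ofMat (C * matUnit j α * D)) (S.ofMat (C * matUnit j α * D))
      (S.barrier ε) x).re ≤ (S.barrier ε x).re *
      (-((C * S.toMat (S.ofMat (matUnit j α)) * D) *
          (C * S.toMat (S.ofMat (matUnit j α)) * D)ᴴ).trace.re
            / (4 * (matV (S.toMat x)).trace.re)
        - S.c ^ 2 * ‖(matV (S.toMat x) * S.toMat x) j α‖ ^ 2
            / (8 * (matV (S.toMat x)).trace.re ^ 2)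
        + ε * ∑ a, ∑ b, ‖S.toMat (S.ofMat (matUnit j α)) a b‖ ^ 2
        + 2 * ε ^ 2 * S.c ^ 2 * ‖S.toMat x j α‖ ^ 2) := by
  have h1 : S.toMat (S.ofMat (C * matUnit j α * D)) = C * S.toMat (S.ofMat (matUnit j α)) * D :=
    hadm _
  have hA := S.frame_trace_V_mul h hadm j α
  have hB := S.frame_trace_inv_mul h hadm j α
  have hA' := congrArg conj hA
  rw [conj_trace_mul, map_mul, Complex.conj_ofReal, Complex.conj_conj] at hA'
  have hB' : ((matV (S.toMat x))⁻¹ * (S.toMat x *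
      (S.toMat (S.ofMat (C * matUnit j α * D)))ᴴ)).trace = S.c * S.toMat x j α := by
    have := congrArg conj hB
    rw [← RCLike.star_def, ← Matrix.trace_conjTranspose, Matrix.conjTranspose_mul,
      Matrix.conjTranspose_mul, Matrix.conjTranspose_conjTranspose,
      Matrix.conjTranspose_nonsing_inv, matV_isHermitian, Matrix.trace_mul_comm] at this
    simpa using this
  rw [S.mixedDeriv_barrier hm ε hx, dLogTrace, dbarLogTrace, dLogDet, dbarLogDet, hA, hB, hA', hB',
    S.frame_trace_inv_inv h hadm, h1, trace_mul_conjTranspose_self, trace_mul_conjTranspose_self,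
    ← S.ofReal_trace_matV, S.barrier_eq_ofReal hm ε hx, Complex.ofReal_re, Complex.ofReal_re,
    Complex.ofReal_re]
  have hτ := S.trace_matV_re_pos hm hx
  set τ := (matV (S.toMat x)).trace.re
  set a := (matV (S.toMat x) * S.toMat x) j α
  set b := S.toMat x j α
  set Y : ℝ := ∑ i, ∑ k, ‖(C * S.toMat (S.ofMat (matUnit j α)) * D) i k‖ ^ 2
  set Z : ℝ := ∑ i, ∑ k, ‖S.toMat (S.ofMat (matUnit j α)) i k‖ ^ 2
  rw [Complex.re_ofReal_mul]
  refine mul_le_mul_of_nonneg_left ?_ (Real.exp_pos _).le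
  have e1 : (1 / 4 * (-(Y : ℂ) / τ - S.c * a * (S.c * conj a) / τ ^ 2) + ε * Z
      + (1 / 4 * (-(S.c * conj a) / τ) - ε * -(S.c * conj b)) *
        (1 / 4 * (-(S.c * a) / τ) - ε * -(S.c * b)) : ℂ)
      = ((1 / 4 * (-Y / τ - S.c ^ 2 * ‖a‖ ^ 2 / τ ^ 2) + ε * Z
        + ‖(-(S.c / (4 * τ)) : ℝ) * a + (ε * S.c : ℝ) * b‖ ^ 2 : ℝ) : ℂ) := by
    push_cast
    rw [← Complex.mul_conj', ← Complex.mul_conj']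
    simp only [map_add, map_mul, map_neg, map_div₀, Complex.conj_ofReal, map_ofNat]
    field_simp
    ring
  rw [e1, Complex.ofReal_re]
  have e2 : ‖((-(S.c / (4 * τ)) : ℝ) : ℂ) * a + (ε * S.c : ℝ) * b‖ ^ 2
      ≤ 2 * (S.c / (4 * τ) * ‖a‖) ^ 2 + 2 * (ε * S.c * ‖b‖) ^ 2 := by
    have h3 := norm_add_le (((-(S.c / (4 * τ)) : ℝ) : ℂ) * a) ((ε * S.c : ℝ) * b)
    rw [norm_mul, norm_mul, Complex.norm_real, Complex.norm_real, Real.norm_eq_abs,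
      Real.norm_eq_abs] at h3
    have h4 := sq_le_sq₀ (norm_nonneg _) (by positivity) |>.2 h3
    refine h4.trans ?_
    have h5 : (|-(S.c / (4 * τ))| * ‖a‖) ^ 2 = (S.c / (4 * τ) * ‖a‖) ^ 2 := by
      rw [mul_pow, sq_abs, mul_pow, neg_sq]
    have h6 : (|ε * S.c| * ‖b‖) ^ 2 = (ε * S.c * ‖b‖) ^ 2 := by
      rw [mul_pow, sq_abs, ← mul_pow]
    rw [← h5, ← h6]
    linarith [add_sq_le (a := |-(S.c / (4 * τ))| * ‖a‖) (b := |ε * S.c| * ‖b‖)]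
  -- The first of these squares takes away half of the term `c² |a|² / (4 τ²)`.
  refine (add_le_add_right e2 _).trans (le_of_eq ?_)
  field_simp
  ring

end Frame

theorem sum_norm_sq_le (x : ι → ℂ) (hx : (matV (S.toMat x)).PosSemidef) :
    ∑ j, ∑ α, ‖S.toMat x j α‖ ^ 2 ≤ m := by
  have h1 := trace_mul_conjTranspose_self (S.toMat x)
  have h2 : S.toMat x * (S.toMat x)ᴴ = 1 - matV (S.toMat x) := by rw [matV]; abel
  rw [h2, Matrix.trace_sub, Matrix.trace_one, Fintype.card_fin] at h1
  have h3 := congrArg Complex.re h1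
  rw [Complex.ofReal_re, Complex.sub_re, Complex.natCast_re] at h3
  have h4 : 0 ≤ (matV (S.toMat x)).trace.re := (Complex.nonneg_iff.1 hx.trace_nonneg).1
  linarith

theorem sum_norm_matV_mul_sq (x : ι → ℂ) :
    ∑ j, ∑ α, ‖(matV (S.toMat x) * S.toMat x) j α‖ ^ 2
      = ((matV (S.toMat x)) ^ 2).trace.re - ((matV (S.toMat x)) ^ 3).trace.re := by
  have h1 := trace_mul_conjTranspose_self (matV (S.toMat x) * S.toMat x)
  have h2 : S.toMat x * (S.toMat x)ᴴ = 1 - matV (S.toMat x) := by rw [matV]; abel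
  have h3 : matV (S.toMat x) * S.toMat x * (matV (S.toMat x) * S.toMat x)ᴴ
      = matV (S.toMat x) ^ 2 - matV (S.toMat x) ^ 3 := by
    rw [Matrix.conjTranspose_mul, matV_isHermitian, Matrix.mul_assoc,
      ← Matrix.mul_assoc (S.toMat x), h2]
    noncomm_ring
  rw [h3, Matrix.trace_sub] at h1
  have := congrArg Complex.re h1
  rw [Complex.ofReal_re, Complex.sub_re] at this
  exact this.symm

/-- For small `ε` the barrier is strictly superharmonic. -/
theorem exists_lap_barrier_neg (hm : 0 < m) :
    ∃ ε : ℝ, 0 < ε ∧ ∀ x ∈ S.dom, (S.lap (S.barrier ε) x).re < 0 := by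
  have hc := S.c_pos
  have hκ := S.kappa_pos
  have hm' : (0 : ℝ) < m := by exact_mod_cast hm
  obtain ⟨γ, hγ, hγ1, hγ2⟩ : ∃ γ : ℝ, 0 < γ ∧ γ ≤ S.kappa / 8 ∧ γ ≤ S.c ^ 2 / (16 * m) :=
    ⟨min (S.kappa / 8) (S.c ^ 2 / (16 * m)), lt_min (by positivity) (by positivity),
      min_le_left _ _, min_le_right _ _⟩
  have hM0 : 0 ≤ S.frameNorm := by unfold frameNorm; positivity
  obtain ⟨ε, hε, hεγ⟩ : ∃ ε : ℝ, 0 < ε ∧ ε * S.frameNorm + 2 * ε ^ 2 * S.c ^ 2 * m < γ := by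
    have hcont : ContinuousAt (fun ε : ℝ => ε * S.frameNorm + 2 * ε ^ 2 * S.c ^ 2 * m) 0 := by
      fun_prop
    have h1 := hcont.eventually_lt (continuousAt_const (y := γ)) (by simpa using hγ)
    obtain ⟨ε, h2, h3⟩ := ((h1.filter_mono nhdsWithin_le_nhds).and
      (self_mem_nhdsWithin (s := Set.Ioi (0 : ℝ)))).exists
    exact ⟨ε, h3, h2⟩
  refine ⟨ε, hε, fun x hx => ?_⟩
  obtain ⟨C, D, h, hadm, -⟩ := S.exists_sqrt x hx
  rw [S.lap_eq_sum (S.contDiffAt_barrier hm ε hx) (A := C) (B := D)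
    (by rw [h.conjTranspose_left, h.sq_left]) (by rw [h.conjTranspose_right, h.sq_right]),
    Complex.re_sum]
  simp only [Complex.re_sum]
  have hb : 0 < (S.barrier ε x).re := by
    rw [S.barrier_eq_ofReal hm ε hx, Complex.ofReal_re]
    exact Real.exp_pos _
  refine lt_of_le_of_lt (Finset.sum_le_sum fun j _ => Finset.sum_le_sum fun α _ =>
    S.mixedDeriv_barrier_frame_le h hadm j α hm ε hx) ?_
  simp only [← Finset.mul_sum]
  refine mul_neg_of_pos_of_neg hb ?_
  simp only [Finset.sum_add_distrib, Finset.sum_sub_distrib, ← Finset.sum_div, ← Finset.mul_sum,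
    Finset.sum_neg_distrib]
  have hτ := S.trace_matV_re_pos hm hx
  have hk := S.kappa_le x C D h hadm
  have hs1 := S.sum_norm_sq_le x (Matrix.PosDef.posSemidef hx)
  have hs2 := S.sum_norm_matV_mul_sq x
  have hfr : ∑ j : Fin m, ∑ α : Fin n, ∑ a, ∑ b, ‖S.toMat (S.ofMat (matUnit j α)) a b‖ ^ 2
    = S.frameNorm := rfl
  rw [hfr]
  set τ := (matV (S.toMat x)).trace.re with hτdef
  set P : ℝ := ∑ j : Fin m, ∑ α : Fin n, ((C * S.toMat (S.ofMat (matUnit j α)) * D) *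
    (C * S.toMat (S.ofMat (matUnit j α)) * D)ᴴ).trace.re
  set Q : ℝ := ∑ j, ∑ α, ‖(matV (S.toMat x) * S.toMat x) j α‖ ^ 2
  have hQ0 : 0 ≤ Q := by positivity
  have hP0 : 0 ≤ P := le_trans (by positivity) hk
  -- The term in `P` is bounded below where `tr V` is large, and the term in `Q = tr (V² - V³)`
  -- where `tr V` is small.
  have hlow : γ ≤ P / (4 * τ) + S.c ^ 2 * Q / (8 * τ ^ 2) := by
    rcases le_or_gt τ (1 / 2) with ht | ht
    · have h1 := (Matrix.PosDef.posSemidef hx).trace_sq_sub_cube ht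
      rw [← hs2] at h1
      have h2 : S.c ^ 2 / (16 * m) ≤ S.c ^ 2 * Q / (8 * τ ^ 2) := by
        rw [div_le_div_iff₀ (by positivity) (by positivity)]
        have : 0 ≤ S.c ^ 2 := by positivity
        nlinarith
      have h3 : 0 ≤ P / (4 * τ) := by positivity
      linarith
    · have h2 : S.kappa / 8 ≤ P / (4 * τ) := by
        rw [div_le_div_iff₀ (by positivity) (by positivity)]
        have : S.kappa * τ * (1 / 2) ≤ S.kappa * τ * τ := by gcongr
        nlinarith
      have h3 : 0 ≤ S.c ^ 2 * Q / (8 * τ ^ 2) := by positivity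
      linarith
  have h5 : 2 * ε ^ 2 * S.c ^ 2 * ∑ j, ∑ α, ‖S.toMat x j α‖ ^ 2 ≤ 2 * ε ^ 2 * S.c ^ 2 * m := by
    gcongr
  rw [neg_div]
  linarith

theorem re_lap_nonpos {u : (ι → ℂ) → ℂ} (hx : x ∈ S.dom) (hu : ContDiffAt ℝ 2 u x)
    (hmax : IsLocalMax (fun y => (u y).re) x) : (S.lap u x).re ≤ 0 := by
  obtain ⟨C, D, h, -, -⟩ := S.exists_sqrt x hx
  rw [S.lap_eq_sum hu (A := C) (B := D)
    (by rw [h.conjTranspose_left, h.sq_left]) (by rw [h.conjTranspose_right, h.sq_right]),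
    Complex.re_sum]
  simp only [Complex.re_sum]
  exact Finset.sum_nonpos fun j _ => Finset.sum_nonpos fun α _ =>
    re_mixedDeriv_self_nonpos hu hmax _

/-- The maximum principle on the Shilov boundary `V = 0`. If `Re u > c` somewhere, then for some
`s > c` the quotient of `Re u - s` by the barrier has a positive maximum `M` in the domain, and
`u - M · barrier` contradicts the second derivative test there. -/
theorem re_le_of_lap_eq_zero (hm : 0 < m) {u : (ι → ℂ) → ℂ} (hu : ContDiffOn ℝ 2 u S.dom)
    (hc : ContinuousOn u (closure S.dom)) (hlap : ∀ x ∈ S.dom, S.lap u x = 0) {c : ℝ}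
    (hb : ∀ x ∈ closure S.dom, matV (S.toMat x) = 0 → (u x).re ≤ c) :
    ∀ x ∈ S.dom, (u x).re ≤ c := by
  intro x₀ hx₀
  by_contra! hlt
  obtain ⟨ε, hε, hneg⟩ := S.exists_lap_barrier_neg hm
  obtain ⟨s, hcs, hs⟩ := exists_between hlt
  set τ : (ι → ℂ) → ℝ := fun y => (matV (S.toMat y)).trace.re with hτ
  set d : (ι → ℂ) → ℝ := fun y => (matV (S.toMat y)).det.re with hd
  have hVc : Continuous fun y => matV (S.toMat y) := continuous_matV.comp S.continuous_toMat
  have hτc : Continuous τ := Complex.continuous_re.comp hVc.matrix_trace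
  have hdc : Continuous d := Complex.continuous_re.comp hVc.matrix_det
  have hτpos : ∀ y ∈ S.dom, 0 < τ y := fun y hy => S.trace_matV_re_pos hm hy
  have hdpos : ∀ y ∈ S.dom, 0 < d y := fun y hy => S.det_matV_re_pos hy
  have hf : ContinuousOn (fun y => (u y).re) (closure S.dom) :=
    Complex.continuous_re.comp_continuousOn hc
  set Q : (ι → ℂ) → ℝ := fun y => ((u y).re - s) * d y ^ ε / τ y ^ (1 / 4 : ℝ) with hQ
  have hδ : 0 < Q x₀ := by
    have := hτpos _ hx₀
    have := hdpos _ hx₀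
    have : 0 < (u x₀).re - s := sub_pos.2 hs
    simp only [hQ]
    positivity
  -- The inequality `Q x₀ ≤ Q y`, in a form that is continuous up to the boundary
  set G : (ι → ℂ) → ℝ := fun y => ((u y).re - s) * d y ^ ε - Q x₀ * τ y ^ (1 / 4 : ℝ) with hG
  have hGc : ContinuousOn G (closure S.dom) := by
    refine ((hf.sub continuousOn_const).mul ?_).sub (continuousOn_const.mul ?_)
    · exact (hdc.rpow_const fun _ => Or.inr hε.le).continuousOn
    · exact (hτc.rpow_const fun _ => Or.inr (by norm_num)).continuousOn
  set K : Set (ι → ℂ) := closure S.dom ∩ {y | s ≤ (u y).re ∧ 0 ≤ G y} with hK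
  have hKc : IsCompact K := by
    refine S.isCompact_closure_dom.of_isClosed_subset ?_ Set.inter_subset_left
    have h1 := hf.preimage_isClosed_of_isClosed isClosed_closure (isClosed_Ici (a := s))
    have h2 := hGc.preimage_isClosed_of_isClosed isClosed_closure (isClosed_Ici (a := (0 : ℝ)))
    convert h1.inter h2 using 1
    ext y
    simp only [hK, Set.mem_inter_iff, Set.mem_ofPred_eq, Set.mem_preimage, Set.mem_Ici]
    tauto
  -- At a boundary point `det V = 0`, so that `G ≥ 0` forces `V = 0`, where `Re u ≤ c < s`.
  have hKdom : K ⊆ S.dom := by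
    rintro y ⟨hy, hys, hyG⟩
    by_contra hnot
    have hps := S.posSemidef_of_mem_closure hy
    have hdet : d y = 0 := by
      by_contra hne
      refine hnot (hps.posDef_iff_isUnit.2 ((Matrix.isUnit_iff_isUnit_det _).2
        (isUnit_iff_ne_zero.2 fun h0 => hne ?_)))
      simp only [hd, h0, Complex.zero_re]
    have hτ0 : 0 ≤ τ y := (Complex.nonneg_iff.1 hps.trace_nonneg).1
    simp only [hG, hdet, Real.zero_rpow hε.ne', mul_zero, zero_sub, Left.nonneg_neg_iff] at hyG
    have h1 : τ y ^ (1 / 4 : ℝ) = 0 :=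
      le_antisymm (nonpos_of_mul_nonpos_right hyG hδ) (Real.rpow_nonneg hτ0 _)
    have h2 : τ y = 0 := ((Real.rpow_eq_zero_iff_of_nonneg hτ0).1 h1).1
    have h3 : (matV (S.toMat y)).trace = 0 := by
      rw [← S.ofReal_trace_matV]
      exact_mod_cast h2
    have h4 := hb y hy (hps.trace_eq_zero_iff.1 h3)
    linarith
  have hx₀K : x₀ ∈ K := by
    refine ⟨subset_closure hx₀, hs.le, ?_⟩
    have := Real.rpow_pos_of_pos (hτpos _ hx₀) (1 / 4 : ℝ)
    simp only [hG, hQ]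
    rw [div_mul_cancel₀ _ this.ne', sub_self]
  have hQc : ContinuousOn Q K := by
    refine ContinuousOn.div ((hf.mono Set.inter_subset_left).sub continuousOn_const |>.mul ?_) ?_
      fun y hy => (Real.rpow_pos_of_pos (hτpos _ (hKdom hy)) _).ne'
    · exact (hdc.rpow_const fun _ => Or.inr hε.le).continuousOn
    · exact (hτc.rpow_const fun _ => Or.inr (by norm_num)).continuousOn
  obtain ⟨x₁, hx₁K, hmax⟩ := hKc.exists_isMaxOn ⟨x₀, hx₀K⟩ hQc
  have hx₁ := hKdom hx₁K
  have hM : 0 < Q x₁ := hδ.trans_le (hmax hx₀K)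
  have hQle : ∀ y ∈ S.dom, Q y ≤ Q x₁ := by
    intro y hy
    by_cases hyK : y ∈ K
    · exact hmax hyK
    · have hτy := Real.rpow_pos_of_pos (hτpos _ hy) (1 / 4 : ℝ)
      have hdy := Real.rpow_pos_of_pos (hdpos _ hy) ε
      have h1 : ¬ (s ≤ (u y).re ∧ 0 ≤ G y) := fun h => hyK ⟨subset_closure hy, h⟩
      rw [not_and_or, not_le, not_le] at h1
      rcases h1 with h1 | h1
      · refine le_trans ?_ hM.le
        exact div_nonpos_of_nonpos_of_nonneg
          (mul_nonpos_of_nonpos_of_nonneg (by linarith) hdy.le) hτy.le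
      · refine le_trans ?_ (hmax hx₀K)
        rw [hQ]
        dsimp only
        rw [div_le_iff₀ hτy]
        simp only [hG] at h1
        linarith
  have hbar : ∀ y ∈ S.dom, (S.barrier ε y).re = τ y ^ (1 / 4 : ℝ) / d y ^ ε := by
    intro y hy
    rw [S.barrier_eq_ofReal hm ε hy, Complex.ofReal_re, Real.exp_sub,
      Real.rpow_def_of_pos (hτpos y hy), Real.rpow_def_of_pos (hdpos y hy),
      _root_.mul_comm (1 / 4 : ℝ), _root_.mul_comm ε]
  have hkey : ∀ y ∈ S.dom, (u y).re - s = Q y * (S.barrier ε y).re := by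
    intro y hy
    have hτy := Real.rpow_pos_of_pos (hτpos _ hy) (1 / 4 : ℝ)
    have hdy := Real.rpow_pos_of_pos (hdpos _ hy) ε
    rw [hbar y hy, hQ]
    dsimp only
    field_simp
  have hbpos : ∀ y ∈ S.dom, 0 < (S.barrier ε y).re := fun y hy => by
    rw [hbar y hy]
    exact div_pos (Real.rpow_pos_of_pos (hτpos _ hy) _) (Real.rpow_pos_of_pos (hdpos _ hy) _)
  have hloc : IsLocalMax (fun y => (u y + (-(Q x₁ : ℝ) : ℂ) * S.barrier ε y).re) x₁ := by
    filter_upwards [S.isOpen_dom.eventually_mem hx₁] with y hy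
    have h1 := hkey y hy
    have h2 := hkey x₁ hx₁
    have h3 := mul_le_mul_of_nonneg_right (hQle y hy) (hbpos y hy).le
    rw [← Complex.ofReal_neg, Complex.add_re, Complex.re_ofReal_mul, Complex.add_re,
      Complex.re_ofReal_mul]
    linarith
  have hu₁ : ContDiffAt ℝ 2 u x₁ := hu.contDiffAt (S.isOpen_dom.mem_nhds hx₁)
  have hb₁ := S.contDiffAt_barrier hm ε hx₁
  have hfin := S.re_lap_nonpos hx₁ (hu₁.add (contDiffAt_const.mul hb₁)) hloc
  rw [S.lap_add hu₁ (contDiffAt_const.mul hb₁), S.lap_const_mul, hlap _ hx₁, zero_add,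
    ← Complex.ofReal_neg, Complex.re_ofReal_mul] at hfin
  have := hneg _ hx₁
  nlinarith

/-- A solution of `Δu = 0` that is constant on the Shilov boundary is constant. -/
theorem eq_const_of_lap_eq_zero (hm : 0 < m) {u : (ι → ℂ) → ℂ} (hu : ContDiffOn ℝ 2 u S.dom)
    (hc : ContinuousOn u (closure S.dom)) (hlap : ∀ x ∈ S.dom, S.lap u x = 0) {c : ℂ}
    (hb : ∀ x ∈ closure S.dom, matV (S.toMat x) = 0 → u x = c) :
    ∀ x ∈ S.dom, u x = c := by
  -- The maximum principle for the real parts of `± u` and `± i u`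
  have key : ∀ b : ℂ, ∀ x ∈ S.dom, (b * u x).re ≤ (b * c).re := fun b =>
    S.re_le_of_lap_eq_zero hm (u := fun y => b * u y) (contDiffOn_const.mul hu)
      (continuousOn_const.mul hc) (fun x hx => by rw [S.lap_const_mul, hlap x hx, mul_zero])
      fun x hx h => by rw [hb x hx h]
  intro x hx
  have h1 := key 1 x hx
  have h2 := key (-1) x hx
  have h3 := key Complex.I x hx
  have h4 := key (-Complex.I) x hx
  simp at h1 h2 h3 h4
  exact Complex.ext (by linarith) (by linarith)

end CartanData

/-! ### Averages over compact families of linear maps -/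

section ParametricIntegral

variable {G : Type*} [TopologicalSpace G] [CompactSpace G] [MeasurableSpace G] [BorelSpace G]
  {μ : Measure G} [IsFiniteMeasure μ]

theorem integrable_of_continuous_of_compactSpace {H : Type*} [NormedAddCommGroup H]
    {f : G → H} (hf : Continuous f) : Integrable f μ :=
  hf.integrable_of_hasCompactSupport (HasCompactSupport.of_compactSpace f)

variable {E H : Type*} [NormedAddCommGroup E] [NormedSpace ℝ E] [LocallyCompactSpace E]
  [NormedAddCommGroup H] [NormedSpace ℝ H]

/-- Differentiation under the integral over a compact space, for a continuous derivative. -/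
theorem hasFDerivAt_integral_of_compactSpace {U : Set E} (hU : IsOpen U) {F : E → G → H}
    {F' : E → G → E →L[ℝ] H} (hF : ∀ x ∈ U, Continuous (F x))
    (hF' : ContinuousOn (Function.uncurry F') (U ×ˢ Set.univ))
    (hd : ∀ x ∈ U, ∀ k, HasFDerivAt (fun y => F y k) (F' x k) x) {x : E} (hx : x ∈ U) :
    HasFDerivAt (fun y => ∫ k, F y k ∂μ) (∫ k, F' x k ∂μ) x := by
  obtain ⟨K, hK, hxK, hKU⟩ := exists_compact_subset hU hx
  obtain ⟨M, hM⟩ := (hK.prod isCompact_univ).exists_bound_of_continuousOn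
    (hF'.mono (Set.prod_mono hKU subset_rfl))
  refine hasFDerivAt_integral_of_dominated_of_fderiv_le (s := K) (bound := fun _ => M)
    (mem_interior_iff_mem_nhds.1 hxK) ?_ ?_ ?_ (Eventually.of_forall fun k y hy => ?_)
    (integrable_const M) (Eventually.of_forall fun k y hy => ?_)
  · filter_upwards [hU.eventually_mem hx] with y hy using
      (hF y hy).aestronglyMeasurable_of_compactSpace
  · exact integrable_of_continuous_of_compactSpace (hF x hx)
  · have : Continuous (F' x) := hF'.comp_continuous (Continuous.prodMk_right x) fun k =>
      ⟨hx, Set.mem_univ _⟩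
    exact this.aestronglyMeasurable_of_compactSpace
  · exact hM (y, k) ⟨hy, Set.mem_univ _⟩
  · exact hd y (hKU hy) k

theorem continuousOn_integral_of_compactSpace {X : Type*} [TopologicalSpace X] {s : Set X}
    {F : X → G → H} (hF : ContinuousOn (Function.uncurry F) (s ×ˢ Set.univ)) :
    ContinuousOn (fun x => ∫ k, F x k ∂μ) s :=
  continuousOn_integral_of_compact_support isCompact_univ hF
    fun _ x _ hx => absurd (Set.mem_univ x) hx

end ParametricIntegral

section Average

variable {G : Type*} [TopologicalSpace G] [CompactSpace G] [MeasurableSpace G] [BorelSpace G]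
  {μ : Measure G} [IsFiniteMeasure μ] {ι : Type*} [Fintype ι] [DecidableEq ι]
  {D : Set (ι → ℂ)} {u : (ι → ℂ) → ℂ} {T : G → (ι → ℂ) →L[ℂ] (ι → ℂ)} {a : G → ℂ}

/-- The average of `u ∘ T k` over `k`, with weight `a k`. -/
noncomputable def weightedAverage (μ : Measure G) (T : G → (ι → ℂ) →L[ℂ] (ι → ℂ)) (a : G → ℂ)
    (u : (ι → ℂ) → ℂ) (x : ι → ℂ) : ℂ := ∫ k, a k * u (T k x) ∂μ

theorem continuous_family_apply (hT : Continuous T) :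
    Continuous fun p : (ι → ℂ) × G => T p.2 p.1 :=
  (hT.comp continuous_snd).clm_apply continuous_fst

theorem continuousOn_average (hT : Continuous T) (ha : Continuous a)
    (hmaps : ∀ k, Set.MapsTo (T k) D D) (hu : ContinuousOn u D) :
    ContinuousOn (weightedAverage μ T a u) D := by
  refine continuousOn_integral_of_compactSpace ((ha.comp continuous_snd).continuousOn.mul ?_)
  exact hu.comp (continuous_family_apply hT).continuousOn fun p hp => hmaps p.2 hp.1

/-- The second derivative of `x ↦ u (T x)` for linear `T`. -/
noncomputable def secondDerivComp (u : (ι → ℂ) → ℂ) (T : (ι → ℂ) →L[ℂ] (ι → ℂ)) (x : ι → ℂ) :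
    (ι → ℂ) →L[ℝ] (ι → ℂ) →L[ℝ] ℂ :=
  ((ContinuousLinearMap.compL ℝ (ι → ℂ) (ι → ℂ) ℂ).flip (T.restrictScalars ℝ)).comp
    ((fderiv ℝ (fderiv ℝ u) (T x)).comp (T.restrictScalars ℝ))

theorem secondDerivComp_apply (u : (ι → ℂ) → ℂ) (T : (ι → ℂ) →L[ℂ] (ι → ℂ)) (x v w : ι → ℂ) :
    secondDerivComp u T x v w = fderiv ℝ (fderiv ℝ u) (T x) (T v) (T w) := rfl

variable (hD : IsOpen D) (hT : Continuous T) (ha : Continuous a)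
  (hmaps : ∀ k, Set.MapsTo (T k) D D) (hu : ContDiffOn ℝ 2 u D)
include hD hT ha hmaps hu

theorem continuousOn_secondDeriv_family : ContinuousOn
    (Function.uncurry fun (x : ι → ℂ) k => a k • secondDerivComp u (T k) x)
    (D ×ˢ Set.univ) := by
  have h1 : ContinuousOn (fderiv ℝ (fderiv ℝ u)) D :=
    (hu.fderiv_of_isOpen (m := 1) hD (by norm_num)).continuousOn_fderiv_of_isOpen hD le_rfl
  have h2 : ContinuousOn (fun p : (ι → ℂ) × G => fderiv ℝ (fderiv ℝ u) (T p.2 p.1))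
      (D ×ˢ Set.univ) := h1.comp (continuous_family_apply hT).continuousOn fun p hp =>
        hmaps p.2 hp.1
  refine continuousOn_clm_apply.2 fun v => continuousOn_clm_apply.2 fun w => ?_
  have hTv : ∀ v, Continuous fun p : (ι → ℂ) × G => T p.2 v := fun v =>
    (hT.comp continuous_snd).clm_apply continuous_const
  exact (ha.comp continuous_snd).continuousOn.smul
    ((h2.clm_apply (hTv v).continuousOn).clm_apply (hTv w).continuousOn)

theorem hasFDerivAt_average {x : ι → ℂ} (hx : x ∈ D) : HasFDerivAt (weightedAverage μ T a u)
    (∫ k, a k • (fderiv ℝ u (T k x)).comp ((T k).restrictScalars ℝ) ∂μ) x := by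
  refine hasFDerivAt_integral_of_compactSpace hD (F := fun x k => a k * u (T k x))
    (F' := fun x k => a k • (fderiv ℝ u (T k x)).comp ((T k).restrictScalars ℝ))
    (fun y hy => ha.mul ?_) ?_ (fun y hy k => ?_) hx
  · exact hu.continuousOn.comp_continuous (hT.clm_apply continuous_const) fun k => hmaps k hy
  · have h2 : ContinuousOn (fun p : (ι → ℂ) × G => fderiv ℝ u (T p.2 p.1)) (D ×ˢ Set.univ) :=
      (hu.continuousOn_fderiv_of_isOpen hD (by norm_num)).comp
        (continuous_family_apply hT).continuousOn fun p hp => hmaps p.2 hp.1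
    refine (ha.comp continuous_snd).continuousOn.smul ?_
    refine continuousOn_clm_apply.2 fun v => ?_
    exact h2.clm_apply ((hT.comp continuous_snd).clm_apply continuous_const).continuousOn
  · have h1 : DifferentiableAt ℝ u (T k y) :=
      (hu.contDiffAt (hD.mem_nhds (hmaps k hy))).differentiableAt (by norm_num)
    exact (h1.hasFDerivAt.comp y ((T k).restrictScalars ℝ).hasFDerivAt).const_mul (a k)

theorem hasFDerivAt_fderiv_average {x : ι → ℂ} (hx : x ∈ D) :
    HasFDerivAt (fderiv ℝ (weightedAverage μ T a u))
      (∫ k, a k • secondDerivComp u (T k) x ∂μ) x := by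
  have h1 : fderiv ℝ (weightedAverage μ T a u) =ᶠ[𝓝 x]
      fun x => ∫ k, a k • (fderiv ℝ u (T k x)).comp ((T k).restrictScalars ℝ) ∂μ := by
    filter_upwards [hD.eventually_mem hx] with y hy using
      (hasFDerivAt_average hD hT ha hmaps hu hy).fderiv
  refine HasFDerivAt.congr_of_eventuallyEq ?_ h1
  refine hasFDerivAt_integral_of_compactSpace hD
    (F := fun x k => a k • (fderiv ℝ u (T k x)).comp ((T k).restrictScalars ℝ))
    (F' := fun x k => a k • secondDerivComp u (T k) x)
    (fun y hy => ha.smul ?_) (continuousOn_secondDeriv_family hD hT ha hmaps hu)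
    (fun y hy k => ?_) hx
  · refine continuous_clm_apply.2 fun v => ?_
    have := (hu.continuousOn_fderiv_of_isOpen hD (by norm_num)).comp_continuous
      (hT.clm_apply continuous_const) fun k => hmaps k hy
    exact this.clm_apply (hT.clm_apply continuous_const)
  · have h1 : DifferentiableAt ℝ (fderiv ℝ u) (T k y) :=
      ((hu.contDiffAt (hD.mem_nhds (hmaps k hy))).fderiv_right (m := 1)
        (by norm_num)).differentiableAt (by norm_num)
    have h2 := h1.hasFDerivAt.comp y ((T k).restrictScalars ℝ).hasFDerivAt
    exact (((ContinuousLinearMap.compL ℝ (ι → ℂ) (ι → ℂ) ℂ).flip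
      ((T k).restrictScalars ℝ)).hasFDerivAt.comp y h2).const_smul (a k)

theorem contDiffOn_average : ContDiffOn ℝ 2 (weightedAverage μ T a u) D := by
  intro x hx
  refine ContDiffAt.contDiffWithinAt ?_
  refine (contDiffAt_succ_iff_hasFDerivAt (n := 1)).2 ⟨fderiv ℝ (weightedAverage μ T a u),
    ⟨D, hD.mem_nhds hx, fun y hy =>
      (hasFDerivAt_average hD hT ha hmaps hu hy).differentiableAt.hasFDerivAt⟩, ?_⟩
  refine contDiffAt_one_iff.2 ⟨fun x => ∫ k, a k • secondDerivComp u (T k) x ∂μ, D,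
    hD.mem_nhds hx, ?_, fun y hy => hasFDerivAt_fderiv_average hD hT ha hmaps hu hy⟩
  exact continuousOn_integral_of_compactSpace
    (continuousOn_secondDeriv_family hD hT ha hmaps hu)

theorem continuous_mixedDeriv_family {x : ι → ℂ} (hx : x ∈ D) (v w : ι → ℂ) :
    Continuous fun k => a k * mixedDeriv (T k v) (T k w) u (T k x) := by
  have h2 : Continuous fun k => fderiv ℝ (fderiv ℝ u) (T k x) :=
    ((hu.fderiv_of_isOpen (m := 1) hD (by norm_num)).continuousOn_fderiv_of_isOpen hD
      le_rfl).comp_continuous (hT.clm_apply continuous_const) fun k => hmaps k hx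
  have hTv : ∀ v, Continuous fun k => T k v := fun v => hT.clm_apply continuous_const
  have h3 : ∀ v w, Continuous fun k => fderiv ℝ (fderiv ℝ u) (T k x) (T k v) (T k w) :=
    fun v w => (h2.clm_apply (hTv v)).clm_apply (hTv w)
  have h4 : ∀ k, mixedDeriv (T k v) (T k w) u (T k x) = _ := fun k =>
    mixedDeriv_eq (hu.contDiffAt (hD.mem_nhds (hmaps k hx))) (T k v) (T k w)
  simp only [h4, ← map_smul]
  have := h3 v w
  have := h3 v (Complex.I • w)
  have := h3 (Complex.I • v) w
  have := h3 (Complex.I • v) (Complex.I • w)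
  fun_prop

theorem mixedDeriv_average {x : ι → ℂ} (hx : x ∈ D) (v w : ι → ℂ) :
    mixedDeriv v w (weightedAverage μ T a u) x
      = ∫ k, a k * mixedDeriv (T k v) (T k w) u (T k x) ∂μ := by
  have hc : Continuous fun k => a k • secondDerivComp u (T k) x :=
    (continuousOn_secondDeriv_family hD hT ha hmaps hu).comp_continuous
      (Continuous.prodMk_right x) fun k => ⟨hx, Set.mem_univ _⟩
  have hc' : ∀ v, Continuous fun k => (a k • secondDerivComp u (T k) x) v := fun v =>
    hc.clm_apply continuous_const
  have hc'' : ∀ v w, Continuous fun k => (a k • secondDerivComp u (T k) x) v w := fun v w =>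
    (hc' v).clm_apply continuous_const
  have key : ∀ v w, fderiv ℝ (fderiv ℝ (weightedAverage μ T a u)) x v w
      = ∫ k, (a k • secondDerivComp u (T k) x) v w ∂μ := fun v w => by
    rw [(hasFDerivAt_fderiv_average hD hT ha hmaps hu hx).fderiv,
      ContinuousLinearMap.integral_apply (integrable_of_continuous_of_compactSpace hc),
      ContinuousLinearMap.integral_apply (integrable_of_continuous_of_compactSpace (hc' v))]
  have hi : ∀ v w, Integrable (fun k => (a k • secondDerivComp u (T k) x) v w) μ := fun v w =>
    integrable_of_continuous_of_compactSpace (hc'' v w)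
  have h4 : ∀ k, mixedDeriv (T k v) (T k w) u (T k x) = _ := fun k =>
    mixedDeriv_eq (hu.contDiffAt (hD.mem_nhds (hmaps k hx))) (T k v) (T k w)
  rw [mixedDeriv_eq ((contDiffOn_average hD hT ha hmaps hu).contDiffAt (hD.mem_nhds hx))]
  simp only [key, h4]
  have hsum : ∀ {f₁ f₂ f₃ f₄ : G → ℂ}, Integrable f₁ μ → Integrable f₂ μ → Integrable f₃ μ →
      Integrable f₄ μ → (1 / 4 : ℂ) * ((∫ k, f₁ k ∂μ) + Complex.I * (∫ k, f₂ k ∂μ)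
        - Complex.I * (∫ k, f₃ k ∂μ) + ∫ k, f₄ k ∂μ)
      = ∫ k, (1 / 4 : ℂ) * (f₁ k + Complex.I * f₂ k - Complex.I * f₃ k + f₄ k) ∂μ :=
    fun {f₁ f₂ f₃ f₄} h₁ h₂ h₃ h₄ => by
      have h₂' := h₂.const_mul Complex.I
      have h₃' := h₃.const_mul Complex.I
      have h₁₂ : Integrable (fun k => f₁ k + Complex.I * f₂ k) μ := h₁.add h₂'
      have h₁₃ : Integrable (fun k => f₁ k + Complex.I * f₂ k - Complex.I * f₃ k) μ :=
        h₁₂.sub h₃'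
      rw [integral_const_mul, integral_add h₁₃ h₄, integral_sub h₁₂ h₃', integral_add h₁ h₂',
        integral_const_mul,
        integral_const_mul]
  rw [hsum (hi _ _) (hi _ _) (hi _ _) (hi _ _)]
  refine integral_congr_ae (Eventually.of_forall fun k => ?_)
  simp only [_root_.smul_apply, secondDerivComp_apply, map_smul, smul_eq_mul]
  ring

end Average

namespace CartanData

variable {ι : Type*} [Fintype ι] [DecidableEq ι] {m n : ℕ} (S : CartanData ι m n) {x : ι → ℂ}

/-! ### Unitary families -/

section Unitary

variable {A : Matrix (Fin m) (Fin m) ℂ} {B : Matrix (Fin n) (Fin n) ℂ}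

theorem matV_sandwich (hB : B * Bᴴ = 1) (hA : A * Aᴴ = 1) (hadm : IsAdmissible S.proj A B) :
    matV (S.toMat (S.sandwich A B x)) = A * matV (S.toMat x) * Aᴴ := by
  rw [S.toMat_sandwich hadm, matV, matV, Matrix.mul_sub, Matrix.sub_mul, Matrix.mul_one, hA]
  simp only [Matrix.conjTranspose_mul, Matrix.mul_assoc]
  rw [← Matrix.mul_assoc B, hB, Matrix.one_mul]

theorem matW_sandwich (hB : Bᴴ * B = 1) (hA : Aᴴ * A = 1) (hadm : IsAdmissible S.proj A B) :
    matW (S.toMat (S.sandwich A B x)) = Bᴴ * matW (S.toMat x) * B := by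
  rw [S.toMat_sandwich hadm, matW, matW, Matrix.mul_sub, Matrix.sub_mul, Matrix.mul_one, hB]
  simp only [Matrix.conjTranspose_mul, Matrix.mul_assoc]
  rw [← Matrix.mul_assoc Aᴴ, hA, Matrix.one_mul]

theorem sandwich_mem_dom (hB : B * Bᴴ = 1) (hA : A * Aᴴ = 1) (hadm : IsAdmissible S.proj A B)
    (hx : x ∈ S.dom) : S.sandwich A B x ∈ S.dom := by
  rw [mem_dom, S.matV_sandwich hB hA hadm]
  have hu : IsUnit A := ⟨⟨A, Aᴴ, hA, mul_eq_one_comm.1 hA⟩, rfl⟩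
  exact (Matrix.IsUnit.posDef_star_right_conjugate_iff hu).2 hx

end Unitary

section Family

variable {G : Type*} [TopologicalSpace G] [CompactSpace G] [MeasurableSpace G] [BorelSpace G]
  {μ : Measure G} [IsFiniteMeasure μ] {A : G → Matrix (Fin m) (Fin m) ℂ}
  {B : G → Matrix (Fin n) (Fin n) ℂ} {a : G → ℂ} {u : (ι → ℂ) → ℂ}

/-- The continuous linear map `X ↦ A X B` on coordinates. -/
noncomputable def sandwichL (A : Matrix (Fin m) (Fin m) ℂ) (B : Matrix (Fin n) (Fin n) ℂ) :
    (ι → ℂ) →L[ℂ] (ι → ℂ) := LinearMap.toContinuousLinearMap (S.sandwich A B)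

theorem sandwichL_apply (A : Matrix (Fin m) (Fin m) ℂ) (B : Matrix (Fin n) (Fin n) ℂ)
    (x : ι → ℂ) : S.sandwichL A B x = S.sandwich A B x := rfl

theorem continuous_sandwichL (hA : Continuous A) (hB : Continuous B) :
    Continuous fun k => S.sandwichL (A k) (B k) := by
  refine continuous_clm_apply.2 fun v => ?_
  have h1 : Continuous fun k => A k * S.toMat v * B k :=
    (hA.matrix_mul continuous_const).matrix_mul hB
  exact (S.continuous_ofMat.comp h1).const_smul _

/-- Averaging over a compact family of unitary automorphisms `X ↦ A X B` of the domain. If the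
average of a solution `u` of `Δu = 0` is constant on the Shilov boundary, the average is constant,
whence the corresponding average of the values at `0` of the operators `Δ^{jk}` vanishes. -/
theorem integral_sys_zero_eq_zero (hm : 0 < m) (hA : Continuous A) (hB : Continuous B)
    (hAu : ∀ k, A k * (A k)ᴴ = 1) (hBu : ∀ k, B k * (B k)ᴴ = 1)
    (hadm : ∀ k, IsAdmissible S.proj (A k) (B k)) (ha : Continuous a)
    (hu : ContDiffOn ℝ 2 u S.dom) (hc : ContinuousOn u (closure S.dom))
    (hlap : ∀ x ∈ S.dom, S.lap u x = 0) {c : ℂ}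
    (hb : ∀ x ∈ closure S.dom, matV (S.toMat x) = 0 →
      ∫ k, a k * u (S.sandwich (A k) (B k) x) ∂μ = c) (j l : Fin m) :
    ∫ k, a k * ∑ p, ∑ q, A k p j * conj (A k q l) * S.sys p q u 0 ∂μ = 0 := by
  set T : G → (ι → ℂ) →L[ℂ] (ι → ℂ) := fun k => S.sandwichL (A k) (B k) with hTdef
  have hT : Continuous T := S.continuous_sandwichL hA hB
  have hmaps : ∀ k, Set.MapsTo (T k) S.dom S.dom := fun k x hx =>
    S.sandwich_mem_dom (hBu k) (hAu k) (hadm k) hx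
  have hmaps' : ∀ k, Set.MapsTo (T k) (closure S.dom) (closure S.dom) := fun k =>
    (hmaps k).closure (T k).continuous
  have hD := S.isOpen_dom
  have hTof : ∀ k X, T k (S.ofMat X) = S.ofMat (A k * X * B k) := fun k X =>
    S.sandwich_ofMat (hadm k) X
  have huT : ∀ k, ∀ x ∈ S.dom, ContDiffAt ℝ 2 u (T k x) := fun k x hx =>
    hu.contDiffAt (hD.mem_nhds (hmaps k hx))
  have hav2 := contDiffOn_average (μ := μ) hD hT ha hmaps hu
  have hint : ∀ x ∈ S.dom, ∀ v w : ι → ℂ,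
      Integrable (fun k => a k * mixedDeriv (T k v) (T k w) u (T k x)) μ := fun x hx v w =>
    integrable_of_continuous_of_compactSpace
      (continuous_mixedDeriv_family hD hT ha hmaps hu hx v w)
  have hlap' : ∀ x ∈ S.dom, S.lap (weightedAverage μ T a u) x = 0 := by
    intro x hx
    obtain ⟨C, D, h, -, -⟩ := S.exists_sqrt x hx
    rw [S.lap_eq_sum (hav2.contDiffAt (hD.mem_nhds hx)) (A := C) (B := D)
      (by rw [h.conjTranspose_left, h.sq_left]) (by rw [h.conjTranspose_right, h.sq_right])]
    simp only [mixedDeriv_average hD hT ha hmaps hu hx]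
    simp only [← integral_finsetSum _ fun (α : Fin n) _ => hint x hx _ _]
    rw [← integral_finsetSum _ fun j _ => integrable_finsetSum _ fun α _ => hint x hx _ _]
    refine integral_eq_zero_of_ae (Eventually.of_forall fun k => ?_)
    simp only [hTof, ← Finset.mul_sum, Pi.zero_apply]
    have h1 : A k * C * (A k * C)ᴴ = matV (S.toMat (T k x)) := by
      rw [hTdef, sandwichL_apply, S.matV_sandwich (hBu k) (hAu k) (hadm k), ← h.sq_left,
        Matrix.conjTranspose_mul, h.conjTranspose_left]
      simp only [Matrix.mul_assoc]
    have h2 : (D * B k)ᴴ * (D * B k) = matW (S.toMat (T k x)) := by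
      rw [hTdef, sandwichL_apply, S.matW_sandwich (mul_eq_one_comm.1 (hBu k))
        (mul_eq_one_comm.1 (hAu k)) (hadm k), ← h.sq_right,
        Matrix.conjTranspose_mul, h.conjTranspose_right]
      simp only [Matrix.mul_assoc]
    have h3 := S.lap_eq_sum (huT k x hx) h1 h2
    rw [hlap _ (hmaps k hx)] at h3
    have h4 : ∀ (j : Fin m) (α : Fin n), A k * (C * matUnit j α * D) * B k
        = A k * C * matUnit j α * (D * B k) := fun j α => by simp only [Matrix.mul_assoc]
    simp only [h4, ← h3, mul_zero]
  have hconst := S.eq_const_of_lap_eq_zero hm hav2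
    (continuousOn_average hT ha hmaps' hc) hlap' hb
  have h0 := S.zero_mem_dom
  have hsys : S.sys j l (weightedAverage μ T a u) 0 = 0 := by
    have h1 : weightedAverage μ T a u =ᶠ[𝓝 0] fun _ => c := by
      filter_upwards [hD.eventually_mem h0] with y hy using hconst y hy
    rw [S.sys_congr h1]
    have hz : ∀ v w : ι → ℂ, mixedDeriv v w (fun _ => c) 0 = 0 := fun v w => by
      simpa using mixedDeriv_const_add_mul c 0 (fun _ => 0) 0 v w
    simp only [sys, hz, mul_zero, Finset.sum_const_zero]
  rw [sys_zero] at hsys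
  simp only [mixedDeriv_average hD hT ha hmaps hu h0] at hsys
  rw [← integral_finsetSum _ fun (α : Fin n) _ => hint 0 h0 _ _] at hsys
  rw [← hsys]
  refine integral_congr_ae (Eventually.of_forall fun k => ?_)
  simp only [dir, hTof, ← Finset.mul_sum, map_zero]
  rw [S.sum_mixedDeriv (by simpa using huT k 0 h0)
    (by rw [map_zero, matW_zero]; exact mul_eq_one_comm.1 (hBu k))]

end Family

end CartanData

/-! ### The unitary group -/

section UnitaryGroup

variable {n : ℕ}

theorem isCompact_unitaryGroup :
    IsCompact ((Matrix.unitaryGroup (Fin n) ℂ : Submonoid _) : Set (Matrix (Fin n) (Fin n) ℂ)) := by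
  have hK : IsCompact (Set.pi Set.univ fun _ : Fin n => Set.pi Set.univ fun _ : Fin n =>
      Metric.closedBall (0 : ℂ) 1) :=
    isCompact_univ_pi fun _ => isCompact_univ_pi fun _ => isCompact_closedBall _ _
  refine IsCompact.of_isClosed_subset hK ?_ fun U hU j _ l _ => ?_
  · have h1 : IsClosed {U : Matrix (Fin n) (Fin n) ℂ | U * star U = 1} :=
      isClosed_eq (continuous_id.matrix_mul continuous_id.matrix_conjTranspose) continuous_const
    convert h1 using 1
    ext U
    exact Matrix.mem_unitaryGroup_iff
  · rw [mem_closedBall_zero_iff]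
    refine norm_le_one_of_posSemidef (z := U) ?_ j l
    have : matV U = 0 := by
      rw [matV, sub_eq_zero]
      exact (Matrix.mem_unitaryGroup_iff.1 hU).symm
    rw [this]
    exact Matrix.PosSemidef.zero

instance : CompactSpace (Matrix.unitaryGroup (Fin n) ℂ) :=
  isCompact_iff_compactSpace.1 isCompact_unitaryGroup

theorem unitaryGroup_mul_conjTranspose (k : Matrix.unitaryGroup (Fin n) ℂ) :
    (k : Matrix (Fin n) (Fin n) ℂ) * (k : Matrix (Fin n) (Fin n) ℂ)ᴴ = 1 :=
  Matrix.mem_unitaryGroup_iff.1 k.2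

theorem unitaryGroup_conjTranspose_mul (k : Matrix.unitaryGroup (Fin n) ℂ) :
    (k : Matrix (Fin n) (Fin n) ℂ)ᴴ * (k : Matrix (Fin n) (Fin n) ℂ) = 1 :=
  Matrix.mem_unitaryGroup_iff'.1 k.2

/-- A matrix with orthonormal rows is a block of rows of a unitary matrix. -/
theorem exists_unitary_rows {m : ℕ} (hmn : m ≤ n) {z : Matrix (Fin m) (Fin n) ℂ}
    (hz : z * zᴴ = 1) : ∃ U : Matrix.unitaryGroup (Fin n) ℂ,
      z = (Matrix.of fun (j : Fin m) (α : Fin n) => if (j : ℕ) = α then (1 : ℂ) else 0) *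
        (U : Matrix (Fin n) (Fin n) ℂ) := by
  set v : Fin n → EuclideanSpace ℂ (Fin n) := fun α =>
    if h : (α : ℕ) < m then WithLp.toLp 2 (fun β => conj (z ⟨α, h⟩ β)) else 0 with hv
  have hinner : ∀ j l : Fin m, ∑ β, z j β * conj (z l β) = if j = l then 1 else 0 := fun j l => by
    have := congrFun (congrFun hz j) l
    rwa [Matrix.mul_apply, Matrix.one_apply] at this
  have horth : Orthonormal ℂ (Set.domRestrict {α : Fin n | (α : ℕ) < m} v) := by
    rw [orthonormal_iff_ite]
    rintro ⟨i, hi⟩ ⟨j, hj⟩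
    have hi' : (i : ℕ) < m := hi
    have hj' : (j : ℕ) < m := hj
    have h1 := hinner ⟨i, hi'⟩ ⟨j, hj'⟩
    simp only [Set.domRestrict_apply, hv, hi', hj', dif_pos,
      EuclideanSpace.inner_eq_star_dotProduct,
      dotProduct, Pi.star_apply, RCLike.star_def, Complex.conj_conj, Subtype.mk.injEq]
    simp only [Fin.mk.injEq, Fin.val_inj] at h1
    rw [← h1]
    exact Finset.sum_congr rfl fun β _ => _root_.mul_comm _ _
  obtain ⟨b, hb⟩ := horth.exists_orthonormalBasis_extension_of_card_eq (by simp)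
  set U : Matrix (Fin n) (Fin n) ℂ := Matrix.of fun α β => conj (b α β) with hU
  have hUu : U * star U = 1 := by
    ext i j
    have h1 := orthonormal_iff_ite.1 b.orthonormal i j
    rw [EuclideanSpace.inner_eq_star_dotProduct] at h1
    rw [Matrix.one_apply, ← h1, Matrix.mul_apply]
    simp only [hU, Matrix.star_apply, Matrix.of_apply, RCLike.star_def, Complex.conj_conj,
      dotProduct, Pi.star_apply]
    exact Finset.sum_congr rfl fun β _ => _root_.mul_comm _ _
  refine ⟨⟨U, Matrix.mem_unitaryGroup_iff.2 hUu⟩, ?_⟩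
  ext j β
  have hj : (j : ℕ) < n := j.2.trans_le hmn
  have h2 : ∀ α : Fin n, ((j : ℕ) = α) = (α = ⟨j, hj⟩) := fun α => by
    exact propext ⟨fun h => Fin.ext h.symm, fun h => (congrArg Fin.val h).symm⟩
  have h3 := hb ⟨j, hj⟩ j.2
  simp only [Matrix.mul_apply, Matrix.of_apply, h2, ite_mul, one_mul, zero_mul,
    Finset.sum_ite_eq', Finset.mem_univ, if_true, hU, h3]
  simp [hv]

theorem mul_mul_conjTranspose_apply {m : ℕ} (P : Matrix (Fin m) (Fin n) ℂ)
    (X : Matrix (Fin n) (Fin n) ℂ) (s t : Fin m) :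
    (P * X * Pᴴ) s t = ∑ p, ∑ q, P s p * conj (P t q) * X p q := by
  simp only [Matrix.mul_apply, Matrix.conjTranspose_apply, Finset.sum_mul, RCLike.star_def]
  rw [Finset.sum_comm]
  exact Finset.sum_congr rfl fun p _ => Finset.sum_congr rfl fun q _ => by ring

end UnitaryGroup

namespace CartanData

variable {ι : Type*} [Fintype ι] [DecidableEq ι] {m n : ℕ}

/-- By homogeneity, it suffices to know at the origin that the solutions of `Δu = 0` satisfy the
system `Δ^{jk} u = 0`. -/
theorem huaOperator_eq_zero_iff_sys_eq_zero (S : CartanData ι m n)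
    (H : ∀ w : (ι → ℂ) → ℂ, ContDiffOn ℝ 2 w S.dom → ContinuousOn w (closure S.dom) →
      (∀ x ∈ S.dom, S.lap w x = 0) → ∀ j k, S.sys j k w 0 = 0)
    {u : (ι → ℂ) → ℂ} (hu : ContDiffOn ℝ 2 u S.dom) (hc : ContinuousOn u (closure S.dom)) :
    (∀ x ∈ S.dom, huaOperator S.dom u x = 0) ↔ ∀ x ∈ S.dom, ∀ j k, S.sys j k u x = 0 := by
  have hD := S.isOpen_dom
  have huat : ∀ x ∈ S.dom, ContDiffAt ℝ 2 u x := fun x hx => hu.contDiffAt (hD.mem_nhds hx)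
  constructor
  · intro hhua a ha
    obtain ⟨C, D, h, hadm, -⟩ := S.exists_sqrt a ha
    refine S.sys_eq_zero_of_comp_mob h hadm (huat a ha) (H _ ?_ ?_ ?_)
    · intro x hx
      exact (S.contDiffAt_comp_mob h hx (huat _ (S.mob_mem_dom h hadm hx))).contDiffWithinAt
    · refine hc.comp (fun x hx => ?_) fun x hx => S.mob_mem_closure h hadm hx
      exact (S.hasFDerivAt_mob
        (S.isUnit_of_mem_closure ha hx)).continuousAt.continuousWithinAt
    · intro x hx
      have hx' := S.mob_mem_dom h hadm hx
      rw [S.lap_comp_mob h hadm hx (huat _ hx')]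
      exact (S.huaOperator_eq_zero_iff hx' (huat _ hx')).1 (hhua _ hx')
  · intro hsys x hx
    rw [S.huaOperator_eq_zero_iff hx (huat x hx), lap]
    exact Finset.sum_eq_zero fun j _ => Finset.sum_eq_zero fun k _ => by rw [hsys x hx, mul_zero]

/-- On the space of all matrices, `u` is averaged over the unitary group acting on the right. It
acts transitively on the Shilov boundary `z z* = 1`. -/
theorem sys_zero_eq_zero_of_surjective (S : CartanData ι m n) (hm : 0 < m) (hmn : m ≤ n)
    (hsurj : Function.Surjective S.toMat)
    (hadm : ∀ k : Matrix.unitaryGroup (Fin n) ℂ, IsAdmissible S.proj 1 (k : Matrix _ _ ℂ))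
    {u : (ι → ℂ) → ℂ} (hu : ContDiffOn ℝ 2 u S.dom) (hc : ContinuousOn u (closure S.dom))
    (hlap : ∀ x ∈ S.dom, S.lap u x = 0) (j l : Fin m) : S.sys j l u 0 = 0 := by
  let _ : MeasurableSpace (Matrix.unitaryGroup (Fin n) ℂ) := borel _
  have _ : BorelSpace (Matrix.unitaryGroup (Fin n) ℂ) := ⟨rfl⟩
  set μ : Measure (Matrix.unitaryGroup (Fin n) ℂ) := Measure.haar with hμ
  obtain ⟨x₀, hx₀⟩ := hsurj (Matrix.of fun j α => if (j : ℕ) = α then 1 else 0)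
  have key := S.integral_sys_zero_eq_zero (μ := μ) hm
    (A := fun _ => 1) (B := fun k => (k : Matrix (Fin n) (Fin n) ℂ)) (a := fun _ => 1)
    continuous_const continuous_subtype_val (fun k => by simp)
    (fun k => unitaryGroup_mul_conjTranspose k) hadm continuous_const hu hc hlap
    (c := ∫ k : Matrix.unitaryGroup (Fin n) ℂ, u (S.sandwich 1 (k : Matrix _ _ ℂ) x₀) ∂μ)
    (fun x _ hV => by
      obtain ⟨U, hU⟩ := exists_unitary_rows hmn (sub_eq_zero.1 hV).symm
      rw [← hx₀] at hU
      simp only [one_mul]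
      rw [← integral_mul_left_eq_self
        (fun k : Matrix.unitaryGroup (Fin n) ℂ => u (S.sandwich 1 (k : Matrix _ _ ℂ) x₀)) U]
      refine integral_congr_ae (Eventually.of_forall fun k => ?_)
      simp only [sandwich_apply, hU, Matrix.one_mul, Submonoid.coe_mul, Matrix.mul_assoc]) j l
  have h1 : ∑ p, ∑ q, (1 : Matrix (Fin m) (Fin m) ℂ) p j *
      conj ((1 : Matrix (Fin m) (Fin m) ℂ) q l) * S.sys p q u 0 = S.sys j l u 0 := by
    simp [Matrix.one_apply]
  simp only [h1, one_mul, integral_const] at key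
  have h2 : μ.real Set.univ ≠ 0 := (measureReal_univ_pos).ne'
  exact (smul_eq_zero.1 key).resolve_left h2

section Congruence

variable {ι : Type*} [Fintype ι] [DecidableEq ι] {n : ℕ} (S : CartanData ι n n)

/-- On spaces of symmetric or antisymmetric matrices, `u` is averaged over the unitary group
acting by `z ↦ k* z k̄`, with the entries of `k M k*` as weights. On the Shilov boundary the
averages form a matrix that commutes with the stabilizer of the point; if this forces the matrix to
be scalar and `tr M = 0`, the averages vanish. The choice `M = (conj Δ^{jk} u(0))` turns the
average of `Δ^{jk} u(0)` into a mean of squares. -/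
theorem sys_zero_eq_zero_of_stabilizer (hn : 0 < n)
    (hadm : ∀ k : Matrix.unitaryGroup (Fin n) ℂ,
      IsAdmissible S.proj (k : Matrix _ _ ℂ)ᴴ ((k : Matrix _ _ ℂ)ᴴᵀ))
    (hstab : ∀ x, matV (S.toMat x) = 0 → ∀ Ω : Matrix (Fin n) (Fin n) ℂ,
      (∀ h : Matrix.unitaryGroup (Fin n) ℂ,
        (h : Matrix _ _ ℂ)ᴴ * S.toMat x * (h : Matrix _ _ ℂ)ᴴᵀ = S.toMat x →
        Commute Ω (h : Matrix _ _ ℂ)) → ∃ c : ℂ, Ω = c • 1)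
    {u : (ι → ℂ) → ℂ} (hu : ContDiffOn ℝ 2 u S.dom) (hc : ContinuousOn u (closure S.dom))
    (hlap : ∀ x ∈ S.dom, S.lap u x = 0) (s t : Fin n) : S.sys s t u 0 = 0 := by
  let _ : MeasurableSpace (Matrix.unitaryGroup (Fin n) ℂ) := borel _
  have _ : BorelSpace (Matrix.unitaryGroup (Fin n) ℂ) := ⟨rfl⟩
  set μ : Measure (Matrix.unitaryGroup (Fin n) ℂ) := Measure.haar with hμ
  set M : Matrix (Fin n) (Fin n) ℂ := Matrix.of fun p q => conj (S.sys p q u 0) with hM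
  have htr : M.trace = 0 := by
    have h1 := hlap 0 S.zero_mem_dom
    simp only [lap, map_zero, matV_zero, Matrix.one_apply, ite_mul, one_mul, zero_mul,
      Finset.sum_ite_eq, Finset.mem_univ, if_true] at h1
    simp only [Matrix.trace, Matrix.diag, hM, Matrix.of_apply, ← map_sum, h1, map_zero]
  set N : Matrix.unitaryGroup (Fin n) ℂ → Matrix (Fin n) (Fin n) ℂ := fun k =>
    (k : Matrix _ _ ℂ) * M * (k : Matrix _ _ ℂ)ᴴ with hN
  have hval : Continuous fun k : Matrix.unitaryGroup (Fin n) ℂ => (k : Matrix (Fin n) (Fin n) ℂ) :=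
    continuous_subtype_val
  have hNc : Continuous N :=
    (hval.matrix_mul continuous_const).matrix_mul hval.matrix_conjTranspose
  have hNe : ∀ s t, Continuous fun k => N k s t := fun s t => hNc.matrix_elem s t
  have hA : Continuous fun k : Matrix.unitaryGroup (Fin n) ℂ =>
      (k : Matrix (Fin n) (Fin n) ℂ)ᴴ := hval.matrix_conjTranspose
  have hB : Continuous fun k : Matrix.unitaryGroup (Fin n) ℂ =>
      (k : Matrix (Fin n) (Fin n) ℂ)ᴴᵀ := hA.matrix_transpose
  have hAu : ∀ k : Matrix.unitaryGroup (Fin n) ℂ,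
      (k : Matrix (Fin n) (Fin n) ℂ)ᴴ * ((k : Matrix (Fin n) (Fin n) ℂ)ᴴ)ᴴ = 1 := fun k => by
    rw [Matrix.conjTranspose_conjTranspose, unitaryGroup_conjTranspose_mul]
  have hBu : ∀ k : Matrix.unitaryGroup (Fin n) ℂ,
      (k : Matrix (Fin n) (Fin n) ℂ)ᴴᵀ * ((k : Matrix (Fin n) (Fin n) ℂ)ᴴᵀ)ᴴ = 1 := fun k => by
    have h1 : ((k : Matrix (Fin n) (Fin n) ℂ)ᴴᵀ)ᴴ = (k : Matrix (Fin n) (Fin n) ℂ)ᵀ := by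
      ext i j
      simp
    rw [h1, ← Matrix.transpose_mul, unitaryGroup_mul_conjTranspose, Matrix.transpose_one]
  set Ω : (ι → ℂ) → Matrix (Fin n) (Fin n) ℂ := fun x => Matrix.of fun s t =>
    ∫ k : Matrix.unitaryGroup (Fin n) ℂ,
      N k s t * u (S.sandwich (k : Matrix _ _ ℂ)ᴴ (k : Matrix _ _ ℂ)ᴴᵀ x) ∂μ with hΩ
  have hΩ_apply : ∀ x s t, Ω x s t = ∫ k : Matrix.unitaryGroup (Fin n) ℂ,
      N k s t * u (S.sandwich (k : Matrix _ _ ℂ)ᴴ (k : Matrix _ _ ℂ)ᴴᵀ x) ∂μ := fun _ _ _ => rfl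
  have hint : ∀ x ∈ closure S.dom, ∀ s t, Integrable (fun k : Matrix.unitaryGroup (Fin n) ℂ =>
      N k s t * u (S.sandwich (k : Matrix _ _ ℂ)ᴴ (k : Matrix _ _ ℂ)ᴴᵀ x)) μ := by
    intro x hx s t
    refine integrable_of_continuous_of_compactSpace ((hNe s t).mul ?_)
    refine hc.comp_continuous ((S.continuous_sandwichL hA hB).clm_apply continuous_const)
      fun k => ?_
    exact map_mem_closure (S.sandwichL _ _).continuous hx fun y hy =>
      S.sandwich_mem_dom (hBu k) (hAu k) (hadm k) hy
  have hzero : ∀ x ∈ closure S.dom, matV (S.toMat x) = 0 → Ω x = 0 := by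
    intro x hx hV
    obtain ⟨c, hcΩ⟩ := hstab x hV (Ω x) fun h hh => by
      have h1 : (h : Matrix _ _ ℂ) * Ω x * (h : Matrix _ _ ℂ)ᴴ = Ω x := by
        ext s t
        have h2 : Ω x s t = ∫ k : Matrix.unitaryGroup (Fin n) ℂ, N (h * k) s t *
            u (S.sandwich (k : Matrix _ _ ℂ)ᴴ (k : Matrix _ _ ℂ)ᴴᵀ x) ∂μ := by
          rw [hΩ_apply, ← integral_mul_left_eq_self _ h]
          refine integral_congr_ae (Eventually.of_forall fun k => ?_)
          simp only [sandwich_apply, Submonoid.coe_mul, Matrix.conjTranspose_mul,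
            Matrix.transpose_mul]
          congr 4
          conv_rhs => rw [← hh]
          simp only [Matrix.mul_assoc]
        have h3 : ∀ k, N (h * k) s t = ∑ p, ∑ q, (h : Matrix _ _ ℂ) s p *
            conj ((h : Matrix _ _ ℂ) t q) * N k p q := fun k => by
          have : N (h * k) = (h : Matrix _ _ ℂ) * N k * (h : Matrix _ _ ℂ)ᴴ := by
            simp only [hN, Submonoid.coe_mul, Matrix.conjTranspose_mul, Matrix.mul_assoc]
          rw [this, mul_mul_conjTranspose_apply]
        rw [h2, mul_mul_conjTranspose_apply]
        simp only [h3, Finset.sum_mul, mul_assoc]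
        rw [integral_finsetSum _ fun p _ => integrable_finsetSum _ fun q _ =>
          ((hint x hx p q).const_mul _).const_mul _]
        simp only [integral_finsetSum _ fun q _ => ((hint x hx _ q).const_mul _).const_mul _]
        simp only [integral_const_mul, hΩ_apply]
      have h2 := congrArg (fun X => X * (h : Matrix (Fin n) (Fin n) ℂ)) h1
      simp only [Matrix.mul_assoc, unitaryGroup_conjTranspose_mul, Matrix.mul_one] at h2
      exact h2.symm
    have htrΩ : (Ω x).trace = 0 := by
      simp only [Matrix.trace, Matrix.diag, hΩ, Matrix.of_apply]
      rw [← integral_finsetSum _ fun i _ => hint x hx i i]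
      refine integral_eq_zero_of_ae (Eventually.of_forall fun k => ?_)
      have h1 : ∑ i, N k i i = 0 := by
        change (N k).trace = 0
        rw [hN, Matrix.trace_mul_comm, ← Matrix.mul_assoc, unitaryGroup_conjTranspose_mul,
          Matrix.one_mul, htr]
      simp only [← Finset.sum_mul, h1, zero_mul, Pi.zero_apply]
    rw [hcΩ, Matrix.trace_smul, Matrix.trace_one, Fintype.card_fin, smul_eq_mul,
      mul_eq_zero] at htrΩ
    rw [hcΩ, htrΩ.resolve_right (by exact_mod_cast hn.ne'), zero_smul]
  have key := S.integral_sys_zero_eq_zero (μ := μ) hn hA hB hAu hBu hadm (hNe s t) hu hc hlap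
    (c := 0) (fun x hx hV => by
      have := congrFun (congrFun (hzero x hx hV) s) t
      simpa [hΩ] using this) s t
  have hsq : ∀ k : Matrix.unitaryGroup (Fin n) ℂ, N k s t * ∑ p, ∑ q,
      (k : Matrix _ _ ℂ)ᴴ p s * conj ((k : Matrix _ _ ℂ)ᴴ q t) * S.sys p q u 0
      = ((‖N k s t‖ ^ 2 : ℝ) : ℂ) := fun k => by
    have h1 : ∑ p, ∑ q, (k : Matrix _ _ ℂ)ᴴ p s * conj ((k : Matrix _ _ ℂ)ᴴ q t) * S.sys p q u 0
        = conj (N k s t) := by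
      simp only [hN, mul_mul_conjTranspose_apply, Matrix.conjTranspose_apply, RCLike.star_def,
        map_sum, map_mul, Complex.conj_conj, hM, Matrix.of_apply]
    rw [h1, Complex.mul_conj']
    push_cast
    rfl
  simp only [hsq] at key
  rw [integral_complex_ofReal, Complex.ofReal_eq_zero] at key
  have hcont : Continuous fun k => ‖N k s t‖ ^ 2 := (hNe s t).norm.pow 2
  rw [integral_eq_zero_iff_of_nonneg (fun k => by positivity)
    (integrable_of_continuous_of_compactSpace hcont)] at key
  have h1 := congrFun ((hcont.ae_eq_iff_eq μ continuous_const).1 key) 1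
  have h2 : ‖N 1 s t‖ ^ 2 = 0 := h1
  simpa [hN, hM] using h2

end Congruence

end CartanData

/-! ### Matrices that commute with the stabilizer of a symmetric or antisymmetric unitary matrix -/

section Stabilizer

open Matrix

variable {n : ℕ}

theorem star_dotProduct_self_ne_zero {x : Fin n → ℂ} (hx : x ≠ 0) : star x ⬝ᵥ x ≠ 0 := fun h =>
  hx (dotProduct_star_self_eq_zero.1 h)

theorem conjTranspose_transpose_comm {m n : ℕ} (A : Matrix (Fin m) (Fin n) ℂ) : Aᴴᵀ = Aᵀᴴ := rfl

/-- A matrix that commutes with `x x*` for all `x` in a set `R` with `ℂⁿ = R + iR`, closed under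
addition, is scalar. -/
theorem exists_eq_smul_one_of_commute {Ω : Matrix (Fin n) (Fin n) ℂ} {R : Set (Fin n → ℂ)}
    (hadd : ∀ x ∈ R, ∀ y ∈ R, x + y ∈ R)
    (hspan : ∀ y, ∃ x₁ ∈ R, ∃ x₂ ∈ R, y = x₁ + Complex.I • x₂)
    (hcomm : ∀ x ∈ R, Commute Ω (vecMulVec x (star x))) : ∃ c : ℂ, Ω = c • 1 := by
  have hR : ∀ x ∈ R, ∀ y ∈ R, Commute Ω (vecMulVec x (star y)) := by
    intro x hx y hy
    by_cases hx0 : x = 0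
    · rw [hx0, zero_vecMulVec]
      exact Commute.zero_right _
    have h1 : Commute Ω (vecMulVec x (star y) + vecMulVec y (star x)) := by
      have h2 := ((hcomm _ (hadd x hx y hy)).sub_right (hcomm x hx)).sub_right (hcomm y hy)
      have h3 : vecMulVec (x + y) (star (x + y)) - vecMulVec x (star x) - vecMulVec y (star y)
          = vecMulVec x (star y) + vecMulVec y (star x) := by
        rw [star_add, add_vecMulVec, vecMulVec_add, vecMulVec_add]
        abel
      rwa [h3] at h2
    have h4 := ((hcomm x hx).mul_right h1).sub_right
      ((hcomm x hx).smul_right (star x ⬝ᵥ y))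
    rw [Matrix.mul_add, vecMulVec_mul_vecMulVec, vecMulVec_mul_vecMulVec, vecMulVec_smul,
      vecMulVec_smul, add_sub_cancel_right] at h4
    have hs : star x ⬝ᵥ x ≠ 0 := star_dotProduct_self_ne_zero hx0
    have h5 := h4.smul_right (star x ⬝ᵥ x)⁻¹
    rwa [inv_smul_smul₀ hs] at h5
  have hall : ∀ x y : Fin n → ℂ, Commute Ω (vecMulVec x (star y)) := by
    intro x y
    obtain ⟨x₁, hx₁, x₂, hx₂, rfl⟩ := hspan x
    obtain ⟨y₁, hy₁, y₂, hy₂, rfl⟩ := hspan y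
    rw [star_add, star_smul, add_vecMulVec, vecMulVec_add, vecMulVec_add, smul_vecMulVec,
      smul_vecMulVec, vecMulVec_smul, vecMulVec_smul]
    exact ((hR _ hx₁ _ hy₁).add_right ((hR _ hx₁ _ hy₂).smul_right _)).add_right
      (((hR _ hx₂ _ hy₁).smul_right _).add_right (((hR _ hx₂ _ hy₂).smul_right _).smul_right _))
  have hmem : Ω ∈ Set.range (scalar (Fin n)) := by
    refine mem_range_scalar_of_commute_single fun i j _ => ?_
    have h1 := hall (Pi.single i 1) (Pi.single j 1)
    have h2 : star (Pi.single j 1 : Fin n → ℂ) = Pi.single j 1 := by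
      ext k
      by_cases h : k = j <;> simp [h]
    rw [h2, ← single_eq_single_vecMulVec_single] at h1
    exact h1.symm
  obtain ⟨c, hc⟩ := hmem
  refine ⟨c, ?_⟩
  rw [← hc, scalar_apply, smul_one_eq_diagonal]

/-- The stabilizer of `ζ` under `z ↦ h* z h̄` contains the unitary matrices `h` with
`ζ h̄ = h ζ`. -/
theorem commute_of_mul_eq_mul {Ω ζ h : Matrix (Fin n) (Fin n) ℂ}
    (hΩ : ∀ h : unitaryGroup (Fin n) ℂ,
      (h : Matrix _ _ ℂ)ᴴ * ζ * (h : Matrix _ _ ℂ)ᴴᵀ = ζ → Commute Ω (h : Matrix _ _ ℂ))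
    (hu : h * hᴴ = 1) (hζ : ζ * hᴴᵀ = h * ζ) : Commute Ω h := by
  refine hΩ ⟨h, mem_unitaryGroup_iff.2 hu⟩ ?_
  change hᴴ * ζ * hᴴᵀ = ζ
  rw [Matrix.mul_assoc, hζ, ← Matrix.mul_assoc, mul_eq_one_comm.1 hu, Matrix.one_mul]

theorem dotProduct_star_conj (x : Fin n → ℂ) : conj (star x ⬝ᵥ x) = star x ⬝ᵥ x := by
  rw [star_dotProduct_self, Complex.conj_ofReal]

theorem conjTranspose_transpose_vecMulVec (x : Fin n → ℂ) :
    (vecMulVec x (star x))ᴴᵀ = vecMulVec (star x) x := by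
  rw [conjTranspose_vecMulVec, star_star, transpose_vecMulVec]

/-- A matrix that commutes with the stabilizer of a symmetric unitary matrix `ζ` is scalar: the
stabilizer contains the reflections in the real vectors of the real structure `x ↦ ζ x̄`. -/
theorem exists_eq_smul_one_of_symm {Ω ζ : Matrix (Fin n) (Fin n) ℂ} (hζ : ζᵀ = ζ)
    (hu : ζ * ζᴴ = 1)
    (hΩ : ∀ h : unitaryGroup (Fin n) ℂ,
      (h : Matrix _ _ ℂ)ᴴ * ζ * (h : Matrix _ _ ℂ)ᴴᵀ = ζ → Commute Ω (h : Matrix _ _ ℂ)) :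
    ∃ c : ℂ, Ω = c • 1 := by
  have hJJ : ∀ x, ζ *ᵥ star (ζ *ᵥ star x) = x := fun x => by
    rw [star_mulVec, star_star, ← mulVec_transpose, mulVec_mulVec, conjTranspose_transpose_comm, hζ,
      hu, one_mulVec]
  refine exists_eq_smul_one_of_commute (R := {x | ζ *ᵥ star x = x}) (fun x hx y hy => ?_)
    (fun y => ?_) fun x hx => ?_
  · rw [Set.mem_ofPred_eq] at hx hy ⊢
    rw [star_add, mulVec_add, hx, hy]
  · refine ⟨(1 / 2 : ℂ) • (y + ζ *ᵥ star y), ?_,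
      (1 / 2 : ℂ) • (-Complex.I) • (y - ζ *ᵥ star y), ?_, ?_⟩
    · rw [Set.mem_ofPred_eq, star_smul, mulVec_smul, star_add, mulVec_add, hJJ, _root_.add_comm y]
      simp
    · rw [Set.mem_ofPred_eq, star_smul, star_smul, mulVec_smul, mulVec_smul, star_sub, mulVec_sub,
        hJJ, ← neg_sub y]
      simp only [map_div₀, map_one, RCLike.star_def, map_neg, Complex.conj_I, map_ofNat, neg_neg]
      module
    · ext i
      simp only [Pi.add_apply, Pi.smul_apply, Pi.sub_apply, smul_eq_mul]
      linear_combination (1 / 2 * (y i - (ζ *ᵥ star y) i)) * Complex.I_sq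
  · rw [Set.mem_ofPred_eq] at hx
    by_cases hx0 : x = 0
    · rw [hx0, zero_vecMulVec]
      exact Commute.zero_right _
    set s := star x ⬝ᵥ x with hs
    have hs0 : s ≠ 0 := star_dotProduct_self_ne_zero hx0
    have hsc : conj s = s := dotProduct_star_conj x
    set P := vecMulVec x (star x) with hP
    have hPP : P * P = s • P := by rw [hP, vecMulVec_mul_vecMulVec, vecMulVec_smul]
    have hPH : Pᴴ = P := by rw [hP, conjTranspose_vecMulVec, star_star]
    have hζP : ζ * Pᴴᵀ = P * ζ := by
      rw [hP, conjTranspose_transpose_vecMulVec, mul_vecMulVec, hx, vecMulVec_mul,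
        ← mulVec_transpose, hζ, hx]
    set h : Matrix (Fin n) (Fin n) ℂ := 1 - (2 / s) • P with hh
    have hhH : hᴴ = h := by
      rw [hh, conjTranspose_sub, conjTranspose_one, conjTranspose_smul, hPH]
      simp [hsc]
    have h1 : Commute Ω h := by
      refine commute_of_mul_eq_mul hΩ ?_ ?_
      · rw [hhH, hh]
        simp only [Matrix.mul_sub, Matrix.sub_mul, Matrix.one_mul, Matrix.mul_one, Matrix.smul_mul,
          Matrix.mul_smul, hPP, smul_smul]
        rw [div_mul_cancel₀ _ hs0]
        module
      · rw [hh, conjTranspose_sub, transpose_sub, Matrix.mul_sub, Matrix.sub_mul,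
          conjTranspose_one, transpose_one, Matrix.mul_one, Matrix.one_mul, conjTranspose_smul,
          transpose_smul, Matrix.mul_smul, Matrix.smul_mul, hζP]
        simp [hsc]
    have h2 := ((Commute.one_right Ω).sub_right h1).smul_right (s / 2)
    have h3 : (s / 2) • (1 - h) = P := by
      rw [hh, sub_sub_cancel, smul_smul]
      have : s / 2 * (2 / s) = 1 := by field_simp
      rw [this, one_smul]
    rwa [h3] at h2

/-- A matrix that commutes with the stabilizer of an antisymmetric unitary matrix `ζ` is scalar:
`x ↦ ζ x̄` is a quaternionic structure, and the stabilizer contains, for every `x`, the map that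
acts by `i` on `x`, by `-i` on `ζ x̄` and trivially on the complement. -/
theorem exists_eq_smul_one_of_skew {Ω ζ : Matrix (Fin n) (Fin n) ℂ} (hζ : ζᵀ = -ζ)
    (hu : ζ * ζᴴ = 1)
    (hΩ : ∀ h : unitaryGroup (Fin n) ℂ,
      (h : Matrix _ _ ℂ)ᴴ * ζ * (h : Matrix _ _ ℂ)ᴴᵀ = ζ → Commute Ω (h : Matrix _ _ ℂ)) :
    ∃ c : ℂ, Ω = c • 1 := by
  refine exists_eq_smul_one_of_commute (R := Set.univ) (fun _ _ _ _ => trivial)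
    (fun y => ⟨y, trivial, 0, trivial, by simp⟩) fun x _ => ?_
  by_cases hx0 : x = 0
  · rw [hx0, zero_vecMulVec]
    exact Commute.zero_right _
  set y := ζ *ᵥ star x with hy
  have hJy : ζ *ᵥ star y = -x := by
    rw [hy, star_mulVec, star_star, ← mulVec_transpose, mulVec_mulVec, conjTranspose_transpose_comm,
      hζ, conjTranspose_neg, Matrix.mul_neg, hu, neg_mulVec, one_mulVec]
  have hxζ : star x ᵥ* ζ = -y := by
    rw [← mulVec_transpose, hζ, neg_mulVec, hy]
  have hyζ : star y ᵥ* ζ = x := by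
    rw [← mulVec_transpose, hζ, neg_mulVec, hJy, neg_neg]
  set s := star x ⬝ᵥ x with hs
  have hs0 : s ≠ 0 := star_dotProduct_self_ne_zero hx0
  have hsc : conj s = s := dotProduct_star_conj x
  have hys : star y ⬝ᵥ y = s := by
    conv_lhs => rw [hy, dotProduct_mulVec, ← hy, hyζ]
    rw [dotProduct_comm]
  have hxy : star x ⬝ᵥ y = 0 := by
    have h1 : star x ⬝ᵥ y = -(star x ⬝ᵥ y) := by
      conv_lhs => rw [hy, dotProduct_mulVec, hxζ, dotProduct_comm, dotProduct_neg]
    linear_combination (1 / 2 : ℂ) * h1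
  have hyx : star y ⬝ᵥ x = 0 := by
    have := congrArg star hxy
    rwa [star_dotProduct, star_star, star_zero] at this
  set P := vecMulVec x (star x) with hP
  set Q := vecMulVec y (star y) with hQ
  have hPP : P * P = s • P := by rw [hP, vecMulVec_mul_vecMulVec, vecMulVec_smul]
  have hQQ : Q * Q = s • Q := by rw [hQ, vecMulVec_mul_vecMulVec, hys, vecMulVec_smul]
  have hPQ : P * Q = 0 := by rw [hP, hQ, vecMulVec_mul_vecMulVec, hxy, zero_smul, vecMulVec_zero]
  have hQP : Q * P = 0 := by rw [hP, hQ, vecMulVec_mul_vecMulVec, hyx, zero_smul, vecMulVec_zero]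
  have hPH : Pᴴ = P := by rw [hP, conjTranspose_vecMulVec, star_star]
  have hQH : Qᴴ = Q := by rw [hQ, conjTranspose_vecMulVec, star_star]
  have hζP : ζ * Pᴴᵀ = Q * ζ := by
    rw [hP, hQ, conjTranspose_transpose_vecMulVec, mul_vecMulVec, vecMulVec_mul, hyζ]
  have hζQ : ζ * Qᴴᵀ = P * ζ := by
    rw [hP, hQ, conjTranspose_transpose_vecMulVec, mul_vecMulVec, vecMulVec_mul, hxζ, hJy,
      neg_vecMulVec, vecMulVec_neg]
  have hI := Complex.I_sq
  set a : ℂ := (Complex.I - 1) / s with ha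
  set b : ℂ := (-Complex.I - 1) / s with hb
  have hca : conj a = b := by simp [ha, hb, hsc]
  have hcb : conj b = a := by rw [← hca, Complex.conj_conj]
  have hab : a + b + a * b * s = 0 := by
    rw [ha, hb]
    field_simp
    linear_combination -hI
  set h : Matrix (Fin n) (Fin n) ℂ := 1 + a • P + b • Q with hh
  have hhH : hᴴ = 1 + b • P + a • Q := by
    rw [hh, conjTranspose_add, conjTranspose_add, conjTranspose_one, conjTranspose_smul,
      conjTranspose_smul, hPH, hQH, RCLike.star_def, hca, hcb]
  have h1 : Commute Ω h := by
    refine commute_of_mul_eq_mul hΩ ?_ ?_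
    · have h2 : h * hᴴ = 1 + (a + b + a * b * s) • P + (a + b + a * b * s) • Q := by
        rw [hhH, hh]
        simp only [Matrix.mul_add, Matrix.add_mul, Matrix.one_mul, Matrix.mul_one, Matrix.smul_mul,
          Matrix.mul_smul, hPP, hQQ, hPQ, hQP, smul_zero, smul_smul]
        module
      rw [h2, hab, zero_smul, zero_smul, add_zero, add_zero]
    · rw [hh, conjTranspose_add, conjTranspose_add, transpose_add, transpose_add, conjTranspose_one,
        transpose_one, conjTranspose_smul, transpose_smul, conjTranspose_smul, transpose_smul,
        RCLike.star_def, hca, hcb]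
      simp only [Matrix.mul_add, Matrix.add_mul, Matrix.mul_one, Matrix.one_mul, Matrix.mul_smul,
        Matrix.smul_mul, hζP, hζQ]
      abel
  -- `P` is a polynomial in `h`
  have h2 := h1.sub_right (Commute.one_right Ω)
  have h3 := ((h2.mul_right h2).sub_right (h2.smul_right (b * s))).smul_right
    (a * (a - b) * s)⁻¹
  have h4 : (h - 1) * (h - 1) - (b * s) • (h - 1) = (a * (a - b) * s) • P := by
    have : h - 1 = a • P + b • Q := by rw [hh]; abel
    rw [this]
    simp only [Matrix.mul_add, Matrix.add_mul, Matrix.smul_mul,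
      Matrix.mul_smul, hPP, hQQ, hPQ, hQP, smul_zero, smul_smul, smul_add]
    module
  have h5 : a * (a - b) * s ≠ 0 := by
    have h6 : a * (a - b) * s = (-2 - 2 * Complex.I) / s := by
      rw [ha, hb]
      field_simp
      linear_combination 2 * hI
    rw [h6]
    refine div_ne_zero (fun h0 => ?_) hs0
    have := congrArg Complex.re h0
    norm_num at this
  rwa [h4, inv_smul_smul₀ h5] at h3

end Stabilizer

/-! ### Square roots -/

section Sqrt

open Matrix

variable {m n : ℕ}

/-- A positive definite matrix has a positive definite square root `U diag(μ) U*`. -/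
theorem Matrix.PosDef.exists_sqrt {V : Matrix (Fin m) (Fin m) ℂ} (hV : V.PosDef) :
    ∃ (U : Matrix (Fin m) (Fin m) ℂ) (μ : Fin m → ℝ), U * Uᴴ = 1 ∧ (∀ i, 0 < μ i) ∧
      (U * diagonal (fun i => (μ i : ℂ)) * Uᴴ).PosDef ∧
      U * diagonal (fun i => (μ i : ℂ)) * Uᴴ * (U * diagonal (fun i => (μ i : ℂ)) * Uᴴ) = V ∧
      V.det.re = ∏ i, μ i ^ 2 := by
  set l := hV.isHermitian.eigenvalues with hl
  set W := hV.isHermitian.eigenvectorUnitary with hW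
  have hl0 : ∀ i, 0 < l i := hV.eigenvalues_pos
  have hU : (W : Matrix (Fin m) (Fin m) ℂ) * (W : Matrix (Fin m) (Fin m) ℂ)ᴴ = 1 :=
    mem_unitaryGroup_iff.1 W.2
  refine ⟨W, fun i => Real.sqrt (l i), hU, fun i => Real.sqrt_pos.2 (hl0 i), ?_, ?_, ?_⟩
  · have h1 : (diagonal fun i => ((Real.sqrt (l i) : ℝ) : ℂ)).PosDef := by
      refine PosDef.diagonal fun i => ?_
      exact_mod_cast Real.sqrt_pos.2 (hl0 i)
    refine (Matrix.IsUnit.posDef_star_right_conjugate_iff ?_).2 h1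
    exact ⟨⟨_, _, hU, mul_eq_one_comm.1 hU⟩, rfl⟩
  · conv_rhs => rw [hV.isHermitian.spectral_theorem, Unitary.conjStarAlgAut_apply]
    have h1 : diagonal (fun i => ((Real.sqrt (l i) : ℝ) : ℂ)) *
        diagonal (fun i => ((Real.sqrt (l i) : ℝ) : ℂ)) = diagonal (RCLike.ofReal ∘ l) := by
      rw [diagonal_mul_diagonal]
      congr 1
      funext i
      rw [← Complex.ofReal_mul, Real.mul_self_sqrt (hl0 i).le]
      rfl
    rw [← h1]
    simp only [Matrix.mul_assoc]
    rw [← Matrix.mul_assoc (W : Matrix (Fin m) (Fin m) ℂ)ᴴ (W : Matrix (Fin m) (Fin m) ℂ),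
      mul_eq_one_comm.1 hU, Matrix.one_mul]
    rfl
  · rw [hV.isHermitian.det_eq_prod_eigenvalues]
    have h1 : ∀ i, Real.sqrt (l i) ^ 2 = l i := fun i => Real.sq_sqrt (hl0 i).le
    simp only [h1]
    have h2 : (∏ i, (RCLike.ofReal (l i) : ℂ)) = ((∏ i, l i : ℝ) : ℂ) := by
      push_cast
      rfl
    rw [h2, Complex.ofReal_re]

end Sqrt

/-! ### A trace inequality for antisymmetric matrices of even size -/

section SkewTrace

open Matrix

variable {n : ℕ}

/-- An eigenvector `x` of `V(z)`, `z` antisymmetric and invertible, comes with the orthogonal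
eigenvector `z x̄`, so that twice the eigenvalue is at most the trace. -/
theorem two_mul_eigenvalue_le_trace {z : Matrix (Fin n) (Fin n) ℂ} (hz : zᵀ = -z)
    (hdet : z.det ≠ 0) (hV : (matV z).PosSemidef) {x : Fin n → ℂ} (hx : x ≠ 0) {l : ℝ}
    (hxl : matV z *ᵥ x = (l : ℂ) • x) : 2 * l ≤ (matV z).trace.re := by
  set y := z *ᵥ star x with hy
  have hzu : IsUnit z := (isUnit_iff_isUnit_det _).2 (isUnit_iff_ne_zero.2 hdet)
  have hy0 : y ≠ 0 := fun h => by
    have h1 : star x = 0 := mulVec_injective_iff_isUnit.2 hzu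
      (by rw [mulVec_zero, ← hy, h])
    exact hx (by simpa using congrArg star h1)
  have hW : matW z = (matV z)ᵀ := by
    rw [matW, matV, transpose_sub, transpose_one, transpose_mul, hz]
    have : zᴴᵀ = -zᴴ := by
      rw [conjTranspose_transpose_comm, hz, conjTranspose_neg]
    rw [this, neg_mul_neg]
  have hyl : matV z *ᵥ y = (l : ℂ) • y := by
    have h1 : (matV z)ᵀ *ᵥ star x = (l : ℂ) • star x := by
      have := congrArg star hxl
      rw [star_mulVec, matV_isHermitian, star_smul, RCLike.star_def, Complex.conj_ofReal] at this
      rwa [mulVec_transpose]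
    rw [hy, mulVec_mulVec, matV_mul, hW, ← mulVec_mulVec, h1, mulVec_smul]
  have hxy : star x ⬝ᵥ y = 0 := by
    have h1 : star x ⬝ᵥ y = -(star x ⬝ᵥ y) := by
      conv_lhs => rw [hy, dotProduct_mulVec, ← mulVec_transpose, hz, neg_mulVec, dotProduct_comm,
        dotProduct_neg]
    linear_combination (1 / 2 : ℂ) * h1
  have hyx : star y ⬝ᵥ x = 0 := by
    have := congrArg star hxy
    rwa [star_dotProduct, star_star, star_zero] at this
  set s := star x ⬝ᵥ x with hs
  set t := star y ⬝ᵥ y with ht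
  have hs0 : s ≠ 0 := star_dotProduct_self_ne_zero hx
  have ht0 : t ≠ 0 := star_dotProduct_self_ne_zero hy0
  have hsc : conj s = s := dotProduct_star_conj x
  have htc : conj t = t := dotProduct_star_conj y
  set E : Matrix (Fin n) (Fin n) ℂ := s⁻¹ • vecMulVec x (star x) + t⁻¹ • vecMulVec y (star y)
    with hE
  have hEE : E * E = E := by
    rw [hE]
    simp only [Matrix.mul_add, Matrix.add_mul, Matrix.smul_mul, Matrix.mul_smul,
      vecMulVec_mul_vecMulVec, hxy, hyx, zero_smul, vecMulVec_zero, smul_zero, add_zero, zero_add,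
      vecMulVec_smul, ← hs, ← ht, smul_smul, inv_mul_cancel₀ hs0, inv_mul_cancel₀ ht0, mul_one]
  have hEH : Eᴴ = E := by
    rw [hE, conjTranspose_add, conjTranspose_smul, conjTranspose_smul, conjTranspose_vecMulVec,
      conjTranspose_vecMulVec, star_star, star_star, RCLike.star_def, map_inv₀,
      map_inv₀, hsc, htc]
  have hVE : matV z * E = (l : ℂ) • E := by
    rw [hE, Matrix.mul_add, Matrix.mul_smul, Matrix.mul_smul, mul_vecMulVec, mul_vecMulVec, hxl,
      hyl, smul_vecMulVec, smul_vecMulVec, smul_add, smul_comm, smul_comm t⁻¹]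
  have htrE : E.trace = 2 := by
    rw [hE, trace_add, trace_smul, trace_smul, trace_vecMulVec, trace_vecMulVec, dotProduct_comm x,
      dotProduct_comm y, ← hs, ← ht, smul_eq_mul, smul_eq_mul, inv_mul_cancel₀ hs0,
      inv_mul_cancel₀ ht0]
    norm_num
  -- `E` projects onto the span of `x` and `y`, and the trace of `V` on the complement is `≥ 0`.
  have h1 : 0 ≤ ((1 - E)ᴴ * matV z * (1 - E)).trace :=
    (hV.conjTranspose_mul_mul_same (1 - E)).trace_nonneg
  have h2 : ((1 - E)ᴴ * matV z * (1 - E)).trace = (matV z).trace - 2 * l := by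
    have h3 : (1 - E) * (1 - E)ᴴ = 1 - E := by
      rw [conjTranspose_sub, conjTranspose_one, hEH]
      simp only [Matrix.mul_sub, Matrix.sub_mul, Matrix.one_mul, Matrix.mul_one, hEE]
      abel
    rw [trace_mul_comm, ← Matrix.mul_assoc, h3, trace_mul_comm, Matrix.mul_sub, Matrix.mul_one,
      hVE, trace_sub, trace_smul, htrE, smul_eq_mul, _root_.mul_comm]
  rw [h2] at h1
  have h4 := (Complex.nonneg_iff.1 h1).1
  simp at h4
  linarith

/-- All eigenvalues of `V` are at most half the trace, so that `tr V² ≤ (tr V)² / 2`. -/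
theorem two_mul_trace_sq_le_of_det_ne_zero {z : Matrix (Fin n) (Fin n) ℂ} (hz : zᵀ = -z)
    (hdet : z.det ≠ 0) (hV : (matV z).PosSemidef) :
    2 * ((matV z) ^ 2).trace.re ≤ (matV z).trace.re ^ 2 := by
  have h1 := hV.isHermitian.trace_pow 1
  have h2 := hV.isHermitian.trace_pow 2
  rw [pow_one] at h1
  have hle : ∀ i, 2 * hV.isHermitian.eigenvalues i ≤ (matV z).trace.re := fun i => by
    refine two_mul_eigenvalue_le_trace hz hdet hV
      (x := WithLp.ofLp (hV.isHermitian.eigenvectorBasis i)) (fun h => ?_)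
      (hV.isHermitian.mulVec_eigenvectorBasis i)
    refine hV.isHermitian.eigenvectorBasis.orthonormal.ne_zero i ?_
    ext j
    exact congrFun h j
  have h0 : ∀ i, 0 ≤ hV.isHermitian.eigenvalues i := hV.eigenvalues_nonneg
  have h3 : (matV z).trace.re = ∑ i, hV.isHermitian.eigenvalues i := by
    rw [h1, Complex.ofReal_re]
    simp
  rw [h2, Complex.ofReal_re, sq ((matV z).trace.re)]
  calc 2 * ∑ i, hV.isHermitian.eigenvalues i ^ 2
      ≤ ∑ i, (matV z).trace.re * hV.isHermitian.eigenvalues i := by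
        rw [Finset.mul_sum]
        exact Finset.sum_le_sum fun i _ => by nlinarith [hle i, h0 i]
    _ = _ := by rw [← Finset.mul_sum, ← h3]

/-- In even dimension there are invertible antisymmetric matrices. -/
theorem exists_skew_det_ne_zero (hn : Even n) :
    ∃ J : Matrix (Fin n) (Fin n) ℂ, Jᵀ = -J ∧ J.det ≠ 0 := by
  have hrev : ∀ i : Fin n, i.rev ≠ i := fun i h => by
    have := congrArg Fin.val h
    rw [Fin.val_rev] at this
    obtain ⟨k, hk⟩ := hn
    have := i.2
    lia
  set J : Matrix (Fin n) (Fin n) ℂ :=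
    Matrix.of fun i j => if j = i.rev then (if i < j then 1 else -1) else 0 with hJ
  have hJapp : ∀ i j, J i j = if j = i.rev then (if i < j then 1 else -1) else 0 := fun _ _ => rfl
  have hJt : Jᵀ = -J := by
    ext i j
    rw [transpose_apply, neg_apply, hJapp, hJapp]
    by_cases h : i = j.rev
    · have h' : j = i.rev := by rw [h, Fin.rev_rev]
      rw [if_pos h, if_pos h']
      have hne : i ≠ j := fun e => hrev j (by rw [← h, e])
      rcases lt_or_gt_of_ne hne with h1 | h1
      · rw [if_pos h1, if_neg h1.not_gt]
      · rw [if_pos h1, if_neg h1.not_gt, neg_neg]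
    · have h' : ¬ j = i.rev := fun e => h (by rw [e, Fin.rev_rev])
      rw [if_neg h, if_neg h', neg_zero]
  refine ⟨J, hJt, fun h0 => ?_⟩
  have h1 : J * Jᵀ = 1 := by
    ext i k
    simp only [mul_apply, hJapp, transpose_apply, ite_mul, zero_mul, Finset.sum_ite_eq',
      Finset.mem_univ, if_true, one_apply, Fin.rev_inj]
    by_cases h : i = k
    · subst h
      rw [if_pos rfl, if_pos rfl]
      split_ifs <;> norm_num
    · rw [if_neg h, if_neg h]
      split_ifs <;> simp
  have h2 := congrArg det h1
  rw [det_mul, h0, zero_mul, det_one] at h2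
  exact zero_ne_one h2

/-- By density of the invertible antisymmetric matrices, which exist in even dimension only. -/
theorem two_mul_trace_sq_le {z : Matrix (Fin n) (Fin n) ℂ} (hn : Even n) (hz : zᵀ = -z)
    (hV : (matV z).PosDef) : 2 * ((matV z) ^ 2).trace.re ≤ (matV z).trace.re ^ 2 := by
  obtain ⟨J, hJ, hJdet⟩ := exists_skew_det_ne_zero hn
  have hJu : IsUnit J.det := isUnit_iff_ne_zero.2 hJdet
  have hcont : Continuous fun t : ℂ => z + t • J := by fun_prop
  have htend : Tendsto (fun t : ℂ => z + t • J) (𝓝[≠] 0) (𝓝 z) := by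
    have := hcont.tendsto 0
    rw [zero_smul, add_zero] at this
    exact this.mono_left nhdsWithin_le_nhds
  have hinv : ∀ᶠ t : ℂ in 𝓝[≠] 0, (z + t • J).det ≠ 0 := by
    have hfin := Polynomial.finite_setOfPred_isRoot (charpoly_monic (-(J⁻¹ * z))).ne_zero
    have h1 : ∀ᶠ t : ℂ in 𝓝[≠] 0, t ∉ {t | (charpoly (-(J⁻¹ * z))).IsRoot t} \ {0} :=
      nhdsWithin_le_nhds ((hfin.subset Set.sdiff_subset).isClosed.isOpen_compl.mem_nhds (by simp))
    filter_upwards [h1, self_mem_nhdsWithin] with t ht ht0 hdet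
    refine ht ⟨?_, ht0⟩
    have h2 : z + t • J = J * (scalar (Fin n) t - -(J⁻¹ * z)) := by
      rw [sub_neg_eq_add, Matrix.mul_add, mul_nonsing_inv_cancel_left _ _ hJu, scalar_apply,
        ← smul_one_eq_diagonal, Matrix.mul_smul, Matrix.mul_one, _root_.add_comm]
    rw [h2, det_mul, mul_eq_zero, or_iff_right hJdet] at hdet
    rw [Set.mem_ofPred_eq, Polynomial.IsRoot, eval_charpoly, hdet]
  have hpos : ∀ᶠ t : ℂ in 𝓝[≠] 0, (matV (z + t • J)).PosDef :=
    htend.eventually (isOpen_posDef_matV.mem_nhds hV)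
  have hVt : Tendsto (fun t : ℂ => matV (z + t • J)) (𝓝[≠] 0) (𝓝 (matV z)) :=
    (continuous_matV.tendsto z).comp htend
  have hc1 : Continuous fun X : Matrix (Fin n) (Fin n) ℂ => 2 * (X ^ 2).trace.re :=
    continuous_const.mul (Complex.continuous_re.comp (continuous_pow 2).matrix_trace)
  have hc2 : Continuous fun X : Matrix (Fin n) (Fin n) ℂ => X.trace.re ^ 2 :=
    (Complex.continuous_re.comp continuous_id.matrix_trace).pow 2
  refine le_of_tendsto_of_tendsto ((hc1.tendsto _).comp hVt) ((hc2.tendsto _).comp hVt) ?_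
  filter_upwards [hinv, hpos] with t h1 h2
  exact two_mul_trace_sq_le_of_det_ne_zero
    (by rw [transpose_add, transpose_smul, hz, hJ, smul_neg, neg_add]) h1 h2.posSemidef

end SkewTrace

/-! ### The space of all matrices -/

section AllMatrices

open Matrix

variable {m n : ℕ}

/-- The squared norms of the frame `C E_{jα} D` add up to `tr V · tr W`. -/
theorem IsSqrtPair.sum_trace_frame {a : Matrix (Fin m) (Fin n) ℂ} {C : Matrix (Fin m) (Fin m) ℂ}
    {D : Matrix (Fin n) (Fin n) ℂ} (h : IsSqrtPair a C D) :
    ∑ j : Fin m, ∑ α : Fin n,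
      ((C * matUnit j α * D) * (C * matUnit j α * D)ᴴ).trace
      = (matV a).trace * (matW a).trace := by
  have h1 : ∀ (j : Fin m) (α : Fin n), ((C * matUnit j α * D) * (C * matUnit j α * D)ᴴ).trace
      = (matV a) j j * (matW a) α α := fun j α => by
    rw [conjTranspose_mul, conjTranspose_mul, h.conjTranspose_left, h.conjTranspose_right,
      trace_mul_comm, ← h.sq_left, ← h.sq_right, conjTranspose_single, star_one]
    have h2 : D * (matUnit α j * C) * (C * matUnit j α * D)
        = D * (matUnit α j * (C * C) * matUnit j α) * D := by
      simp only [Matrix.mul_assoc]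
    rw [h2, single_mul_mul_single, one_mul, mul_one, trace_mul_comm, ← Matrix.mul_assoc,
      trace_mul_single]
    simp [_root_.mul_comm]
  simp only [h1, ← Finset.mul_sum, ← Finset.sum_mul]
  rfl

theorem det_matW (z : Matrix (Fin m) (Fin n) ℂ) : (matW z).det = (matV z).det := by
  rw [matW, matV, det_one_sub_mul_comm]

theorem trace_matW (z : Matrix (Fin m) (Fin n) ℂ) : (matW z).trace = n - m + (matV z).trace := by
  rw [matW, matV, trace_sub, trace_sub, trace_one, trace_one, trace_mul_comm, Fintype.card_fin,
    Fintype.card_fin]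
  ring

/-- The determinant of `X ↦ C X D`. -/
theorem det_sandwich {C : Matrix (Fin m) (Fin m) ℂ} {D : Matrix (Fin n) (Fin n) ℂ}
    (T : (Fin m × Fin n → ℂ) →ₗ[ℂ] (Fin m × Fin n → ℂ))
    (hT : ∀ v p, T v p = (C * matI v * D) p.1 p.2) :
    LinearMap.det T = C.det ^ n * D.det ^ m := by
  have h1 : T = toLin' (kroneckerMap (· * ·) C Dᵀ) := by
    refine LinearMap.ext fun v => funext fun p => ?_
    rw [hT, toLin'_apply]
    simp only [mul_apply, mulVec, dotProduct, kroneckerMap_apply, transpose_apply,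
      Fintype.sum_prod_type, Finset.sum_mul, matI, of_apply]
    rw [Finset.sum_comm]
    exact Finset.sum_congr rfl fun _ _ => Finset.sum_congr rfl fun _ _ => by ring
  rw [h1, LinearMap.det_toLin']
  have := det_kronecker C Dᵀ
  rw [Fintype.card_fin, Fintype.card_fin, det_transpose] at this
  exact this

/-- The data of the domain `I(m,n)`, of genus `m + n`. -/
noncomputable def cartanI (m n : ℕ) (hm : 0 < m) (hmn : m ≤ n) :
    CartanData (Fin m × Fin n) m n where
  toMat := { toFun := matI, map_add' := fun _ _ => rfl, map_smul' := fun _ _ => rfl }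
  ofMat :=
    { toFun := fun X p => X p.1 p.2
      map_add' := fun _ _ => rfl
      map_smul' := fun _ _ => rfl }
  c := 1
  c_pos := one_pos
  ofMat_toMat := fun x => by
    rw [Complex.ofReal_one, one_smul]
    rfl
  trace_toMat_mul := fun x X => by
    rw [Complex.ofReal_one, one_mul]
    rfl
  p := m + n
  p_pos := by lia
  exists_sqrt := fun x hx => by
    obtain ⟨U, μ, -, -, hC, hCC, -⟩ := hx.exists_sqrt
    obtain ⟨U', μ', -, -, hD, hDD, -⟩ := (posDef_matW hx).exists_sqrt
    set C := U * diagonal (fun i => (μ i : ℂ)) * Uᴴ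
    set D := U' * diagonal (fun i => (μ' i : ℂ)) * U'ᴴ
    refine ⟨C, D, ⟨hC, hD, hCC, hDD⟩, fun _ => rfl, fun T hT => ?_⟩
    have h1 : LinearMap.det T = C.det ^ n * D.det ^ m := det_sandwich T fun v p => by
      rw [hT, Complex.ofReal_one, inv_one, one_smul]
      rfl
    set d := (matV (matI x)).det with hd
    have hre : ‖d‖ = d.re := (Complex.re_eq_norm.2 hx.det_pos.le).symm
    have hC2 : ‖C.det‖ ^ 2 = d.re := by
      rw [← hre, sq, ← norm_mul, ← det_mul, hCC]
      rfl
    have hD2 : ‖D.det‖ ^ 2 = d.re := by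
      rw [← hre, sq, ← norm_mul, ← det_mul, hDD, det_matW]
      rfl
    rw [h1, norm_mul, norm_pow, norm_pow, mul_pow, ← pow_mul, ← pow_mul, _root_.mul_comm n,
      _root_.mul_comm m, pow_mul, pow_mul, hC2, hD2, ← pow_add, _root_.add_comm n]
    rfl
  exists_toMat_eq := fun x y _ => ⟨fun p => ((matI y : Matrix (Fin m) (Fin n) ℂ) *
    (1 + (matI x : Matrix (Fin m) (Fin n) ℂ)ᴴ * matI y)⁻¹ : Matrix (Fin m) (Fin n) ℂ) p.1 p.2, rfl⟩
  isAdmissible_inv := fun _ _ _ _ => rfl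
  kappa := 1
  kappa_pos := one_pos
  kappa_le := fun x C D h _ => by
    have h1 := congrArg Complex.re h.sum_trace_frame
    simp only [Complex.re_sum] at h1
    refine le_of_le_of_eq ?_ h1.symm
    have h2 := (Complex.nonneg_iff.1 h.posDef_matV.posSemidef.trace_nonneg)
    have h3 : (m : ℝ) ≤ n := by exact_mod_cast hmn
    rw [trace_matW, Complex.mul_re, ← h2.2]
    simp only [Complex.add_re, Complex.sub_re, Complex.natCast_re, zero_mul, sub_zero]
    nlinarith [h2.1]

theorem sys_cartanI (hm : 0 < m) (hmn : m ≤ n) (j k : Fin m) (u : (Fin m × Fin n → ℂ) → ℂ)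
    (x : Fin m × Fin n → ℂ) : (cartanI m n hm hmn).sys j k u x = sysI j k u x := by
  have hdir : ∀ (j : Fin m) (α : Fin n), (cartanI m n hm hmn).dir j α = Pi.single (j, α) 1 := by
    intro j α
    ext p
    change single j α (1 : ℂ) p.1 p.2 = _
    rw [single_apply, Pi.single_apply]
    congr 1
    rw [Prod.ext_iff]
    exact propext ⟨fun h => ⟨h.1.symm, h.2.symm⟩, fun h => ⟨h.1.symm, h.2.symm⟩⟩
  refine Finset.sum_congr rfl fun α _ => Finset.sum_congr rfl fun β _ => ?_
  rw [hdir, hdir]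
  congr 1
  change matW (matI x) β α = _
  simp only [matW, kron, Matrix.sub_apply, one_apply, mul_apply, conjTranspose_apply,
    RCLike.star_def, eq_comm (a := β)]
  congr 1
  exact Finset.sum_congr rfl fun l _ => _root_.mul_comm _ _

end AllMatrices

/-! ### Spaces of symmetric and antisymmetric matrices -/

section Transpose

open Matrix

variable {ι : Type*} [Fintype ι] [DecidableEq ι] {n : ℕ}

/-- A parametrization of the matrices `z` with `zᵗ = ε z`, `ε = ±1`, normalized by
`toMat (ofMat X) = X + ε Xᵗ`. -/
structure TransposeModel (ι : Type*) [Fintype ι] [DecidableEq ι] (n : ℕ) where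
  ε : ℂ
  toMat : (ι → ℂ) →ₗ[ℂ] Matrix (Fin n) (Fin n) ℂ
  ofMat : Matrix (Fin n) (Fin n) ℂ →ₗ[ℂ] (ι → ℂ)
  ε_eq : ε = 1 ∨ ε = -1
  ofMat_toMat : ∀ x, ofMat (toMat x) = (2 : ℂ) • x
  toMat_ofMat : ∀ X, toMat (ofMat X) = X + ε • Xᵀ

namespace TransposeModel

variable (S : TransposeModel ι n)

theorem ε_mul_self : S.ε * S.ε = 1 := by rcases S.ε_eq with h | h <;> simp [h]

theorem conj_ε : conj S.ε = S.ε := by rcases S.ε_eq with h | h <;> simp [h]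

theorem transpose_toMat (x : ι → ℂ) : (S.toMat x)ᵀ = S.ε • S.toMat x := by
  have h1 := S.toMat_ofMat (S.toMat x)
  rw [S.ofMat_toMat, map_smul, two_smul] at h1
  have h2 : S.toMat x = S.ε • (S.toMat x)ᵀ := add_left_cancel h1
  conv_rhs => rw [h2]
  rw [smul_smul, S.ε_mul_self, one_smul]

theorem matW_toMat (x : ι → ℂ) : matW (S.toMat x) = (matV (S.toMat x))ᵀ := by
  rw [matW, matV, transpose_sub, transpose_one, transpose_mul, conjTranspose_transpose_comm,
    S.transpose_toMat, conjTranspose_smul, Matrix.smul_mul, Matrix.mul_smul, smul_smul,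
    RCLike.star_def, S.conj_ε, S.ε_mul_self, one_smul]

theorem isAdmissible (A : Matrix (Fin n) (Fin n) ℂ) :
    IsAdmissible (fun X => S.toMat (S.ofMat X)) A Aᵀ := fun X => by
  simp only [S.toMat_ofMat, transpose_mul, transpose_transpose, Matrix.mul_add, Matrix.add_mul,
    Matrix.mul_smul, Matrix.smul_mul, Matrix.mul_assoc]

theorem toMat_ofMat_mul_toMat_mul (A : Matrix (Fin n) (Fin n) ℂ) (x : ι → ℂ) :
    S.toMat (S.ofMat (A * S.toMat x * Aᵀ)) = (2 : ℂ) • (A * S.toMat x * Aᵀ) := by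
  have := S.isAdmissible A (S.toMat x)
  simp only [S.ofMat_toMat, map_smul] at this
  rw [this, Matrix.mul_smul, Matrix.smul_mul]

/-- The linear map `z ↦ A z Aᵗ`, in coordinates. -/
noncomputable def congruence (A : Matrix (Fin n) (Fin n) ℂ) : (ι → ℂ) →ₗ[ℂ] (ι → ℂ) where
  toFun x := (2 : ℂ)⁻¹ • S.ofMat (A * S.toMat x * Aᵀ)
  map_add' x y := by
    rw [map_add, Matrix.mul_add, Matrix.add_mul, map_add, smul_add]
  map_smul' c x := by
    rw [map_smul, Matrix.mul_smul, Matrix.smul_mul, map_smul, smul_comm, RingHom.id_apply]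

theorem congruence_apply (A : Matrix (Fin n) (Fin n) ℂ) (x : ι → ℂ) :
    S.congruence A x = (2 : ℂ)⁻¹ • S.ofMat (A * S.toMat x * Aᵀ) := rfl

theorem toMat_congruence (A : Matrix (Fin n) (Fin n) ℂ) (x : ι → ℂ) :
    S.toMat (S.congruence A x) = A * S.toMat x * Aᵀ := by
  rw [congruence_apply, map_smul, S.toMat_ofMat_mul_toMat_mul, inv_smul_smul₀ two_ne_zero]

theorem congruence_mul (A B : Matrix (Fin n) (Fin n) ℂ) :
    S.congruence (A * B) = S.congruence A ∘ₗ S.congruence B := by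
  refine LinearMap.ext fun x => ?_
  rw [LinearMap.comp_apply, S.congruence_apply A, toMat_congruence, congruence_apply, transpose_mul]
  simp only [Matrix.mul_assoc]

theorem congruence_one : S.congruence 1 = LinearMap.id := by
  refine LinearMap.ext fun x => ?_
  rw [congruence_apply, transpose_one, Matrix.mul_one, Matrix.one_mul, S.ofMat_toMat,
    inv_smul_smul₀ two_ne_zero, LinearMap.id_apply]

theorem det_congruence_conj {U : Matrix (Fin n) (Fin n) ℂ} (hU : U * Uᴴ = 1)
    (A : Matrix (Fin n) (Fin n) ℂ) :
    LinearMap.det (S.congruence (U * A * Uᴴ)) = LinearMap.det (S.congruence A) := by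
  have h1 : LinearMap.det (S.congruence U) * LinearMap.det (S.congruence Uᴴ) = 1 := by
    rw [← LinearMap.det_comp, ← congruence_mul, hU, congruence_one, LinearMap.det_id]
  rw [congruence_mul, congruence_mul, LinearMap.det_comp, LinearMap.det_comp]
  linear_combination LinearMap.det (S.congruence A) * h1

theorem transpose_one_add (x y : ι → ℂ) :
    (1 + S.toMat y * (S.toMat x)ᴴ)ᵀ = 1 + (S.toMat x)ᴴ * S.toMat y := by
  rw [transpose_add, transpose_one, transpose_mul, conjTranspose_transpose_comm, S.transpose_toMat,
    S.transpose_toMat, conjTranspose_smul, Matrix.smul_mul, Matrix.mul_smul, smul_smul,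
    RCLike.star_def, S.conj_ε, S.ε_mul_self, one_smul]

theorem exists_toMat_eq (x y : ι → ℂ) (hu : IsUnit (1 + (S.toMat x)ᴴ * S.toMat y)) :
    ∃ y', S.toMat y' = S.toMat y * (1 + (S.toMat x)ᴴ * S.toMat y)⁻¹ := by
  refine ⟨(2 : ℂ)⁻¹ • S.ofMat (S.toMat y * (1 + (S.toMat x)ᴴ * S.toMat y)⁻¹), ?_⟩
  have h1 : (S.toMat y * (1 + (S.toMat x)ᴴ * S.toMat y)⁻¹)ᵀ
      = S.ε • (S.toMat y * (1 + (S.toMat x)ᴴ * S.toMat y)⁻¹) := by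
    rw [push_through_inv hu, transpose_mul, transpose_nonsing_inv, transpose_one_add,
      S.transpose_toMat, Matrix.smul_mul, push_through_inv hu]
  rw [map_smul, S.toMat_ofMat, h1, smul_smul, S.ε_mul_self, one_smul, ← two_smul ℂ,
    inv_smul_smul₀ two_ne_zero]

/-- The squared norms of the frame `C (E_{jα} + ε E_{αj}) D` add up to `2 ((tr V)² + ε tr V²)`. -/
theorem sum_trace_frame {x : ι → ℂ} {C D : Matrix (Fin n) (Fin n) ℂ}
    (h : IsSqrtPair (S.toMat x) C D) (hadm : IsAdmissible (fun X => S.toMat (S.ofMat X)) C D) :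
    ∑ j : Fin n, ∑ α : Fin n, ((C * S.toMat (S.ofMat (matUnit j α)) * D) *
        (C * S.toMat (S.ofMat (matUnit j α)) * D)ᴴ).trace
      = 2 * ((matV (S.toMat x)).trace ^ 2 + S.ε * (matV (S.toMat x) ^ 2).trace) := by
  set V := matV (S.toMat x) with hV
  have hW : D * Dᴴ = Vᵀ := by rw [h.conjTranspose_right, h.sq_right, S.matW_toMat]
  have hW' : Dᴴ * D = Vᵀ := by rw [h.conjTranspose_right, h.sq_right, S.matW_toMat]
  have hC : C * Cᴴ = V := by rw [h.conjTranspose_left, h.sq_left]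
  have h1 : ∀ j α : Fin n, ((C * S.toMat (S.ofMat (matUnit j α)) * D) *
        (C * S.toMat (S.ofMat (matUnit j α)) * D)ᴴ).trace
      = 2 * (((C * matUnit j α * D) * (C * matUnit j α * D)ᴴ).trace
        + S.ε * ((C * matUnit j α * D) * (C * matUnit j α * D)ᵀᴴ).trace) := fun j α => by
    have e0 : C * S.toMat (S.ofMat (matUnit j α)) * D
        = C * matUnit j α * D + S.ε • (C * matUnit j α * D)ᵀ :=
      (hadm (matUnit j α)).symm.trans (S.toMat_ofMat _)
    rw [e0]
    set Y := C * matUnit j α * D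
    have e1 : (Yᵀ * Yᵀᴴ).trace = (Y * Yᴴ).trace := by
      rw [← conjTranspose_transpose_comm, ← transpose_mul, trace_transpose, trace_mul_comm]
    have e2 : (Yᵀ * Yᴴ).trace = (Y * Yᵀᴴ).trace := by
      rw [← trace_transpose, transpose_mul, transpose_transpose, conjTranspose_transpose_comm,
        trace_mul_comm]
    rw [conjTranspose_add, conjTranspose_smul, RCLike.star_def, S.conj_ε, Matrix.add_mul,
      Matrix.mul_add, Matrix.mul_add, Matrix.mul_smul, Matrix.smul_mul, Matrix.smul_mul,
      Matrix.mul_smul, smul_smul, S.ε_mul_self, one_smul, trace_add, trace_add, trace_add,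
      trace_smul, trace_smul, e1, e2, smul_eq_mul]
    ring
  have h2 : ∑ j : Fin n, ∑ α : Fin n,
      ((C * matUnit j α * D) * (C * matUnit j α * D)ᵀᴴ).trace = (V ^ 2).trace := by
    have e1 : ∀ j α a b : Fin n, (C * matUnit j α * D) a b = C a j * D α b := fun j α a b => by
      rw [single_conj_eq_sum]
      simp [Matrix.sum_apply, Matrix.single_apply, ite_and]
    have e2 : ∀ j α : Fin n, ((C * matUnit j α * D) * (C * matUnit j α * D)ᵀᴴ).trace
        = ∑ a, ∑ b, (C a j * Cᴴ j b) * (Dᴴ a α * D α b) := fun j α => by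
      rw [trace]
      refine Finset.sum_congr rfl fun a _ => ?_
      rw [diag_apply, mul_apply]
      refine Finset.sum_congr rfl fun b _ => ?_
      rw [conjTranspose_apply, transpose_apply, e1, e1, conjTranspose_apply, conjTranspose_apply,
        star_mul]
      ring
    simp only [e2]
    rw [sq]
    change _ = ∑ a, (V * V) a a
    have hVV : ∀ a, (V * V) a a = ∑ b, V a b * V b a := fun a => Matrix.mul_apply
    simp only [hVV]
    rw [Finset.sum_congr rfl fun j _ => Finset.sum_comm, Finset.sum_comm]
    refine Finset.sum_congr rfl fun a _ => ?_
    rw [Finset.sum_congr rfl fun j _ => Finset.sum_comm, Finset.sum_comm]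
    refine Finset.sum_congr rfl fun b _ => ?_
    have e3 : V a b = ∑ j, C a j * Cᴴ j b := by rw [← hC, mul_apply]
    have e4 : V b a = ∑ α, Dᴴ a α * D α b := by rw [← transpose_apply V, ← hW', mul_apply]
    rw [e3, e4, Finset.sum_mul_sum]
  simp only [h1, ← Finset.mul_sum, Finset.sum_add_distrib, h2, h.sum_trace_frame]
  rw [S.matW_toMat, trace_transpose, ← sq, hV]

/-- The data of the domain of the matrices `z` with `zᵗ = ε z` and `V(z) > 0`. The multipliers `d`
are the eigenvalues of `z ↦ diag(μ) z diag(μ)`. -/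
noncomputable def cartanData (p : ℕ) (hp : 0 < p)
    (hdet : ∀ μ : Fin n → ℝ, (∀ i, 0 < μ i) → ∃ d : ι → ℝ,
      (∀ x i, S.ofMat (diagonal (fun i => (μ i : ℂ)) * S.toMat x * diagonal (fun i => (μ i : ℂ))) i
        = 2 * d i * x i) ∧ (∏ i, d i) ^ 2 = (∏ i, μ i ^ 2) ^ p)
    (htr : ∀ x, (matV (S.toMat x)).PosDef → (matV (S.toMat x)).trace.re ^ 2
      ≤ 2 * ((matV (S.toMat x)).trace.re ^ 2 + (S.ε * (matV (S.toMat x) ^ 2).trace).re)) :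
    CartanData ι n n where
  toMat := S.toMat
  ofMat := S.ofMat
  c := 2
  c_pos := two_pos
  ofMat_toMat := fun x => by rw [S.ofMat_toMat, Complex.ofReal_ofNat]
  trace_toMat_mul := fun x X => by
    have h1 : (S.toMat x * Xᵀᴴ).trace = S.ε * (S.toMat x * Xᴴ).trace := by
      rw [← trace_transpose, transpose_mul, ← conjTranspose_transpose_comm, transpose_transpose,
        S.transpose_toMat, Matrix.mul_smul, trace_smul, trace_mul_comm, smul_eq_mul]
    rw [S.toMat_ofMat, conjTranspose_add, conjTranspose_smul, Matrix.mul_add, Matrix.mul_smul,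
      trace_add, trace_smul, h1, smul_eq_mul, RCLike.star_def, S.conj_ε, ← _root_.mul_assoc,
      S.ε_mul_self, Complex.ofReal_ofNat]
    ring
  p := p
  p_pos := hp
  exists_sqrt := fun x hx => by
    obtain ⟨U, μ, hU, hμ, hC, hCC, hVdet⟩ := hx.exists_sqrt
    refine ⟨_, (U * diagonal (fun i => (μ i : ℂ)) * Uᴴ)ᵀ, ⟨hC, hC.transpose, hCC, ?_⟩,
      S.isAdmissible _, fun T hT => ?_⟩
    · rw [← transpose_mul, hCC, S.matW_toMat]
    · obtain ⟨d, hd, hdp⟩ := hdet μ hμ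
      have h1 : T = S.congruence (U * diagonal (fun i => (μ i : ℂ)) * Uᴴ) :=
        LinearMap.ext fun v => by rw [hT, congruence_apply, Complex.ofReal_ofNat]
      have h2 : S.congruence (diagonal fun i => (μ i : ℂ))
          = toLin' (diagonal fun i => (d i : ℂ)) := by
        refine LinearMap.ext fun v => funext fun i => ?_
        rw [congruence_apply, diagonal_transpose, Pi.smul_apply, hd, toLin'_apply, mulVec_diagonal,
          smul_eq_mul]
        ring
      rw [h1, S.det_congruence_conj hU, h2, LinearMap.det_toLin', det_diagonal,
        ← Complex.ofReal_prod, Complex.norm_real, Real.norm_eq_abs, sq_abs, hdp, hVdet]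
  exists_toMat_eq := S.exists_toMat_eq
  isAdmissible_inv := fun x y _ => by
    rw [← S.transpose_one_add, ← transpose_nonsing_inv]
    exact S.isAdmissible _
  kappa := 1
  kappa_pos := one_pos
  kappa_le := fun x C D h hadm => by
    have h1 := congrArg Complex.re (S.sum_trace_frame h hadm)
    simp only [Complex.re_sum] at h1
    refine le_of_le_of_eq ?_ h1.symm
    have h2 := (Complex.nonneg_iff.1 h.posDef_matV.posSemidef.trace_nonneg)
    have h3 := htr x h.posDef_matV
    rw [one_mul, sq (matV (S.toMat x)).trace, ← Complex.ofReal_ofNat, Complex.re_ofReal_mul,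
      Complex.add_re, Complex.mul_re, ← h2.2, mul_zero, sub_zero, ← sq]
    exact h3

end TransposeModel

end Transpose

/-! ### Symmetric and antisymmetric coordinates -/

section Coordinates

open Matrix

variable {n : ℕ}

theorem prod_skewIdx_eq (μ : Fin n → ℝ) : ∏ p : SkewIdx n, μ p.1.1 * μ p.1.2
    = ∏ p : Fin n × Fin n, if p.1 < p.2 then μ p.1 * μ p.2 else 1 := by
  rw [← Finset.prod_filter]
  exact (Finset.prod_subtype _ (by simp) fun p : Fin n × Fin n => μ p.1 * μ p.2).symm

theorem prod_sq_eq (μ : Fin n → ℝ) :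
    ∏ i, μ i ^ 2 = ∏ p : Fin n × Fin n, if p.1 = p.2 then μ p.1 * μ p.2 else 1 := by
  rw [Fintype.prod_prod_type]
  simp [sq]

/-- Over the pairs `i < j`, the products `μ_i μ_j` multiply to the power `(n-1)/2` of `∏ μ_i²`. -/
theorem prod_lt_sq (hn : 0 < n) {μ : Fin n → ℝ} (hμ : ∀ i, 0 < μ i) :
    (∏ p : SkewIdx n, μ p.1.1 * μ p.1.2) ^ 2 = (∏ i, μ i ^ 2) ^ (n - 1) := by
  set f : Fin n × Fin n → ℝ := fun p => μ p.1 * μ p.2 with hf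
  have hlt := prod_skewIdx_eq μ
  have hgt : (∏ p : Fin n × Fin n, if p.1 < p.2 then f p else 1)
      = ∏ p : Fin n × Fin n, if p.2 < p.1 then f p else 1 := by
    refine Fintype.prod_equiv (Equiv.prodComm _ _) _ _ fun p => ?_
    simp [hf, _root_.mul_comm]
  have hdiag := prod_sq_eq μ
  have hall : ∏ p, f p = (∏ i, μ i ^ 2) ^ n := by
    rw [Fintype.prod_prod_type]
    simp only [hf, Finset.prod_mul_distrib, Finset.prod_const, Finset.card_univ, Fintype.card_fin,
      Finset.prod_pow]
    ring
  have hsplit : (∏ p : SkewIdx n, μ p.1.1 * μ p.1.2) ^ 2 * ∏ i, μ i ^ 2 = (∏ i, μ i ^ 2) ^ n := by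
    rw [← hall, sq]
    conv_lhs => enter [1, 2]; rw [hlt, hgt]
    rw [hlt, hdiag, ← Finset.prod_mul_distrib, ← Finset.prod_mul_distrib]
    refine Finset.prod_congr rfl fun p _ => ?_
    rcases lt_trichotomy p.1 p.2 with h | h | h
    · simp [hf, h, h.ne, h.not_gt]
    · simp [hf, h]
    · simp [h, h.ne', h.not_gt]
  have h0 : ∏ i, μ i ^ 2 ≠ 0 := (Finset.prod_pos fun i _ => pow_pos (hμ i) 2).ne'
  refine mul_right_cancel₀ h0 ?_
  rw [hsplit, ← pow_succ, Nat.sub_add_cancel hn]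

/-- Over the pairs `i ≤ j`, the products `μ_i μ_j` multiply to the power `(n+1)/2` of `∏ μ_i²`. -/
theorem prod_sym2_sq (hn : 0 < n) {μ : Fin n → ℝ} (hμ : ∀ i, 0 < μ i) :
    (∏ s : Sym2 (Fin n), Sym2.lift ⟨fun i j => μ i * μ j, fun _ _ => _root_.mul_comm _ _⟩ s) ^ 2
      = (∏ i, μ i ^ 2) ^ (n + 1) := by
  set f : Fin n × Fin n → ℝ := fun p => μ p.1 * μ p.2 with hf
  have h1 : ∏ s : Sym2 (Fin n), Sym2.lift ⟨fun i j => μ i * μ j, fun _ _ => _root_.mul_comm _ _⟩ s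
      = ∏ p : {p : Fin n × Fin n // p.1 ≤ p.2}, f p.1 := by
    refine (Fintype.prod_equiv Sym2.sortEquiv.symm _ _ fun p => ?_).symm
    rfl
  have h2 : ∏ p : {p : Fin n × Fin n // p.1 ≤ p.2}, f p.1
      = ∏ p : Fin n × Fin n, if p.1 ≤ p.2 then f p else 1 := by
    rw [← Finset.prod_filter]
    exact (Finset.prod_subtype _ (by simp) f).symm
  have hlt := prod_skewIdx_eq μ
  have hdiag := prod_sq_eq μ
  have h3 : ∏ p : Fin n × Fin n, (if p.1 ≤ p.2 then f p else 1)
      = (∏ p : SkewIdx n, μ p.1.1 * μ p.1.2) * ∏ i, μ i ^ 2 := by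
    rw [hlt, hdiag, ← Finset.prod_mul_distrib]
    refine Finset.prod_congr rfl fun p _ => ?_
    rcases lt_trichotomy p.1 p.2 with h | h | h
    · simp [hf, h, h.ne, h.le]
    · simp [hf, h]
    · simp [h.not_ge, h.ne', h.not_gt]
  rw [h1, h2, h3, mul_pow, prod_lt_sq hn hμ, ← pow_add]
  congr 1
  lia

/-- Symmetric matrices, with the coordinates `z_{jα} = z_{αj}`. -/
def symmModel (n : ℕ) : TransposeModel (Sym2 (Fin n)) n where
  ε := 1
  toMat := { toFun := matII, map_add' := fun _ _ => rfl, map_smul' := fun _ _ => rfl }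
  ofMat :=
    { toFun := fun X => Sym2.lift ⟨fun i j => X i j + X j i, fun _ _ => _root_.add_comm _ _⟩
      map_add' := fun X Y => funext fun s => s.ind fun i j => by
        simp only [Sym2.lift_mk, Pi.add_apply, Matrix.add_apply]
        ring
      map_smul' := fun c X => funext fun s => s.ind fun i j => by
        simp [mul_add] }
  ε_eq := Or.inl rfl
  ofMat_toMat := fun x => funext fun s => s.ind fun i j => by
    change x s(i, j) + x s(j, i) = 2 * x s(i, j)
    rw [Sym2.eq_swap (a := j), two_mul]
  toMat_ofMat := fun X => by
    ext i j
    exact congrArg (X i j + ·) (one_mul (X j i)).symm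

/-- Antisymmetric matrices, with the coordinates `z_{jα} = -z_{αj}`, `j < α`. -/
def skewModel (n : ℕ) : TransposeModel (SkewIdx n) n where
  ε := -1
  toMat :=
    { toFun := matIII
      map_add' := fun x y => by
        ext i j
        simp only [matIII, of_apply, Matrix.add_apply, Pi.add_apply]
        split_ifs <;> ring
      map_smul' := fun c x => by
        ext i j
        simp only [matIII, of_apply, Matrix.smul_apply, Pi.smul_apply, smul_eq_mul,
          RingHom.id_apply]
        split_ifs <;> ring }
  ofMat :=
    { toFun := fun X p => X p.1.1 p.1.2 - X p.1.2 p.1.1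
      map_add' := fun X Y => funext fun p => by
        simp only [Pi.add_apply, Matrix.add_apply]
        ring
      map_smul' := fun c X => funext fun p => by
        simp [mul_sub] }
  ε_eq := Or.inr rfl
  ofMat_toMat := fun x => funext fun p => by
    change matIII x p.1.1 p.1.2 - matIII x p.1.2 p.1.1 = _
    have h := p.2
    simp only [matIII, of_apply, h, h.not_gt, dif_pos, dif_neg, not_false_eq_true, Pi.smul_apply,
      smul_eq_mul]
    ring
  toMat_ofMat := fun X => by
    ext i j
    change matIII (fun p => X p.1.1 p.1.2 - X p.1.2 p.1.1) i j = _
    simp only [matIII, of_apply, Matrix.add_apply, Matrix.smul_apply, transpose_apply, smul_eq_mul]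
    split_ifs with h1 h2
    · ring
    · ring
    · rw [le_antisymm (not_lt.1 h2) (not_lt.1 h1)]
      ring

/-- The data of the domain `II(n)`, of genus `n + 1`. -/
noncomputable def cartanII (n : ℕ) (hn : 0 < n) : CartanData (Sym2 (Fin n)) n n :=
  (symmModel n).cartanData (n + 1) n.succ_pos
    (fun μ hμ => ⟨_, fun x s => s.ind fun i j => by
      change (diagonal _ * matII x * diagonal _ : Matrix _ _ ℂ) i j
        + (diagonal _ * matII x * diagonal _ : Matrix _ _ ℂ) j i
        = 2 * ((μ i * μ j : ℝ) : ℂ) * x s(i, j)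
      rw [mul_diagonal, mul_diagonal, diagonal_mul, diagonal_mul, matII, of_apply, of_apply,
        Sym2.eq_swap (a := j)]
      push_cast
      ring, prod_sym2_sq hn hμ⟩)
    fun x hx => by
      have h1 := hx.isHermitian.trace_pow 2
      have h2 : 0 ≤ ((matV ((symmModel n).toMat x)) ^ 2).trace.re := by
        rw [h1, Complex.ofReal_re]
        exact Finset.sum_nonneg fun i _ => sq_nonneg _
      change _ ≤ 2 * (_ + (1 * _ : ℂ).re)
      rw [one_mul]
      nlinarith [sq_nonneg (matV ((symmModel n).toMat x)).trace.re]

/-- The data of the domain `III(n)`, `n` even, of genus `n - 1`. -/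
noncomputable def cartanIII (n : ℕ) (hn : 0 < n) (he : Even n) : CartanData (SkewIdx n) n n :=
  (skewModel n).cartanData (n - 1) (by obtain ⟨k, hk⟩ := he; lia)
    (fun μ hμ => ⟨fun p => μ p.1.1 * μ p.1.2, fun x p => by
      change (diagonal _ * matIII x * diagonal _ : Matrix _ _ ℂ) p.1.1 p.1.2
        - (diagonal _ * matIII x * diagonal _ : Matrix _ _ ℂ) p.1.2 p.1.1 = _
      have h := p.2
      rw [mul_diagonal, mul_diagonal, diagonal_mul, diagonal_mul]
      simp only [matIII, of_apply, h, h.not_gt, dif_pos, dif_neg, not_false_eq_true]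
      push_cast
      ring, prod_lt_sq hn hμ⟩)
    fun x hx => by
      have h1 : ((skewModel n).toMat x)ᵀ = -(skewModel n).toMat x := by
        rw [(skewModel n).transpose_toMat]
        exact neg_one_smul ℂ _
      have h2 := two_mul_trace_sq_le he h1 hx
      change _ ≤ 2 * (_ + (-1 * _ : ℂ).re)
      rw [neg_one_mul, Complex.neg_re]
      linarith

theorem conj_kron (j k : Fin n) : conj (kron j k) = kron j k := by
  rw [kron]
  split_ifs <;> simp

theorem sys_cartanII (hn : 0 < n) (j k : Fin n) {u : (Sym2 (Fin n) → ℂ) → ℂ}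
    {x : Sym2 (Fin n) → ℂ} (hu : ContDiffAt ℝ 2 u x) :
    (cartanII n hn).sys j k u x = sysII j k u x := by
  have hdir : ∀ j α : Fin n,
      (cartanII n hn).dir j α = (1 + kron j α) • Pi.single s(j, α) (1 : ℂ) := by
    intro j α
    refine funext fun s => s.ind fun a b => ?_
    change single j α (1 : ℂ) a b + single j α (1 : ℂ) b a = _
    simp only [single_apply, Pi.smul_apply, Pi.single_apply, kron, smul_eq_mul, Sym2.eq_iff]
    grind
  have hcoef : ∀ j α : Fin n, 1 + kron j α = (1 - kron j α / 2)⁻¹ := by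
    intro j α
    rw [kron]
    split_ifs <;> norm_num
  refine Finset.sum_congr rfl fun α _ => Finset.sum_congr rfl fun β _ => ?_
  rw [hdir, hdir, mixedDeriv_smul_left hu, mixedDeriv_smul_right hu, map_add, map_one, conj_kron,
    hcoef, hcoef]
  have hW : matW ((cartanII n hn).toMat x) β α = matV (matII x) α β := by
    have := congrFun (congrFun ((symmModel n).matW_toMat x) β) α
    exact this
  rw [hW, div_eq_mul_inv (matV (matII x) α β), mul_inv]
  ring

theorem sys_cartanIII (hn : 0 < n) (he : Even n) (j k : Fin n) {u : (SkewIdx n → ℂ) → ℂ}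
    {x : SkewIdx n → ℂ} (hu : ContDiffAt ℝ 2 u x) :
    (cartanIII n hn he).sys j k u x = sysIII j k u x := by
  have hdir : ∀ j α : Fin n,
      (cartanIII n hn he).dir j α = (1 - kron j α) • dirIII j α := by
    intro j α
    funext p
    change single j α (1 : ℂ) p.1.1 p.1.2 - single j α (1 : ℂ) p.1.2 p.1.1 = _
    obtain ⟨⟨a, b⟩, hab⟩ := p
    have hab' : a ≠ b := hab.ne
    simp only [single_apply, Pi.smul_apply, kron, dirIII, smul_eq_mul, Prod.mk.injEq]
    grind
  refine Finset.sum_congr rfl fun α _ => Finset.sum_congr rfl fun β _ => ?_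
  rw [hdir, hdir, mixedDeriv_smul_left hu, mixedDeriv_smul_right hu, map_sub, map_one, conj_kron]
  have hW : matW ((cartanIII n hn he).toMat x) β α = matV (matIII x) α β := by
    have := congrFun (congrFun ((skewModel n).matW_toMat x) β) α
    exact this
  rw [hW]
  ring

end Coordinates

theorem theorem2p2 :
    (∀ (m n : ℕ), 0 < m → m ≤ n → ∀ u : (Fin m × Fin n → ℂ) → ℂ,
      ContDiffOn ℝ 2 u (domI m n) → ContinuousOn u (closure (domI m n)) →
        ((∀ z ∈ domI m n, huaOperator (domI m n) u z = 0) ↔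
          ∀ z ∈ domI m n, ∀ j k : Fin m, sysI j k u z = 0)) ∧
    (∀ n : ℕ, 0 < n → ∀ u : (Sym2 (Fin n) → ℂ) → ℂ,
      ContDiffOn ℝ 2 u (domII n) → ContinuousOn u (closure (domII n)) →
        ((∀ z ∈ domII n, huaOperator (domII n) u z = 0) ↔
          ∀ z ∈ domII n, ∀ j k : Fin n, sysII j k u z = 0)) ∧
    (∀ n : ℕ, 0 < n → Even n → ∀ u : (SkewIdx n → ℂ) → ℂ,
      ContDiffOn ℝ 2 u (domIII n) → ContinuousOn u (closure (domIII n)) →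
        ((∀ z ∈ domIII n, huaOperator (domIII n) u z = 0) ↔
          ∀ z ∈ domIII n, ∀ j k : Fin n, sysIII j k u z = 0)) := by
  refine ⟨fun m n hm hmn u hu hc => ?_, fun n hn u hu hc => ?_, fun n hn he u hu hc => ?_⟩
  · set S := cartanI m n hm hmn with hS
    have hsurj : Function.Surjective S.toMat := fun X => ⟨fun p => X p.1 p.2, rfl⟩
    refine (S.huaOperator_eq_zero_iff_sys_eq_zero (fun w hw hwc hlap j k =>
      S.sys_zero_eq_zero_of_surjective hm hmn hsurj (fun _ _ => rfl) hw hwc hlap j k)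
      hu hc).trans ?_
    exact forall₂_congr fun z _ => forall₂_congr fun j k => by rw [sys_cartanI]
  · set S := cartanII n hn with hS
    refine (S.huaOperator_eq_zero_iff_sys_eq_zero (fun w hw hwc hlap j k =>
      S.sys_zero_eq_zero_of_stabilizer hn (fun _ => (symmModel n).isAdmissible _)
        (fun x hx Ω hΩ => ?_) hw hwc hlap j k) hu hc).trans ?_
    · exact exists_eq_smul_one_of_symm
        (((symmModel n).transpose_toMat x).trans (one_smul ℂ _)) (sub_eq_zero.1 hx).symm hΩ
    · exact forall₂_congr fun z hz => forall₂_congr fun j k => by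
        rw [sys_cartanII hn j k (hu.contDiffAt (S.isOpen_dom.mem_nhds hz))]
  · set S := cartanIII n hn he with hS
    refine (S.huaOperator_eq_zero_iff_sys_eq_zero (fun w hw hwc hlap j k =>
      S.sys_zero_eq_zero_of_stabilizer hn (fun _ => (skewModel n).isAdmissible _)
        (fun x hx Ω hΩ => ?_) hw hwc hlap j k) hu hc).trans ?_
    · exact exists_eq_smul_one_of_skew
        (((skewModel n).transpose_toMat x).trans (neg_one_smul ℂ _)) (sub_eq_zero.1 hx).symm hΩ
    · exact forall₂_congr fun z hz => forall₂_congr fun j k => by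
        rw [sys_cartanIII hn he j k (hu.contDiffAt (S.isOpen_dom.mem_nhds hz))]
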